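/- A \emph{straight-line program} (SLP) is a nonempty finite sequence of variables $X_0,\dots,X_{m-1}$, each with exactly one rule, which is either $X_k\to a$ with a terminal symbol $a$, or $X_k\to X_\ell X_r$ with $\ell,r<k$. The last variable is the start symbol, so the SLP generates exactly one string $S=s_1s_2\cdots s_N$. The \emph{size} $n$ of the SLP is the total number of symbols in all its rules (left-hand and right-hand sides); in particular $n\ge 2$. The machine model is the unit-cost word RAM: a program is a fixed finite text using finitely many registers and an addressable memory of words, with operations $+$, truncated $-$, $\times$, integer division and comparisons, indirect reading and writing, branching and loops. All numbers must fit into words of $w$ bits, and words have $\Omega(\log(n+N))$ bits; variable indices, positions in $S$ and terminal symbols are single words. The space used is the number of memory cells. \textbf{Lemma.} Random access to the string of an SLP of size $n$ that generates a string of length $N$ can be supported in $O(\log N)$ time after $O(n\log n)$ preprocessing time and space. Precisely: there are two fixed word RAM programs, a preprocessing program and a query program, and constants $C,c$, such that the following holds for every SLP, with $n$, $N$, $S$ as above, and every word length $w\ge c\log_2(n+N)$ for which all terminal symbols of the SLP fit into a word. Given the rules of the SLP in memory, the preprocessing program halts after at most $C\,n\log n$ steps, using at most $C\,n\log n$ memory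 cells (the cells of the input included). From the resulting memory contents, the query program, given any $i$ with $1\le i\le N$, halts after at most $C\,(1+\log N)$ steps with output $s_i$, uses only the same memory cells, and leaves the memory contents unchanged (so that any number of queries can be answered). -/

import Mathlib

/-! ## Straight-line programs -/

/-- The right-hand side of the rule of the `k`-th variable (`k = 0, 1, …`) of a straight-line
program: one terminal symbol, or exactly two variables that precede the `k`-th one.
Terminal symbols are natural numbers (character codes). -/
inductive SLPRule (k : ℕ) : Type
  | terminal (a : ℕ) : SLPRule k
  | pair (l r : Fin k) : SLPRule k

/-- The number of symbols of the rule: the left-hand side and the symbols on the right. -/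
def SLPRule.symbols {k : ℕ} : SLPRule k → ℕ
  | .terminal _ => 2
  | .pair _ _ => 3

/-- A straight-line program: a nonempty finite sequence of variables `X₀, X₁, …`, each with one
rule; the start symbol is the last variable. -/
structure SLP : Type where
  numVars : ℕ
  numVars_pos : 0 < numVars
  rule : (k : Fin numVars) → SLPRule k.val

namespace SLP

/-- The string derived from the variable with index `k`. -/
def expand (G : SLP) (k : ℕ) (hk : k < G.numVars) : List ℕ :=
  match G.rule ⟨k, hk⟩ with
  | .terminal a => [a]
  | .pair l r =>
      expand G l.val (l.isLt.trans hk) ++ expand G r.val (r.isLt.trans hk)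
termination_by k
decreasing_by
  · exact l.isLt
  · exact r.isLt

/-- The string generated by the straight-line program. -/
def word (G : SLP) : List ℕ :=
  G.expand (G.numVars - 1) (Nat.sub_lt G.numVars_pos Nat.one_pos)

/-- The size of the grammar: the total number of symbols in all its rules. -/
def size (G : SLP) : ℕ := ∑ k : Fin G.numVars, (G.rule k).symbols

/-- The three words that describe a rule in the input: `0, a, 0` for the terminal `a`, and
`1, l, r` for a pair of variables. -/
def ruleCode {k : ℕ} : SLPRule k → Fin 3 → ℕ
  | .terminal a => ![0, a, 0]
  | .pair l r => ![1, l.val, r.val]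

/-- The memory that holds the grammar: the rule of the `k`-th variable is in the cells
`3 * k`, `3 * k + 1`, `3 * k + 2`, and all other cells are `0`. -/
def inputMem (G : SLP) (j : ℕ) : ℕ :=
  if h : j / 3 < G.numVars then
    ruleCode (G.rule ⟨j / 3, h⟩) ⟨j % 3, Nat.mod_lt j (by decide)⟩
  else 0

end SLP

/-! ## Word RAM

A program is a fixed finite text; it uses a fixed finite number of registers and an addressable
memory. On a machine with word length `w` and `s` memory cells, every number that is computed has
to be less than `2 ^ w`, and every address that is used has to be less than `s`; an execution
that violates this is not an execution. Every evaluated node of an expression and every executed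
statement or loop test costs one unit of time. -/

namespace WordRAM

/-- The contents of the registers and of the memory cells. -/
@[ext] structure State : Type where
  reg : ℕ → ℕ
  mem : ℕ → ℕ

/-- The arithmetic and comparison operations on words. -/
inductive Op : Type
  | add | sub | mul | div | lt | eq

/-- Subtraction is truncated at `0`, division is rounded down (with quotient `0` for divisor `0`),
and a comparison yields `1` or `0`. -/
def Op.eval : Op → ℕ → ℕ → ℕ
  | .add, x, y => x + y
  | .sub, x, y => x - y
  | .mul, x, y => x * y
  | .div, x, y => x / y
  | .lt, x, y => if x < y then 1 else 0
  | .eq, x, y => if x = y then 1 else 0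

/-- Expressions: a constant, a register, the memory cell at a computed address, an operation. -/
inductive Expr : Type
  | const (c : ℕ) : Expr
  | reg (r : ℕ) : Expr
  | load (addr : Expr) : Expr
  | op (o : Op) (a b : Expr) : Expr

namespace Expr

/-- The value of an expression. -/
def eval (σ : State) : Expr → ℕ
  | const c => c
  | reg r => σ.reg r
  | load a => σ.mem (a.eval σ)
  | op o a b => o.eval (a.eval σ) (b.eval σ)

/-- The time to evaluate an expression: its number of nodes. -/
def cost : Expr → ℕ
  | const _ => 1
  | reg _ => 1
  | load a => a.cost + 1
  | op _ a b => a.cost + b.cost + 1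

/-- All values in the evaluation fit into words of `w` bits, and only cells with addresses less
than `s` are read. -/
def Fits (w s : ℕ) (σ : State) : Expr → Prop
  | const c => c < 2 ^ w
  | reg r => σ.reg r < 2 ^ w
  | load a => a.Fits w s σ ∧ a.eval σ < s ∧ σ.mem (a.eval σ) < 2 ^ w
  | op o a b => a.Fits w s σ ∧ b.Fits w s σ ∧ o.eval (a.eval σ) (b.eval σ) < 2 ^ w

end Expr

/-- Programs. Conditions are expressions; a nonzero value means that the condition holds. -/
inductive Prog : Type
  | skip : Prog
  | assign (r : ℕ) (e : Expr) : Prog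
  | store (addr e : Expr) : Prog
  | seq (p q : Prog) : Prog
  | ite (c : Expr) (p q : Prog) : Prog
  | while (c : Expr) (p : Prog) : Prog

/-- `Exec w s p σ t τ`: on a machine with word length `w` and `s` memory cells, the program `p`
started in state `σ` halts after exactly `t` units of time in state `τ`. -/
inductive Exec (w s : ℕ) : Prog → State → ℕ → State → Prop
  | skip (σ : State) : Exec w s .skip σ 1 σ
  | assign (σ : State) (r : ℕ) (e : Expr) (he : e.Fits w s σ) :
      Exec w s (.assign r e) σ (e.cost + 1) ⟨Function.update σ.reg r (e.eval σ), σ.mem⟩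
  | store (σ : State) (a e : Expr) (ha : a.Fits w s σ) (has : a.eval σ < s)
      (he : e.Fits w s σ) :
      Exec w s (.store a e) σ (a.cost + e.cost + 1)
        ⟨σ.reg, Function.update σ.mem (a.eval σ) (e.eval σ)⟩
  | seq {p q : Prog} {σ τ υ : State} {t u : ℕ} (hp : Exec w s p σ t τ) (hq : Exec w s q τ u υ) :
      Exec w s (.seq p q) σ (t + u) υ
  | iteTrue {c : Expr} {p q : Prog} {σ τ : State} {t : ℕ} (hc : c.Fits w s σ)
      (h : c.eval σ ≠ 0) (hp : Exec w s p σ t τ) :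
      Exec w s (.ite c p q) σ (c.cost + 1 + t) τ
  | iteFalse {c : Expr} {p q : Prog} {σ τ : State} {t : ℕ} (hc : c.Fits w s σ)
      (h : c.eval σ = 0) (hq : Exec w s q σ t τ) :
      Exec w s (.ite c p q) σ (c.cost + 1 + t) τ
  | whileTrue {c : Expr} {p : Prog} {σ τ υ : State} {t u : ℕ} (hc : c.Fits w s σ)
      (h : c.eval σ ≠ 0) (hp : Exec w s p σ t τ) (hw : Exec w s (.while c p) τ u υ) :
      Exec w s (.while c p) σ (c.cost + 1 + t + u) υ
  | whileFalse {c : Expr} {p : Prog} {σ : State} (hc : c.Fits w s σ) (h : c.eval σ = 0) :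
      Exec w s (.while c p) σ (c.cost + 1) σ

/-- The state at the start of a program: the argument `x` is in register `0`, all other registers
are `0`, and the memory is `m`. -/
def start (x : ℕ) (m : ℕ → ℕ) : State := ⟨Function.update 0 0 x, m⟩

end WordRAM

/-!
Call a child `z` of a variable `k` heavy if their lengths have the same integer part of the binary
logarithm, their common level, and `z` has fewer than twice as many occurrences in the derivation
tree as `k`. As `2 ^ level ≤ len < 2 ^ (level + 1)`, a variable has at most one heavy child, and as
the occurrences of the parents of `z` add up to at most those of `z`, it has at most one heavy
parent. So the heavy edges form disjoint paths, and as `occ * len` is at most the length `N` of the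
whole string, any way down from the start variable leaves a path only `O(log N)` times: each time
the level drops or the number of occurrences at least doubles.

Where a path is left is found by a search in a sorted table. The string of a variable is made up of
the string of the end of its path and of what hangs off the path to the left and to the right. The
lengths of these two parts, `left` and `right`, are monotone along the path. Their range is divided
into as many buckets of equal width as the path has variables, and the search starts from the stored
limits of its bucket. A step of the weights inside a bucket is at most the width of the bucket, and
it is the length of the string into which the path is left; so if this length is smaller only by a
factor `2 ^ d`, then the path has `O(2 ^ d)` variables, and bisection takes `O(1 + d)` steps. The
drops `d` of the level telescope to `O(log N)`.
-/

namespace WordRAM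

/-! ## Program logic -/

/-- The side conditions under which an expression fits, provided that all registers and all memory
cells hold words and that `16` is a word. -/
def Expr.Safe (w s : ℕ) (σ : State) : Expr → Prop
  | .const c => c ≤ 16
  | .reg _ => True
  | .load a => a.Safe w s σ ∧ a.eval σ < s
  | .op .add a b => a.Safe w s σ ∧ b.Safe w s σ ∧ a.eval σ + b.eval σ < 2 ^ w
  | .op .mul a b => a.Safe w s σ ∧ b.Safe w s σ ∧ a.eval σ * b.eval σ < 2 ^ w
  | .op _ a b => a.Safe w s σ ∧ b.Safe w s σ

/-- All registers and all memory cells hold words of `w` bits. -/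
def State.Words (w : ℕ) (σ : State) : Prop :=
  (∀ r, σ.reg r < 2 ^ w) ∧ ∀ a, σ.mem a < 2 ^ w

theorem Expr.Fits.eval_lt {w s : ℕ} {σ : State} : ∀ {e : Expr}, e.Fits w s σ → e.eval σ < 2 ^ w
  | .const _, h => h
  | .reg _, h => h
  | .load _, h => h.2.2
  | .op _ _ _, h => h.2.2

theorem Expr.Safe.fits {w s : ℕ} {σ : State} (hw : 16 < 2 ^ w) (hσ : σ.Words w) :
    ∀ {e : Expr}, e.Safe w s σ → e.Fits w s σ
  | .const _, h => lt_of_le_of_lt h hw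
  | .reg r, _ => hσ.1 r
  | .load _, h => ⟨h.1.fits hw hσ, h.2, hσ.2 _⟩
  | .op .add _ _, h => ⟨h.1.fits hw hσ, h.2.1.fits hw hσ, h.2.2⟩
  | .op .mul _ _, h => ⟨h.1.fits hw hσ, h.2.1.fits hw hσ, h.2.2⟩
  | .op .sub _ _, h =>
    ⟨h.1.fits hw hσ, h.2.fits hw hσ, (Nat.sub_le _ _).trans_lt (h.1.fits hw hσ).eval_lt⟩
  | .op .div _ _, h =>
    ⟨h.1.fits hw hσ, h.2.fits hw hσ, (Nat.div_le_self _ _).trans_lt (h.1.fits hw hσ).eval_lt⟩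
  | .op .lt _ _, h =>
    ⟨h.1.fits hw hσ, h.2.fits hw hσ, by simp only [Op.eval]; split <;> omega⟩
  | .op .eq _ _, h =>
    ⟨h.1.fits hw hσ, h.2.fits hw hσ, by simp only [Op.eval]; split <;> omega⟩

theorem State.Words.update_reg {w : ℕ} {σ : State} (hσ : σ.Words w) (r : ℕ) {v : ℕ}
    (hv : v < 2 ^ w) : State.Words w ⟨Function.update σ.reg r v, σ.mem⟩ :=
  ⟨fun i => by simp only [Function.update_apply]; split; exacts [hv, hσ.1 i], hσ.2⟩

theorem State.Words.update_mem {w : ℕ} {σ : State} (hσ : σ.Words w) (a : ℕ) {v : ℕ}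
    (hv : v < 2 ^ w) : State.Words w ⟨σ.reg, Function.update σ.mem a v⟩ :=
  ⟨hσ.1, fun i => by simp only [Function.update_apply]; split; exacts [hv, hσ.2 i]⟩

/-- The worst-case running time of a program without loops; loops are not counted. -/
def Prog.time : Prog → ℕ
  | .skip => 1
  | .assign _ e => e.cost + 1
  | .store a e => a.cost + e.cost + 1
  | .seq p q => p.time + q.time
  | .ite c p q => c.cost + 1 + max p.time q.time
  | .while _ _ => 0

/-- The weakest precondition of a program without loops, with `Expr.Safe` for the side conditions;
no state satisfies it for a loop. -/
def Prog.WP (w s : ℕ) : Prog → State → (State → Prop) → Prop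
  | .skip, σ, Q => Q σ
  | .assign r e, σ, Q => e.Safe w s σ ∧ Q ⟨Function.update σ.reg r (e.eval σ), σ.mem⟩
  | .store a e, σ, Q => (a.Safe w s σ ∧ a.eval σ < s ∧ e.Safe w s σ) ∧
      Q ⟨σ.reg, Function.update σ.mem (a.eval σ) (e.eval σ)⟩
  | .seq p q, σ, Q => p.WP w s σ fun τ => q.WP w s τ Q
  | .ite c p q, σ, Q =>
      c.Safe w s σ ∧ (c.eval σ ≠ 0 → p.WP w s σ Q) ∧ (c.eval σ = 0 → q.WP w s σ Q)
  | .while _ _, _, _ => False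

/-- Total correctness with a time bound: started in `σ`, the program `p` halts within `b` units of
time in a state that satisfies `Q`. -/
def Runs (w s : ℕ) (p : Prog) (σ : State) (b : ℕ) (Q : State → Prop) : Prop :=
  σ.Words w → ∃ t τ, Exec w s p σ t τ ∧ t ≤ b ∧ τ.Words w ∧ Q τ

namespace Runs

variable {w s b b' : ℕ} {p q : Prog} {c : Expr} {σ : State} {Q R : State → Prop}

theorem weaken (h : Runs w s p σ b Q) (hb : b ≤ b') (hQ : ∀ τ, Q τ → R τ) :
    Runs w s p σ b' R := fun hσ =>
  let ⟨t, τ, e, ht, hτ, hq⟩ := h hσ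
  ⟨t, τ, e, ht.trans hb, hτ, hQ τ hq⟩

theorem seq (hp : Runs w s p σ b R) (hq : ∀ τ, R τ → Runs w s q τ b' Q) :
    Runs w s (.seq p q) σ (b + b') Q := by
  intro hσ
  obtain ⟨t, τ, e, ht, hτ, hR⟩ := hp hσ
  obtain ⟨t', υ, e', ht', hυ, hQ⟩ := hq τ hR hτ
  exact ⟨_, υ, .seq e e', add_le_add ht ht', hυ, hQ⟩

theorem ite (hw : 16 < 2 ^ w) (hc : c.Safe w s σ) (hp : c.eval σ ≠ 0 → Runs w s p σ b Q)
    (hq : c.eval σ = 0 → Runs w s q σ b Q) : Runs w s (.ite c p q) σ (c.cost + 1 + b) Q := by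
  intro hσ
  by_cases h : c.eval σ = 0
  · obtain ⟨t, τ, e, ht, hτ⟩ := hq h hσ
    exact ⟨_, τ, .iteFalse (hc.fits hw hσ) h e, by omega, hτ⟩
  · obtain ⟨t, τ, e, ht, hτ⟩ := hp h hσ
    exact ⟨_, τ, .iteTrue (hc.fits hw hσ) h e, by omega, hτ⟩

theorem of_wp (hw : 16 < 2 ^ w) (h : p.WP w s σ Q) : Runs w s p σ p.time Q := by
  induction p generalizing σ Q with
  | skip => exact fun hσ => ⟨_, _, .skip _, le_rfl, hσ, h⟩
  | assign r e =>
    exact fun hσ => ⟨_, _, .assign _ r e (h.1.fits hw hσ), le_rfl,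
      hσ.update_reg r (h.1.fits hw hσ).eval_lt, h.2⟩
  | store a e =>
    exact fun hσ => ⟨_, _, .store _ a e (h.1.1.fits hw hσ) h.1.2.1 (h.1.2.2.fits hw hσ), le_rfl,
      hσ.update_mem _ (h.1.2.2.fits hw hσ).eval_lt, h.2⟩
  | seq p q hp hq => exact (hp h).seq fun τ => hq
  | ite c p q hp hq =>
    exact Runs.ite hw h.1 (fun hc => (hp (h.2.1 hc)).weaken (le_max_left _ _) fun _ => id)
      fun hc => (hq (h.2.2 hc)).weaken (le_max_right _ _) fun _ => id
  | _ => exact h.elim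

/-- The invariant `I n` says that `n` units of time are left for the iterations to come. -/
theorem while_loop (hw : 16 < 2 ^ w) (I : ℕ → State → Prop) (hsafe : ∀ n σ, I n σ → c.Safe w s σ)
    (hstep : ∀ n σ, I n σ → c.eval σ ≠ 0 →
      ∃ b, Runs w s p σ b fun τ => ∃ n', n' + b + (c.cost + 1) ≤ n ∧ I n' τ)
    (n : ℕ) (h : I n σ) :
    Runs w s (.while c p) σ (n + (c.cost + 1)) fun τ => c.eval τ = 0 ∧ ∃ n', I n' τ := by
  induction n using Nat.strong_induction_on generalizing σ with
  | _ n ih =>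
    intro hσ
    have hc := (hsafe n σ h).fits hw hσ
    by_cases h0 : c.eval σ = 0
    · exact ⟨_, σ, .whileFalse hc h0, by omega, hσ, h0, n, h⟩
    · obtain ⟨b, hb⟩ := hstep n σ h h0
      obtain ⟨t, τ, e, ht, hτ, n', hn, hI⟩ := hb hσ
      obtain ⟨t', υ, e', ht', hυ⟩ := ih n' (by omega) hI hτ
      exact ⟨_, υ, .whileTrue hc h0 e e', by omega, hυ⟩

end Runs

/-- Whether a program contains no instruction that writes to the memory. -/
def Prog.readOnly : Prog → Bool
  | .skip | .assign _ _ => true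
  | .store _ _ => false
  | .seq p q | .ite _ p q => p.readOnly && q.readOnly
  | .while _ p => p.readOnly

theorem Exec.mem_eq {w s t : ℕ} {p : Prog} {σ τ : State} (h : Exec w s p σ t τ)
    (hp : p.readOnly) : τ.mem = σ.mem := by
  induction h with
  | skip | assign | whileFalse => rfl
  | store => exact absurd hp Bool.false_ne_true
  | seq _ _ ihp ihq =>
    rw [Prog.readOnly, Bool.and_eq_true] at hp
    exact (ihq hp.2).trans (ihp hp.1)
  | iteTrue _ _ _ ih =>
    rw [Prog.readOnly, Bool.and_eq_true] at hp
    exact ih hp.1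
  | iteFalse _ _ _ ih =>
    rw [Prog.readOnly, Bool.and_eq_true] at hp
    exact ih hp.2
  | whileTrue _ _ _ _ ihp ihw => exact (ihw hp).trans (ihp hp)

/-! ## Notation for expressions and programs -/

instance : Add Expr := ⟨.op .add⟩
instance : Sub Expr := ⟨.op .sub⟩
instance : Mul Expr := ⟨.op .mul⟩
instance : Div Expr := ⟨.op .div⟩

section
variable (w s n : ℕ) (σ : State) (a b : Expr)

@[simp] theorem Expr.eval_const : (Expr.const n).eval σ = n := rfl
@[simp] theorem Expr.eval_reg : (Expr.reg n).eval σ = σ.reg n := rfl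
@[simp] theorem Expr.eval_load : (Expr.load a).eval σ = σ.mem (a.eval σ) := rfl
@[simp] theorem Expr.eval_add : (a + b).eval σ = a.eval σ + b.eval σ := rfl
@[simp] theorem Expr.eval_sub : (a - b).eval σ = a.eval σ - b.eval σ := rfl
@[simp] theorem Expr.eval_mul : (a * b).eval σ = a.eval σ * b.eval σ := rfl
@[simp] theorem Expr.eval_div : (a / b).eval σ = a.eval σ / b.eval σ := rfl
@[simp] theorem Expr.eval_lt :
    (Expr.op .lt a b).eval σ = if a.eval σ < b.eval σ then 1 else 0 := rfl
@[simp] theorem Expr.eval_eq :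
    (Expr.op .eq a b).eval σ = if a.eval σ = b.eval σ then 1 else 0 := rfl

variable {σ a b} in
theorem Expr.eval_lt_eq_zero : (Expr.op .lt a b).eval σ = 0 ↔ b.eval σ ≤ a.eval σ := by
  rw [Expr.eval_lt, ite_eq_right_iff, ← not_lt]
  simp

@[simp] theorem Expr.safe_const : (Expr.const n).Safe w s σ ↔ n ≤ 16 := Iff.rfl
@[simp] theorem Expr.safe_reg : (Expr.reg n).Safe w s σ := trivial
@[simp] theorem Expr.safe_load :
    (Expr.load a).Safe w s σ ↔ a.Safe w s σ ∧ a.eval σ < s := Iff.rfl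
@[simp] theorem Expr.safe_add : (a + b).Safe w s σ ↔
    a.Safe w s σ ∧ b.Safe w s σ ∧ a.eval σ + b.eval σ < 2 ^ w := Iff.rfl
@[simp] theorem Expr.safe_mul : (a * b).Safe w s σ ↔
    a.Safe w s σ ∧ b.Safe w s σ ∧ a.eval σ * b.eval σ < 2 ^ w := Iff.rfl
@[simp] theorem Expr.safe_sub : (a - b).Safe w s σ ↔ a.Safe w s σ ∧ b.Safe w s σ := Iff.rfl
@[simp] theorem Expr.safe_div : (a / b).Safe w s σ ↔ a.Safe w s σ ∧ b.Safe w s σ := Iff.rfl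
@[simp] theorem Expr.safe_lt :
    (Expr.op .lt a b).Safe w s σ ↔ a.Safe w s σ ∧ b.Safe w s σ := Iff.rfl
@[simp] theorem Expr.safe_eq :
    (Expr.op .eq a b).Safe w s σ ↔ a.Safe w s σ ∧ b.Safe w s σ := Iff.rfl

end

/-- The sequential composition of a list of programs. -/
def block : List Prog → Prog
  | [] => .skip
  | p :: ps => .seq p (block ps)

section
variable {w s r : ℕ} {σ : State} {e a c : Expr} {p q : Prog} {ps : List Prog} {Q : State → Prop}

@[simp] theorem wp_skip : Prog.skip.WP w s σ Q ↔ Q σ := Iff.rfl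
@[simp] theorem wp_assign : (Prog.assign r e).WP w s σ Q ↔
    e.Safe w s σ ∧ Q ⟨Function.update σ.reg r (e.eval σ), σ.mem⟩ := Iff.rfl
@[simp] theorem wp_store : (Prog.store a e).WP w s σ Q ↔
    (a.Safe w s σ ∧ a.eval σ < s ∧ e.Safe w s σ) ∧
      Q ⟨σ.reg, Function.update σ.mem (a.eval σ) (e.eval σ)⟩ := Iff.rfl
@[simp] theorem wp_ite : (Prog.ite c p q).WP w s σ Q ↔
    c.Safe w s σ ∧ (c.eval σ ≠ 0 → p.WP w s σ Q) ∧ (c.eval σ = 0 → q.WP w s σ Q) := Iff.rfl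
@[simp] theorem wp_block_nil : (block []).WP w s σ Q ↔ Q σ := Iff.rfl
@[simp] theorem wp_block_cons : (block (p :: ps)).WP w s σ Q ↔
    p.WP w s σ fun τ => (block ps).WP w s τ Q := Iff.rfl

end

/-- The loop that runs `body` with register `1` counting from `0` up to register `0`. -/
def forRange (body : Prog) : Prog :=
  .seq (.assign 1 (.const 0)) <| .while (.op .lt (.reg 1) (.reg 0)) <|
    .seq body (.assign 1 (.reg 1 + .const 1))

theorem Runs.forRange {w s m b : ℕ} {body : Prog} {σ : State} (hw : 16 < 2 ^ w)
    (I : ℕ → (ℕ → ℕ) → Prop) (hm : σ.reg 0 = m) (hI : I 0 σ.mem)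
    (hbody : ∀ σ, σ.reg 0 = m → ∀ k < m, σ.reg 1 = k → I k σ.mem →
      Runs w s body σ b fun τ => τ.reg 0 = m ∧ τ.reg 1 = k ∧ I (k + 1) τ.mem) :
    Runs w s (WordRAM.forRange body) σ (m * (b + 8) + 6)
      fun τ => τ.reg 0 = m ∧ I m τ.mem := by
  intro hσ
  have hm' : m < 2 ^ w := hm ▸ hσ.1 0
  let J (n : ℕ) (σ : State) : Prop :=
    σ.reg 0 = m ∧ σ.reg 1 ≤ m ∧ (m - σ.reg 1) * (b + 8) ≤ n ∧ I (σ.reg 1) σ.mem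
  have hinit : Runs w s (.assign 1 (.const 0)) σ 2 (J (m * (b + 8))) :=
    of_wp hw (by simpa [J, hm] using hI)
  refine ((hinit.seq (b' := m * (b + 8) + 4) fun τ hτ => ?_).weaken
    (by omega) fun _ => id) hσ
  refine (Runs.while_loop hw J (fun _ _ _ => by simp) (fun n σ hJ hlt => ?_) _ hτ).weaken le_rfl ?_
  · obtain ⟨h0, -, hn, hI⟩ := hJ
    have hlt : σ.reg 1 < m := by simpa [h0] using hlt
    have hincr (τ : State) (hτ : τ.reg 0 = m ∧ τ.reg 1 = σ.reg 1 ∧ I (σ.reg 1 + 1) τ.mem) :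
        Runs w s (.assign 1 (.reg 1 + .const 1)) τ 4 (J ((m - (σ.reg 1 + 1)) * (b + 8))) :=
      of_wp hw (by simpa [J, hτ, hlt] using Nat.lt_of_le_of_lt hlt hm')
    refine ⟨b + 4, ((hbody σ h0 _ hlt rfl hI).seq hincr).weaken le_rfl fun υ hυ => ⟨_, ?_, hυ⟩⟩
    obtain ⟨d, hd⟩ : ∃ d, m - σ.reg 1 = d + 1 := ⟨m - σ.reg 1 - 1, by omega⟩
    rw [show m - (σ.reg 1 + 1) = d by omega]
    rw [hd] at hn
    change d * (b + 8) + (b + 4) + 4 ≤ n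
    linarith
  · rintro τ ⟨hge, n', h0, h1, -, hI⟩
    have hge : m ≤ τ.reg 1 := by simpa [h0] using hge
    exact ⟨h0, h1.antisymm hge ▸ hI⟩

/-! ## Memory layout -/

/-- The columns of the table that the preprocessing program computes, with one row per variable;
`SLP.table` gives their contents. -/
inductive Column : Type
  | occ | len | pow | next | pathEnd | left | right | rank | size | start | var | leftStart
  | rightStart
  deriving DecidableEq

/-- The position of a column in a row. -/
def Column.index : Column → ℕ
  | occ => 0
  | len => 1
  | pow => 2
  | next => 3
  | pathEnd => 4
  | left => 5
  | right => 6
  | rank => 7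
  | size => 8
  | start => 9
  | var => 10
  | leftStart => 11
  | rightStart => 12

theorem Column.index_lt (f : Column) : f.index < 13 := by cases f <;> decide

theorem Column.index_injective : Function.Injective Column.index := by
  intro f f' h; cases f <;> cases f' <;> first | rfl | exact absurd h (by decide)

/-- The address of column `f` of row `k` behind an input of `3 * m` cells. -/
def cellAddr (m : ℕ) (f : Column) (k : ℕ) : ℕ := 3 * m + 13 * k + f.index

/-- The content of column `f` of row `k`. -/
def cell (m : ℕ) (mem : ℕ → ℕ) (f : Column) (k : ℕ) : ℕ := mem (cellAddr m f k)

section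
variable {m a v k k' : ℕ} {f f' : Column} {mem : ℕ → ℕ}

theorem cellAddr_inj : cellAddr m f k = cellAddr m f' k' ↔ f = f' ∧ k = k' := by
  have := f.index_lt
  have := f'.index_lt
  rw [← Column.index_injective.eq_iff]
  unfold cellAddr
  omega

theorem cellAddr_lt (hk : k < m) : cellAddr m f k < 16 * m := by
  have := f.index_lt
  unfold cellAddr
  omega

theorem ne_cellAddr (ha : a < 3 * m) : a ≠ cellAddr m f k := by
  unfold cellAddr
  omega

theorem cell_update : cell m (Function.update mem (cellAddr m f k) v) f' k' =
    if f' = f ∧ k' = k then v else cell m mem f' k' := by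
  simp only [cell, Function.update_apply, cellAddr_inj]

end

/-- The address of a cell, with the number of variables in register `0`. -/
def addrExpr (f : Column) (e : Expr) : Expr :=
  .const 3 * .reg 0 + .const 13 * e + .const f.index

/-- The content of a cell, with the number of variables in register `0`. -/
def cellExpr (f : Column) (e : Expr) : Expr := .load (addrExpr f e)

section
variable {w s m : ℕ} {f : Column} {σ : State} {e : Expr}

theorem eval_addrExpr : (addrExpr f e).eval σ = cellAddr (σ.reg 0) f (e.eval σ) := rfl

theorem eval_cellExpr : (cellExpr f e).eval σ = cell (σ.reg 0) σ.mem f (e.eval σ) := rfl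

theorem safe_addrExpr (hw : 16 * m < 2 ^ w) (h0 : σ.reg 0 = m) (he : e.Safe w s σ)
    (hk : e.eval σ < m) : (addrExpr f e).Safe w s σ := by
  have := f.index_lt
  simp only [addrExpr, Expr.safe_add, Expr.safe_mul, Expr.safe_const, Expr.safe_reg,
    Expr.eval_const, Expr.eval_reg, Expr.eval_mul, Expr.eval_add, h0]
  refine ⟨⟨⟨by simp, trivial, ?_⟩, ⟨by simp, he, ?_⟩, ?_⟩, ?_, ?_⟩ <;> omega

theorem safe_cellExpr (hw : 16 * m < 2 ^ w) (h0 : σ.reg 0 = m) (he : e.Safe w (16 * m) σ)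
    (hk : e.eval σ < m) : (cellExpr f e).Safe w (16 * m) σ :=
  ⟨safe_addrExpr hw h0 he hk, by rw [eval_addrExpr, h0]; exact cellAddr_lt hk⟩

end

end WordRAM

namespace SLP

section

/-! ## Occurrences in the derivation tree -/

variable (G : SLP)

/-- The first word that encodes the rule of a variable: `0` for a terminal symbol, `1` for a pair of
variables. It is `0` if there is no such variable. -/
def tag (k : ℕ) : ℕ := G.inputMem (3 * k)

/-- The second word that encodes the rule of a variable: the terminal symbol or the left variable.
-/
def fst (k : ℕ) : ℕ := G.inputMem (3 * k + 1)

/-- The third word that encodes the rule of a variable: the right variable of a pair. -/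
def snd (k : ℕ) : ℕ := G.inputMem (3 * k + 2)

/-- The variables on the right-hand side of a rule. -/
def children (k : ℕ) : List ℕ := if G.tag k = 1 then [G.fst k, G.snd k] else []

/-- The string derived from a variable; the empty string if there is no such variable. -/
def str (k : ℕ) : List ℕ := if hk : k < G.numVars then G.expand k hk else []

/-- The length of the string derived from a variable. -/
def len (k : ℕ) : ℕ := (G.str k).length

theorem inputMem_eq {k : ℕ} (hk : k < G.numVars) {f : ℕ} (hf : f < 3) :
    G.inputMem (3 * k + f) = ruleCode (G.rule ⟨k, hk⟩) ⟨f, hf⟩ := by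
  have hdiv : (3 * k + f) / 3 = k := by omega
  have hmod : (3 * k + f) % 3 = f := by omega
  rw [inputMem, dif_pos (by rwa [hdiv])]
  congr! 2
  exact Fin.ext hdiv

theorem tag_of_numVars_le {k : ℕ} (hk : G.numVars ≤ k) : G.tag k = 0 := by
  rw [tag, inputMem, dif_neg (by omega)]

variable {G} {k z : ℕ}

theorem rule_cases (hk : k < G.numVars) :
    (G.tag k = 0 ∧ G.str k = [G.fst k]) ∨
    (G.tag k = 1 ∧ G.fst k < k ∧ G.snd k < k ∧ G.str k = G.str (G.fst k) ++ G.str (G.snd k)) := by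
  have htag : G.tag k = _ := G.inputMem_eq hk (f := 0) (by decide)
  have hfst : G.fst k = _ := G.inputMem_eq hk (f := 1) (by decide)
  have hsnd : G.snd k = _ := G.inputMem_eq hk (f := 2) (by decide)
  cases hr : G.rule ⟨k, hk⟩ with
  | terminal a =>
    rw [hr] at htag hfst
    have hfst' : G.fst k = a := hfst
    refine .inl ⟨htag, ?_⟩
    rw [str, dif_pos hk, expand, hr, hfst']
  | pair l r =>
    rw [hr] at htag hfst hsnd
    have hfst' : G.fst k = l.val := hfst
    have hsnd' : G.snd k = r.val := hsnd
    refine .inr ⟨htag, by rw [hfst']; exact l.isLt, by rw [hsnd']; exact r.isLt, ?_⟩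
    rw [str, dif_pos hk, expand, hr, hfst', hsnd', str, str, dif_pos (l.isLt.trans hk),
      dif_pos (r.isLt.trans hk)]

theorem lt_numVars_of_tag (h : G.tag k = 1) : k < G.numVars := by
  by_contra! hk
  exact absurd (tag_of_numVars_le G hk) (by omega)

theorem tag_eq (G : SLP) (k : ℕ) : G.tag k = 0 ∨ G.tag k = 1 := by
  by_cases hk : k < G.numVars
  · exact (rule_cases hk).imp And.left And.left
  · exact .inl (tag_of_numVars_le G (not_lt.mp hk))

theorem str_of_tag_zero (hk : k < G.numVars) (h : G.tag k = 0) : G.str k = [G.fst k] := by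
  rcases rule_cases hk with h' | h'
  · exact h'.2
  · omega

theorem rule_of_tag_one (h : G.tag k = 1) :
    G.fst k < k ∧ G.snd k < k ∧ G.str k = G.str (G.fst k) ++ G.str (G.snd k) := by
  rcases rule_cases (lt_numVars_of_tag h) with h' | h'
  · omega
  · exact h'.2

theorem mem_children : z ∈ G.children k ↔ G.tag k = 1 ∧ (z = G.fst k ∨ z = G.snd k) := by
  unfold children
  split <;> simp [*]

theorem lt_of_mem_children (h : z ∈ G.children k) : z < k := by
  obtain ⟨htag, rfl | rfl⟩ := mem_children.mp h
  exacts [(rule_of_tag_one htag).1, (rule_of_tag_one htag).2.1]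

theorem lt_numVars_of_mem_children (h : z ∈ G.children k) : z < G.numVars :=
  (lt_of_mem_children h).trans (lt_numVars_of_tag (mem_children.mp h).1)

theorem count_children_eq_zero (h : k ≤ z) : (G.children k).count z = 0 :=
  List.count_eq_zero_of_not_mem fun hz => absurd (lt_of_mem_children hz) (by omega)

theorem len_of_tag_zero (hk : k < G.numVars) (h : G.tag k = 0) : G.len k = 1 := by
  rw [len, str_of_tag_zero hk h, List.length_singleton]

theorem len_of_tag_one (h : G.tag k = 1) : G.len k = G.len (G.fst k) + G.len (G.snd k) := by
  rw [len, (rule_of_tag_one h).2.2, List.length_append, len, len]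

theorem len_pos (hk : k < G.numVars) : 0 < G.len k := by
  induction k using Nat.strong_induction_on with
  | _ k ih =>
    rcases tag_eq G k with h | h
    · rw [len_of_tag_zero hk h]; exact one_pos
    · have hlt := (rule_of_tag_one h).1
      have := ih _ hlt (hlt.trans hk)
      rw [len_of_tag_one h]
      omega

theorem len_le_of_mem_children (h : z ∈ G.children k) : G.len z ≤ G.len k := by
  obtain ⟨htag, rfl | rfl⟩ := mem_children.mp h <;> rw [len_of_tag_one htag] <;> omega

theorem str_last (G : SLP) : G.str (G.numVars - 1) = G.word := by
  rw [str, dif_pos (Nat.sub_lt G.numVars_pos Nat.one_pos), word]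

theorem len_last (G : SLP) : G.len (G.numVars - 1) = G.word.length := by rw [len, str_last]

theorem two_mul_numVars_le_size (G : SLP) : 2 * G.numVars ≤ G.size := by
  have : ∑ _k : Fin G.numVars, 2 ≤ G.size :=
    Finset.sum_le_sum fun k _ => by cases G.rule k <;> simp [SLPRule.symbols]
  simpa [mul_comm] using this

variable (G) in
/-- The number of nodes labelled `z` in the derivation tree of the start symbol whose parent is one
of the last `t` variables (the root counts as such). -/
def occAfter : ℕ → ℕ → ℕ
  | 0, z => if z = G.numVars - 1 then 1 else 0
  | t + 1, z => occAfter t z +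
      occAfter t (G.numVars - 1 - t) * (G.children (G.numVars - 1 - t)).count z

variable (G) in
/-- The number of nodes labelled `z` in the derivation tree of the start symbol. -/
def occ (z : ℕ) : ℕ := G.occAfter G.numVars z

theorem occAfter_mono (z : ℕ) : Monotone fun t => G.occAfter t z :=
  monotone_nat_of_le_succ fun _ => Nat.le_add_right _ _

theorem occAfter_eq_occ {t : ℕ} (ht : t ≤ G.numVars) (h : G.numVars ≤ z + 1 + t) :
    G.occAfter t z = G.occ z := by
  obtain ⟨d, hd⟩ := Nat.exists_eq_add_of_le ht
  rw [occ, hd]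
  clear hd ht
  induction d with
  | zero => rfl
  | succ d ih =>
    rw [← add_assoc, occAfter, count_children_eq_zero (by omega), mul_zero, add_zero, ih]

theorem occ_last : G.occ (G.numVars - 1) = 1 := by
  rw [← occAfter_eq_occ (t := 0) (Nat.zero_le _) (by have := G.numVars_pos; omega), occAfter,
    if_pos rfl]

theorem sum_count_children_mul_len_le (k : ℕ) :
    ∑ z ∈ Finset.range k, (G.children k).count z * G.len z ≤ G.len k := by
  rcases tag_eq G k with h | h
  · simp [children, h]
  · obtain ⟨hfst, hsnd, -⟩ := rule_of_tag_one h
    simp [children, h, List.count_cons, add_mul, Finset.sum_add_distrib, hfst, hsnd,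
      len_of_tag_one h, add_comm]

/-- Expanding a variable replaces it by children of at most the same total length. -/
theorem sum_occAfter_mul_len_le (t : ℕ) :
    ∑ z ∈ Finset.range (G.numVars - t), G.occAfter t z * G.len z ≤ G.len (G.numVars - 1) := by
  induction t with
  | zero =>
    simp only [occAfter, ite_mul, one_mul, zero_mul, Nat.sub_zero, Finset.sum_ite_eq',
      Finset.mem_range, Nat.sub_lt G.numVars_pos one_pos, if_true, le_refl]
  | succ t ih =>
    rcases Nat.lt_or_ge t G.numVars with ht | ht
    · have hk : G.numVars - t = G.numVars - 1 - t + 1 := by omega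
      rw [hk, Finset.sum_range_succ] at ih
      rw [show G.numVars - (t + 1) = G.numVars - 1 - t by omega]
      generalize hk : G.numVars - 1 - t = k at ih
      calc ∑ z ∈ Finset.range k, G.occAfter (t + 1) z * G.len z
          = ∑ z ∈ Finset.range k, G.occAfter t z * G.len z +
              G.occAfter t k * ∑ z ∈ Finset.range k, (G.children k).count z * G.len z := by
            simp only [occAfter, hk, add_mul, mul_assoc, Finset.sum_add_distrib, Finset.mul_sum]
        _ ≤ _ := (Nat.add_le_add_left (Nat.mul_le_mul_left _ (sum_count_children_mul_len_le k)) _)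
        _ ≤ G.len (G.numVars - 1) := ih
    · simp [Nat.sub_eq_zero_of_le (ht.trans t.le_succ)]

theorem occ_mul_len_le (hk : k < G.numVars) : G.occ k * G.len k ≤ G.len (G.numVars - 1) := by
  rw [← occAfter_eq_occ (t := G.numVars - 1 - k) (by omega) (by omega)]
  exact (Finset.single_le_sum (f := fun z => G.occAfter (G.numVars - 1 - k) z * G.len z)
    (fun _ _ => Nat.zero_le _) (Finset.mem_range.mpr (by omega))).trans
      (sum_occAfter_mul_len_le (G.numVars - 1 - k))

theorem len_le_of_occ_pos (hk : k < G.numVars) (h : 0 < G.occ k) :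
    G.len k ≤ G.len (G.numVars - 1) :=
  (Nat.le_mul_of_pos_left _ h).trans (occ_mul_len_le hk)

theorem occ_le (hk : k < G.numVars) : G.occ k ≤ G.len (G.numVars - 1) :=
  (Nat.le_mul_of_pos_right _ (len_pos hk)).trans (occ_mul_len_le hk)

theorem occAfter_sub (hk : k < G.numVars) (z : ℕ) :
    G.occAfter (G.numVars - k) z =
      G.occAfter (G.numVars - 1 - k) z + G.occ k * (G.children k).count z := by
  rw [show G.numVars - k = G.numVars - 1 - k + 1 by omega, occAfter,
    show G.numVars - 1 - (G.numVars - 1 - k) = k by omega,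
    occAfter_eq_occ (z := k) (by omega) (by omega)]

theorem occ_mul_count_add_occ_mul_count_le {j : ℕ} (hj : j < G.numVars) (hkj : k < j) (z : ℕ) :
    G.occ j * (G.children j).count z + G.occ k * (G.children k).count z ≤ G.occ z := by
  calc _ ≤ G.occAfter (G.numVars - j) z + G.occ k * (G.children k).count z := by
        rw [occAfter_sub hj]; omega
    _ ≤ G.occAfter (G.numVars - 1 - k) z + G.occ k * (G.children k).count z :=
        Nat.add_le_add_right (occAfter_mono z (by omega)) _
    _ = G.occAfter (G.numVars - k) z := (occAfter_sub (hkj.trans hj) z).symm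
    _ ≤ G.occ z := occAfter_mono z (Nat.sub_le _ _)

theorem occ_mul_count_le (hk : k < G.numVars) (z : ℕ) :
    G.occ k * (G.children k).count z ≤ G.occ z :=
  calc _ ≤ G.occAfter (G.numVars - k) z := by rw [occAfter_sub hk]; omega
    _ ≤ G.occ z := occAfter_mono z (Nat.sub_le _ _)

theorem occ_le_of_mem_children (h : z ∈ G.children k) : G.occ k ≤ G.occ z :=
  (Nat.le_mul_of_pos_right _ (List.count_pos_iff.mpr h)).trans
    (occ_mul_count_le (lt_numVars_of_tag (mem_children.mp h).1) z)

end

section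

/-! ## Heavy paths -/

variable {G : SLP} {k u v x z : ℕ}

variable (G) in
/-- The binary logarithm of the length of the string derived from a variable. -/
def level (k : ℕ) : ℕ := Nat.log 2 (G.len k)

variable (G) in
/-- The child `z` of `k` is heavy if it has the same level, and less than twice the number of
occurrences. -/
def Heavy (k z : ℕ) : Prop := G.level z = G.level k ∧ G.occ z < 2 * G.occ k

instance (k : ℕ) : DecidablePred (G.Heavy k) := fun _ => inferInstanceAs (Decidable (_ ∧ _))

variable (G) in
/-- The heavy child of a variable, if there is one. -/
def next (k : ℕ) : Option ℕ := (G.children k).find? (G.Heavy k)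

theorem level_mono_of_mem_children (h : z ∈ G.children k) : G.level z ≤ G.level k :=
  Nat.log_mono_right (len_le_of_mem_children h)

theorem two_pow_level_le (hk : k < G.numVars) : 2 ^ G.level k ≤ G.len k :=
  Nat.pow_log_le_self 2 (len_pos hk).ne'

theorem len_lt_two_pow_level (k : ℕ) : G.len k < 2 * 2 ^ G.level k := by
  rw [mul_comm, ← pow_succ]
  exact Nat.lt_pow_succ_log_self one_lt_two _

/-- Two different heavy children would make `k` longer than its level allows, and equal children
occur twice as often as `k`. -/
theorem Heavy.unique {z' : ℕ} (hz : z ∈ G.children k) (hz' : z' ∈ G.children k)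
    (h : G.Heavy k z) (h' : G.Heavy k z') : z = z' := by
  have hz₀ := two_pow_level_le (lt_numVars_of_mem_children hz)
  have hz₀' := two_pow_level_le (lt_numVars_of_mem_children hz')
  rw [h.1] at hz₀
  rw [h'.1] at hz₀'
  have hlt := G.len_lt_two_pow_level k
  obtain ⟨htag, hz⟩ := mem_children.mp hz
  obtain ⟨-, hz'⟩ := mem_children.mp hz'
  rw [len_of_tag_one htag] at hlt
  rcases hz with rfl | rfl <;> rcases hz' with rfl | rfl <;> first | rfl | omega

theorem next_eq_some_iff : G.next k = some z ↔ z ∈ G.children k ∧ G.Heavy k z := by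
  constructor
  · exact fun h => ⟨List.mem_of_find?_eq_some h, by simpa using List.find?_some h⟩
  · rintro ⟨hz, hheavy⟩
    obtain ⟨z', hz'⟩ : ∃ z', G.next k = some z' := by
      rw [← Option.isSome_iff_exists, next, List.find?_isSome]
      exact ⟨z, hz, by simpa using hheavy⟩
    rw [hz', hheavy.unique hz (List.mem_of_find?_eq_some hz')
      (by simpa using List.find?_some hz')]

theorem lt_of_next (h : G.next k = some u) : u < k :=
  lt_of_mem_children (next_eq_some_iff.mp h).1

theorem tag_of_next (h : G.next k = some u) : G.tag k = 1 :=
  (mem_children.mp (next_eq_some_iff.mp h).1).1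

theorem occ_pos_of_next (h : G.next k = some u) : 0 < G.occ k := by
  have := (next_eq_some_iff.mp h).2.2
  omega

theorem fst_ne_snd_of_next (h : G.next k = some u) : G.fst k ≠ G.snd k := by
  intro heq
  obtain ⟨hu, hheavy⟩ := next_eq_some_iff.mp h
  have hocc := occ_mul_count_le (lt_numVars_of_tag (tag_of_next h)) u
  have hcount : (G.children k).count u = 2 := by
    obtain ⟨htag, hu⟩ := mem_children.mp hu
    rcases hu with rfl | rfl <;> simp [children, htag, heq]
  rw [hcount] at hocc
  exact absurd hheavy.2 (by omega)

theorem next_inj {j : ℕ} (hj : G.next j = some z) (hk : G.next k = some z) : j = k := by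
  wlog h : k < j generalizing j k
  · rcases (not_lt.mp h).lt_or_eq with h | h
    exacts [(this hk hj h).symm, h]
  obtain ⟨hzj, hheavyj⟩ := next_eq_some_iff.mp hj
  obtain ⟨hzk, hheavyk⟩ := next_eq_some_iff.mp hk
  have hsum := occ_mul_count_add_occ_mul_count_le
    (lt_numVars_of_tag (mem_children.mp hzj).1) h z
  have := Nat.le_mul_of_pos_right (G.occ j) (List.count_pos_iff.mpr hzj)
  have := Nat.le_mul_of_pos_right (G.occ k) (List.count_pos_iff.mpr hzk)
  have := hheavyj.2
  have := hheavyk.2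
  omega

variable (G) in
/-- The last variable of the heavy path that starts at `k`. -/
def pathEnd (k : ℕ) : ℕ :=
  match h : G.next k with
  | none => k
  | some u => have := lt_of_next h; pathEnd u
termination_by k

variable (G) in
/-- The length of the part of `str k` to the left of the string of the last variable of the heavy
path that starts at `k`. -/
def left (k : ℕ) : ℕ :=
  match h : G.next k with
  | none => 0
  | some u => have := lt_of_next h; left u + if u = G.fst k then 0 else G.len (G.fst k)
termination_by k

variable (G) in
/-- The length of the part of `str k` to the right of the string of the last variable of the heavy
path that starts at `k`. -/
def right (k : ℕ) : ℕ := G.len k - G.left k - G.len (G.pathEnd k)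

theorem pathEnd_of_none (h : G.next k = none) : G.pathEnd k = k := by
  rw [pathEnd]; split <;> simp_all

theorem pathEnd_of_some (h : G.next k = some u) : G.pathEnd k = G.pathEnd u := by
  rw [pathEnd]; split <;> simp_all

theorem left_of_none (h : G.next k = none) : G.left k = 0 := by
  rw [left]; split <;> simp_all

theorem left_of_some (h : G.next k = some u) :
    G.left k = G.left u + if u = G.fst k then 0 else G.len (G.fst k) := by
  rw [left]; split <;> simp_all

variable (G) in
/-- The variable `x` is on the heavy path that starts at `v`. -/
def OnPath (v x : ℕ) : Prop := Relation.ReflTransGen (fun a b => G.next a = some b) v x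

theorem OnPath.head_induction {P : ∀ v, G.OnPath v x → Prop} {v : ℕ} (h : G.OnPath v x)
    (refl : P x .refl)
    (head : ∀ {k u} (hu : G.next k = some u) (h : G.OnPath u x), P u h → P k (.head hu h)) :
    P v h :=
  Relation.ReflTransGen.head_induction_on h refl head

theorem onPath_pathEnd (k : ℕ) : G.OnPath k (G.pathEnd k) := by
  induction k using Nat.strong_induction_on with
  | _ k ih =>
    cases h : G.next k with
    | none => rw [pathEnd_of_none h]; exact .refl
    | some u => rw [pathEnd_of_some h]; exact .head h (ih u (lt_of_next h))

theorem next_pathEnd (G : SLP) (k : ℕ) : G.next (G.pathEnd k) = none := by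
  induction k using Nat.strong_induction_on with
  | _ k ih =>
    cases h : G.next k with
    | none => rwa [pathEnd_of_none h]
    | some u => rw [pathEnd_of_some h]; exact ih u (lt_of_next h)

namespace OnPath

theorem pathEnd_eq (h : G.OnPath v x) : G.pathEnd v = G.pathEnd x := by
  induction h using OnPath.head_induction with
  | refl => rfl
  | head h _ ih => exact (pathEnd_of_some h).trans ih

theorem le (h : G.OnPath v x) : x ≤ v := by
  induction h using OnPath.head_induction with
  | refl => exact le_rfl
  | head h _ ih => exact ih.trans (lt_of_next h).le

theorem level_eq (h : G.OnPath v x) : G.level x = G.level v := by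
  induction h using OnPath.head_induction with
  | refl => rfl
  | head h _ ih => exact ih.trans (next_eq_some_iff.mp h).2.1

theorem occ_le (h : G.OnPath v x) : G.occ v ≤ G.occ x := by
  induction h using OnPath.head_induction with
  | refl => exact le_rfl
  | head h _ ih => exact (occ_le_of_mem_children (next_eq_some_iff.mp h).1).trans ih

theorem exists_str_eq (h : G.OnPath v x) :
    ∃ a b, G.str v = a ++ G.str x ++ b ∧ a.length + G.left x = G.left v := by
  induction h using OnPath.head_induction with
  | refl => exact ⟨[], [], by simp, by simp⟩
  | @head k u hu _ ih =>
    obtain ⟨a, b, hstr, hleft⟩ := ih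
    obtain ⟨hmem, -⟩ := next_eq_some_iff.mp hu
    obtain ⟨htag, hchild⟩ := mem_children.mp hmem
    rw [left_of_some hu, (rule_of_tag_one htag).2.2]
    by_cases hfst : u = G.fst k
    · refine ⟨a, b ++ G.str (G.snd k), ?_, ?_⟩
      · rw [← hfst, hstr]; simp only [List.append_assoc]
      · rw [if_pos hfst, hleft, add_zero]
    · obtain rfl : u = G.snd k := hchild.resolve_left hfst
      refine ⟨G.str (G.fst k) ++ a, b, ?_, ?_⟩
      · rw [hstr]; simp only [List.append_assoc]
      · rw [if_neg hfst, List.length_append, len]; omega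

end OnPath

theorem left_add_len_pathEnd_add_right (G : SLP) (k : ℕ) :
    G.left k + G.len (G.pathEnd k) + G.right k = G.len k := by
  obtain ⟨a, b, hstr, hleft⟩ := (onPath_pathEnd k).exists_str_eq
  have hlen := congrArg List.length hstr
  rw [left_of_none (next_pathEnd G k)] at hleft
  simp only [List.length_append] at hlen
  unfold right len
  omega

theorem right_of_none (h : G.next k = none) : G.right k = 0 := by
  rw [right, pathEnd_of_none h]; omega

theorem right_of_some (h : G.next k = some u) :
    G.right k = G.right u + if u = G.fst k then G.len (G.snd k) else 0 := by
  obtain ⟨htag, hchild⟩ := mem_children.mp (next_eq_some_iff.mp h).1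
  have hk := left_add_len_pathEnd_add_right G k
  have hu := left_add_len_pathEnd_add_right G u
  rw [pathEnd_of_some h, left_of_some h, len_of_tag_one htag] at hk
  split_ifs at hk ⊢ with hfst
  · subst hfst; omega
  · obtain rfl := hchild.resolve_left hfst; omega

namespace OnPath

/-- The string of `x` starts at position `left v - left x` of the string of `v`. -/
theorem getElem?_str (h : G.OnPath v x) {y : ℕ} (hlo : G.left v ≤ y + G.left x)
    (hhi : y + G.right v < G.len v + G.right x) :
    (G.str v)[y]? = (G.str x)[y + G.left x - G.left v]? ∧
      y + G.left x - G.left v < G.len x := by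
  obtain ⟨a, b, hstr, hleft⟩ := h.exists_str_eq
  have hv := left_add_len_pathEnd_add_right G v
  have hx := left_add_len_pathEnd_add_right G x
  rw [h.pathEnd_eq] at hv
  have hlt : y + G.left x - G.left v < (G.str x).length := by
    change _ < G.len x; omega
  refine ⟨?_, hlt⟩
  rw [hstr, List.append_assoc, List.getElem?_append_right (by omega),
    List.getElem?_append_left (by omega)]
  congr 1
  omega

end OnPath

/-- A weight of variables that vanishes at the ends of the heavy paths, decreases along the paths
and is at most the length. The lengths to the left and to the right of the end of the path are two
such weights. -/
structure PathWeight (G : SLP) (g : ℕ → ℕ) : Prop where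
  of_none : ∀ {k}, G.next k = none → g k = 0
  le_of_some : ∀ {k u}, G.next k = some u → g u ≤ g k
  le_len : ∀ k, g k ≤ G.len k

theorem pathWeight_left (G : SLP) : G.PathWeight G.left where
  of_none := left_of_none
  le_of_some h := by rw [left_of_some h]; omega
  le_len k := by have := left_add_len_pathEnd_add_right G k; omega

theorem pathWeight_right (G : SLP) : G.PathWeight G.right where
  of_none := right_of_none
  le_of_some h := by rw [right_of_some h]; omega
  le_len k := by have := left_add_len_pathEnd_add_right G k; omega

namespace PathWeight

variable {g : ℕ → ℕ}

theorem le_of_onPath (hg : G.PathWeight g) (h : G.OnPath v x) : g x ≤ g v := by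
  induction h using OnPath.head_induction with
  | refl => exact le_rfl
  | head h _ ih => exact ih.trans (hg.le_of_some h)

theorem le_len_last (hg : G.PathWeight g) {k : ℕ} (hk : k < G.numVars) :
    g k ≤ G.len (G.numVars - 1) := by
  cases h : G.next k with
  | none => rw [hg.of_none h]; exact Nat.zero_le _
  | some u => exact (hg.le_len k).trans (len_le_of_occ_pos hk (occ_pos_of_next h))

theorem log_le_level (hg : G.PathWeight g) (h : G.OnPath v x) : Nat.log 2 (g v) ≤ G.level x :=
  (Nat.log_mono_right (hg.le_len v)).trans_eq h.level_eq.symm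

end PathWeight

theorem onPath_of_pathEnd_eq (h : G.pathEnd v = G.pathEnd x) (hx : x ≤ v) : G.OnPath v x := by
  have hv : G.OnPath v (G.pathEnd x) := h ▸ onPath_pathEnd v
  have hunique : Relator.RightUnique (Function.swap fun a b => G.next a = some b) :=
    fun _ _ _ => next_inj
  rcases Relation.ReflTransGen.total_of_right_unique hunique
    (Relation.reflTransGen_swap.mpr hv) (Relation.reflTransGen_swap.mpr (onPath_pathEnd x))
      with h | h
  · have h : G.OnPath x v := Relation.reflTransGen_swap.mp h
    exact h.le.antisymm hx ▸ .refl
  · exact Relation.reflTransGen_swap.mp h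

end

end SLP

/-! ## Searching a sorted table -/

/-- The first index `p` in `[a, b)` with `T ≤ S p`, or `b` if there is none. -/
noncomputable def insertionPoint (S : ℕ → ℕ) (a b T : ℕ) : ℕ := sInf {p | a ≤ p ∧ (p < b → T ≤ S p)}

section insertionPoint

variable {S : ℕ → ℕ} {a b p T T' : ℕ}

theorem insertionPoint_mem (S : ℕ → ℕ) (a b T : ℕ) :
    a ≤ insertionPoint S a b T ∧
      (insertionPoint S a b T < b → T ≤ S (insertionPoint S a b T)) :=
  Nat.sInf_mem (s := {p | a ≤ p ∧ (p < b → T ≤ S p)}) ⟨max a b, by simp⟩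

theorem le_insertionPoint (S : ℕ → ℕ) (a b T : ℕ) : a ≤ insertionPoint S a b T :=
  (insertionPoint_mem S a b T).1

theorem insertionPoint_le (hab : a ≤ b) : insertionPoint S a b T ≤ b :=
  Nat.sInf_le ⟨hab, fun h => absurd h (lt_irrefl b)⟩

theorem insertionPoint_mono (h : T ≤ T') : insertionPoint S a b T ≤ insertionPoint S a b T' :=
  Nat.sInf_le ((insertionPoint_mem S a b T').imp_right fun hT' hb => h.trans (hT' hb))

theorem lt_insertionPoint_iff (hS : MonotoneOn S (Set.Ico a b)) (ha : a ≤ p) (hb : p < b) :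
    p < insertionPoint S a b T ↔ S p < T := by
  obtain ⟨hle, hT⟩ := insertionPoint_mem S a b T
  constructor
  · exact fun h => not_le.mp fun hT => h.not_ge (Nat.sInf_le ⟨ha, fun _ => hT⟩)
  · contrapose!
    intro h
    exact (hT (h.trans_lt hb)).trans (hS ⟨hle, h.trans_lt hb⟩ ⟨ha, hb⟩ h)

/-- The width of the buckets that divide the range of a sorted table into as many parts as the table
has entries. -/
def bucketWidth (S : ℕ → ℕ) (a b : ℕ) : ℕ := S (b - 1) / (b - a) + 1

theorem div_bucketWidth_lt (hab : a < b) (hT : T ≤ S (b - 1)) :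
    T / bucketWidth S a b < b - a := by
  refine (Nat.div_lt_iff_lt_mul (Nat.succ_pos _)).mpr ?_
  exact hT.trans_lt (Nat.lt_mul_div_succ _ (by omega))

theorem mul_bucketWidth_le {c : ℕ} (hc : c ≤ b - a) :
    c * bucketWidth S a b ≤ S (b - 1) + (b - a) :=
  (Nat.mul_le_mul_right _ hc).trans
    ((Nat.mul_add_one _ _).trans_le (Nat.add_le_add_right (Nat.mul_div_le _ _) _))

theorem insertionPoint_mul_bucketWidth (hab : a < b) (hS : MonotoneOn S (Set.Ico a b)) :
    insertionPoint S a b ((b - a) * bucketWidth S a b) = b := by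
  obtain ⟨hle, hT⟩ := insertionPoint_mem S a b ((b - a) * bucketWidth S a b)
  refine (insertionPoint_le hab.le).antisymm (not_lt.mp fun hlt => ?_)
  have hmax : S (insertionPoint S a b ((b - a) * bucketWidth S a b)) ≤ S (b - 1) :=
    hS ⟨hle, hlt⟩ ⟨by omega, by omega⟩ (by omega)
  exact ((hT hlt).trans hmax).not_gt (Nat.lt_mul_div_succ _ (by omega))

/-- Two consecutive entries in the interior of a bucket differ by less than its width. -/
theorem log_sub_add_log_gap_le {c : ℕ} (hab : a < b) (hS : MonotoneOn S (Set.Ico a b))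
    (hlo : insertionPoint S a b (c * bucketWidth S a b) < p)
    (hhi : p < insertionPoint S a b ((c + 1) * bucketWidth S a b)) (hgap : S (p - 1) < S p) :
    Nat.log 2 (b - a) + Nat.log 2 (S p - S (p - 1)) ≤ Nat.log 2 (S (b - 1)) := by
  have ha := le_insertionPoint S a b (c * bucketWidth S a b)
  have hb := hhi.trans_le (insertionPoint_le hab.le)
  have hlow : c * bucketWidth S a b ≤ S (p - 1) := by
    rw [← not_lt, ← lt_insertionPoint_iff hS (by omega) (by omega)]
    omega
  have hhigh := (lt_insertionPoint_iff hS (by omega) hb).mp hhi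
  have hdiff : S p - S (p - 1) ≤ S (b - 1) / (b - a) := by
    rw [add_mul, one_mul, bucketWidth] at hhigh
    rw [bucketWidth] at hlow
    omega
  have hmul : (b - a) * (S p - S (p - 1)) ≤ S (b - 1) :=
    (Nat.mul_le_mul_left _ hdiff).trans (Nat.mul_div_le _ _)
  refine Nat.le_log_of_pow_le one_lt_two (le_trans ?_ hmul)
  rw [pow_add]
  exact Nat.mul_le_mul (Nat.pow_log_le_self 2 (by omega)) (Nat.pow_log_le_self 2 (by omega))

end insertionPoint

namespace SLP

section

/-! ## The list of all heavy paths -/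

variable {G : SLP} {e j k p u : ℕ}

variable (G) in
/-- The number of smaller variables on the heavy path of a variable. -/
def rank (k : ℕ) : ℕ := Nat.count (fun j => G.pathEnd j = G.pathEnd k) k

variable (G) in
/-- The number of variables on the heavy path that ends in `e`. -/
def pathSize (e : ℕ) : ℕ := Nat.count (fun j => G.pathEnd j = e) G.numVars

variable (G) in
/-- The position at which the heavy path that ends in `e` starts when all heavy paths are listed one
after the other. -/
def pathStart (e : ℕ) : ℕ := ∑ i ∈ Finset.range e, G.pathSize i

variable (G) in
/-- The position of a variable in the list of all heavy paths. -/
def pos (k : ℕ) : ℕ := G.pathStart (G.pathEnd k) + G.rank k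

variable (G) in
/-- The variable at a position of the list of all heavy paths. -/
noncomputable def varAt : ℕ → ℕ := Function.invFunOn G.pos (Set.Iio G.numVars)

theorem pathEnd_le (k : ℕ) : G.pathEnd k ≤ k := (onPath_pathEnd k).le

theorem pathStart_succ (G : SLP) (e : ℕ) : G.pathStart (e + 1) = G.pathStart e + G.pathSize e :=
  Finset.sum_range_succ _ _

theorem pathStart_mono (G : SLP) : Monotone G.pathStart := fun _ _ h =>
  Finset.sum_le_sum_of_subset (Finset.range_mono h)

theorem pathStart_numVars (G : SLP) : G.pathStart G.numVars = G.numVars := by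
  have h := Finset.card_eq_sum_card_fiberwise (f := G.pathEnd) (s := Finset.range G.numVars)
    (t := Finset.range G.numVars) fun k hk => by
      have := pathEnd_le (G := G) k
      simp only [Finset.coe_range, Set.mem_Iio] at hk ⊢
      omega
  rw [Finset.card_range] at h
  simp only [pathStart, pathSize, Nat.count_eq_card_filter_range]
  exact h.symm

theorem pathStart_le (he : e ≤ G.numVars) : G.pathStart e ≤ G.numVars :=
  (G.pathStart_mono he).trans_eq G.pathStart_numVars

theorem rank_lt_pathSize (hk : k < G.numVars) : G.rank k < G.pathSize (G.pathEnd k) :=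
  Nat.count_strict_mono rfl hk

theorem pathStart_le_pos (k : ℕ) : G.pathStart (G.pathEnd k) ≤ G.pos k := Nat.le_add_right _ _

theorem pos_lt_pathStart_succ (hk : k < G.numVars) :
    G.pos k < G.pathStart (G.pathEnd k + 1) := by
  rw [pathStart_succ]
  exact Nat.add_lt_add_left (rank_lt_pathSize hk) _

theorem pos_lt (hk : k < G.numVars) : G.pos k < G.numVars :=
  (pos_lt_pathStart_succ hk).trans_le (pathStart_le ((pathEnd_le k).trans_lt hk))

theorem pos_le_iff (h : G.pathEnd j = G.pathEnd k) :
    G.pos j ≤ G.pos k ↔ j ≤ k := by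
  simp only [pos, rank, h, Nat.add_le_add_iff_left]
  constructor
  · contrapose!
    exact fun hkj => Nat.count_strict_mono rfl hkj
  · exact fun hjk => Nat.count_monotone _ hjk

theorem pathEnd_eq_of_pos_mem (hk : k < G.numVars) (hlo : G.pathStart e ≤ G.pos k)
    (hhi : G.pos k < G.pathStart (e + 1)) : G.pathEnd k = e := by
  by_contra! hne
  rcases hne.lt_or_gt with h | h
  · exact ((pos_lt_pathStart_succ hk).trans_le (G.pathStart_mono h)).not_ge hlo
  · exact (hhi.trans_le (G.pathStart_mono h)).not_ge (pathStart_le_pos k)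

theorem pos_injOn (G : SLP) : Set.InjOn G.pos (Set.Iio G.numVars) := by
  intro j hj k hk h
  have hend : G.pathEnd j = G.pathEnd k :=
    pathEnd_eq_of_pos_mem hj (h ▸ pathStart_le_pos k) (h ▸ pos_lt_pathStart_succ hk)
  exact ((pos_le_iff hend).mp h.le).antisymm ((pos_le_iff hend.symm).mp h.ge)

theorem varAt_pos (hk : k < G.numVars) : G.varAt (G.pos k) = k :=
  G.pos_injOn.leftInvOn_invFunOn hk

theorem pos_surjOn (G : SLP) : Set.SurjOn G.pos (Set.Iio G.numVars) (Set.Iio G.numVars) := by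
  have := Finset.surjOn_of_injOn_of_card_le (s := Finset.range G.numVars)
    (t := Finset.range G.numVars) G.pos (fun k hk => by simpa using pos_lt (by simpa using hk))
    (by simpa using G.pos_injOn) le_rfl
  simpa using this

theorem varAt_lt (hp : p < G.numVars) : G.varAt p < G.numVars :=
  Function.invFunOn_mem (G.pos_surjOn hp)

theorem pos_varAt (hp : p < G.numVars) : G.pos (G.varAt p) = p :=
  Function.invFunOn_eq (G.pos_surjOn hp)

theorem pathEnd_varAt (he : e < G.numVars) (hlo : G.pathStart e ≤ p)
    (hhi : p < G.pathStart (e + 1)) : G.pathEnd (G.varAt p) = e := by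
  have hp : p < G.numVars := hhi.trans_le (pathStart_le he)
  exact pathEnd_eq_of_pos_mem (varAt_lt hp) (by rwa [pos_varAt hp]) (by rwa [pos_varAt hp])

theorem rank_of_none (h : G.next k = none) : G.rank k = 0 := by
  refine Nat.count_of_forall_not fun j hj hend => ?_
  rcases (onPath_of_pathEnd_eq hend.symm hj.le).cases_head with rfl | ⟨u, hu, -⟩
  · exact lt_irrefl _ hj
  · rw [h] at hu; cases hu

theorem rank_of_some (h : G.next k = some u) : G.rank k = G.rank u + 1 := by
  obtain ⟨d, rfl⟩ := Nat.exists_eq_add_of_lt (lt_of_next h)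
  have hzero : Nat.count (fun j => G.pathEnd (u + 1 + j) = G.pathEnd u) d = 0 := by
    refine Nat.count_of_forall_not fun j hj hend => ?_
    rw [← pathEnd_of_some h] at hend
    rcases (onPath_of_pathEnd_eq hend.symm (by omega)).cases_head with heq | ⟨u', hu', hpath⟩
    · omega
    · obtain rfl : u = u' := by rw [h] at hu'; exact Option.some.inj hu'
      have := OnPath.le hpath
      omega
  rw [rank, pathEnd_of_some h, add_right_comm, Nat.count_add, hzero, Nat.count_succ, if_pos rfl,
    add_zero, rank]

theorem pos_of_some (h : G.next k = some u) : G.pos k = G.pos u + 1 := by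
  rw [pos, pos, pathEnd_of_some h, rank_of_some h, add_assoc]

variable (G) in
/-- The position in the list of all heavy paths at which the weight `g` reaches `T` on the path that
ends in `e`. -/
noncomputable def pathSearch (g : ℕ → ℕ) (e T : ℕ) : ℕ :=
  insertionPoint (g ∘ G.varAt) (G.pathStart e) (G.pathStart (e + 1)) T

variable (G) in
/-- The width of the buckets for the weights `g` on the path that ends in `e`. -/
noncomputable def pathWidth (g : ℕ → ℕ) (e : ℕ) : ℕ :=
  bucketWidth (g ∘ G.varAt) (G.pathStart e) (G.pathStart (e + 1))

theorem PathWeight.monotoneOn {g : ℕ → ℕ} (hg : G.PathWeight g) (he : e < G.numVars) :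
    MonotoneOn (g ∘ G.varAt) (Set.Ico (G.pathStart e) (G.pathStart (e + 1))) := by
  intro p hp q hq hpq
  have hlt {p : ℕ} (hp : p < G.pathStart (e + 1)) : p < G.numVars := hp.trans_le (pathStart_le he)
  have hend : G.pathEnd (G.varAt p) = G.pathEnd (G.varAt q) := by
    rw [pathEnd_varAt he hp.1 hp.2, pathEnd_varAt he hq.1 hq.2]
  refine hg.le_of_onPath (onPath_of_pathEnd_eq hend.symm ((pos_le_iff hend).mp ?_))
  rwa [pos_varAt (hlt hp.2), pos_varAt (hlt hq.2)]

end

section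

/-! ## Leaving a heavy path -/

variable {G : SLP} {e k p u v x y z : ℕ}

variable (G) in
/-- An upper bound for how often the number of occurrences of a variable can still double. -/
def room (k : ℕ) : ℕ := Nat.log 2 (G.len (G.numVars - 1) / G.occ k)

theorem room_mono (hv : 0 < G.occ v) (h : G.occ v ≤ G.occ z) : G.room z ≤ G.room v :=
  Nat.log_mono_right (Nat.div_le_div_left h hv)

theorem room_lt (hz : z < G.numVars) (hv : 0 < G.occ v) (h : 2 * G.occ v ≤ G.occ z) :
    G.room z < G.room v := by
  have hpow : 2 ^ G.room z * G.occ z ≤ G.len (G.numVars - 1) :=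
    (Nat.le_div_iff_mul_le (by omega)).mp
      (Nat.pow_log_le_self 2 (Nat.div_pos (occ_le hz) (by omega)).ne')
  refine Nat.le_log_of_pow_le one_lt_two ((Nat.le_div_iff_mul_le hv).mpr (le_trans ?_ hpow))
  rw [pow_succ, mul_assoc]
  exact Nat.mul_le_mul_left _ h

theorem level_add_room_lt (hv : 0 < G.occ v) (h : G.OnPath v x) (hz : z ∈ G.children x)
    (hne : G.next x ≠ some z) : G.level z + G.room z < G.level v + G.room v := by
  have hocc := h.occ_le.trans (occ_le_of_mem_children hz)
  have hlevel := h.level_eq ▸ level_mono_of_mem_children hz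
  have hnot : ¬ G.Heavy x z := fun hheavy => hne (next_eq_some_iff.mpr ⟨hz, hheavy⟩)
  rcases hlevel.lt_or_eq with hlt | heq
  · exact add_lt_add_of_lt_of_le hlt (room_mono hv hocc)
  · refine add_lt_add_of_le_of_lt heq.le (room_lt (lt_numVars_of_mem_children hz) hv ?_)
    have : ¬ G.occ z < 2 * G.occ x := fun hlt => hnot ⟨heq.trans h.level_eq.symm, hlt⟩
    have := h.occ_le
    omega

variable (G) in
/-- The child of `x` in whose string the position `y` of the string of `x` lies, and that position
in the string of the child. -/
def descend (x y : ℕ) : ℕ × ℕ :=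
  if y < G.len (G.fst x) then (G.fst x, y) else (G.snd x, y - G.len (G.fst x))

theorem descend_of_lt (h : y < G.len (G.fst x)) : G.descend x y = (G.fst x, y) := if_pos h

theorem descend_of_ge (h : G.len (G.fst x) ≤ y) :
    G.descend x y = (G.snd x, y - G.len (G.fst x)) := if_neg h.not_gt

theorem descend_spec (hx : G.tag x = 1) (hy : y < G.len x) :
    (G.descend x y).1 ∈ G.children x ∧ (G.descend x y).2 < G.len (G.descend x y).1 ∧
      (G.str x)[y]? = (G.str (G.descend x y).1)[(G.descend x y).2]? := by
  rw [len_of_tag_one hx] at hy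
  rw [(rule_of_tag_one hx).2.2]
  rcases lt_or_ge y (G.len (G.fst x)) with h | h
  · rw [descend_of_lt h]
    exact ⟨mem_children.mpr ⟨hx, .inl rfl⟩, h, List.getElem?_append_left h⟩
  · rw [descend_of_ge h]
    exact ⟨mem_children.mpr ⟨hx, .inr rfl⟩, show y - _ < G.len (G.snd x) by omega,
      List.getElem?_append_right h⟩

variable (G) in
/-- The path from `v` to the leaf at position `y` in the derivation tree leaves the heavy path
at `x`. -/
structure Exit (v y x : ℕ) : Prop where
  onPath : G.OnPath v x
  tag_eq : G.tag x = 1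
  left_le : G.left v ≤ y + G.left x
  lt_right : y + G.right v < G.len v + G.right x
  next_ne : G.next x ≠ some (G.descend x (y + G.left x - G.left v)).1

variable (G) in
/-- The variable and the position in its string at which the search for position `y` of the string
of `v` continues when the heavy path is left at `x`. -/
def follow (v y x : ℕ) : ℕ × ℕ := G.descend x (y + G.left x - G.left v)

theorem Exit.follow_spec (h : G.Exit v y x) (hv : 0 < G.occ v) :
    (G.follow v y x).1 ∈ G.children x ∧ (G.follow v y x).2 < G.len (G.follow v y x).1 ∧
      (G.str v)[y]? = (G.str (G.follow v y x).1)[(G.follow v y x).2]? ∧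
      G.level (G.follow v y x).1 + G.room (G.follow v y x).1 < G.level v + G.room v := by
  obtain ⟨hstr, hlt⟩ := h.onPath.getElem?_str h.left_le h.lt_right
  obtain ⟨hmem, hlt', hstr'⟩ := descend_spec h.tag_eq hlt
  exact ⟨hmem, hlt', hstr.trans hstr', level_add_room_lt hv h.onPath hmem h.next_ne⟩

theorem exit_pathEnd (hv : G.tag (G.pathEnd v) = 1) (hlo : G.left v ≤ y)
    (hhi : y < G.left v + G.len (G.pathEnd v)) : G.Exit v y (G.pathEnd v) where
  onPath := onPath_pathEnd v
  tag_eq := hv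
  left_le := by omega
  lt_right := by have := left_add_len_pathEnd_add_right G v; omega
  next_ne := by rw [next_pathEnd]; nofun

theorem exit_left (h : G.OnPath v x) (hu : G.next x = some u) (hy : y < G.left v)
    (hlt : G.left u < G.left v - y) (hle : G.left v - y ≤ G.left x) :
    G.Exit v y x ∧ G.len (G.follow v y x).1 = G.left x - G.left u := by
  have hleft := left_of_some hu
  have hfst : u ≠ G.fst x := fun hfst => by rw [if_pos hfst] at hleft; omega
  rw [if_neg hfst] at hleft
  have hdesc := descend_of_lt (G := G) (x := x) (y := y + G.left x - G.left v) (by omega)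
  refine ⟨⟨h, tag_of_next hu, by omega, ?_, ?_⟩, ?_⟩
  · have := left_add_len_pathEnd_add_right G v; omega
  · rw [hdesc, hu]; exact fun heq => hfst (Option.some.inj heq)
  · rw [follow, hdesc, hleft, Nat.add_sub_cancel_left]

theorem exit_right (h : G.OnPath v x) (hu : G.next x = some u)
    (hlt : G.right u < y + 1 - G.left v - G.len (G.pathEnd v))
    (hle : y + 1 - G.left v - G.len (G.pathEnd v) ≤ G.right x) :
    G.Exit v y x ∧ G.len (G.follow v y x).1 = G.right x - G.right u := by
  have hright := right_of_some hu
  have hfst : u = G.fst x := by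
    by_contra hfst
    rw [if_neg hfst] at hright
    omega
  have hleft := left_of_some hu
  have hlen := left_add_len_pathEnd_add_right G u
  rw [if_pos hfst] at hleft hright
  rw [← pathEnd_of_some hu, ← h.pathEnd_eq] at hlen
  have hdesc := descend_of_ge (G := G) (x := x) (y := y + G.left x - G.left v)
    (by rw [← hfst]; omega)
  refine ⟨⟨h, tag_of_next hu, by omega, ?_, ?_⟩, ?_⟩
  · have := left_add_len_pathEnd_add_right G v; omega
  · rw [hdesc, hu, hfst]; exact fun heq => fst_ne_snd_of_next hu (Option.some.inj heq)
  · rw [follow, hdesc, hright, Nat.add_sub_cancel_left]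

theorem pos_of_none (h : G.next k = none) : G.pos k = G.pathStart k := by
  rw [pos, rank_of_none h, pathEnd_of_none h, add_zero]

theorem exists_next_varAt (he : G.next e = none) (hem : e < G.numVars)
    (hlo : G.pathStart e < p) (hhi : p < G.pathStart (e + 1)) :
    ∃ u, G.next (G.varAt p) = some u ∧ G.varAt (p - 1) = u := by
  have hp : p < G.numVars := hhi.trans_le (pathStart_le hem)
  have hpos := pos_varAt hp
  obtain ⟨u, hu⟩ : ∃ u, G.next (G.varAt p) = some u := by
    refine Option.ne_none_iff_exists'.mp fun hnone => ?_
    rw [← pathEnd_of_none hnone, pathEnd_varAt hem hlo.le hhi, pos_of_none he] at hpos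
    exact hlo.ne hpos
  refine ⟨u, hu, ?_⟩
  rw [← hpos, pos_of_some hu, Nat.add_sub_cancel, varAt_pos ((lt_of_next hu).trans (varAt_lt hp))]

theorem PathWeight.exists_next {g : ℕ → ℕ} {T : ℕ} (hg : G.PathWeight g) (hk : k < G.numVars)
    (he : G.pathEnd k = e) (hT : 0 < T) (hTk : T ≤ g k)
    (hp : G.pathSearch g e T = p) :
    G.pathStart e < p ∧ p < G.pathStart (e + 1) ∧ G.OnPath k (G.varAt p) ∧
      ∃ u, G.next (G.varAt p) = some u ∧ G.varAt (p - 1) = u ∧ g u < T ∧ T ≤ g (G.varAt p) := by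
  have hem : e < G.numVars := he ▸ (pathEnd_le k).trans_lt hk
  have hend : G.next e = none := he ▸ next_pathEnd G k
  have hlt_iff {q : ℕ} (hlo : G.pathStart e ≤ q) (hhi : q < G.pathStart (e + 1)) :
      q < p ↔ g (G.varAt q) < T := hp ▸ lt_insertionPoint_iff (hg.monotoneOn hem) hlo hhi
  have hk_lt : G.pos k < G.pathStart (e + 1) := he ▸ pos_lt_pathStart_succ hk
  have hpk : p ≤ G.pos k := by
    rw [← not_lt, hlt_iff (he ▸ pathStart_le_pos k) hk_lt, varAt_pos hk]
    exact hTk.not_gt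
  have hpb := hpk.trans_lt hk_lt
  have hap : G.pathStart e < p := by
    have hend_pos := pos_of_none hend
    have hne := pos_lt_pathStart_succ hem
    rw [hend_pos, pathEnd_of_none hend] at hne
    rwa [hlt_iff le_rfl hne, ← hend_pos, varAt_pos hem, hg.of_none hend]
  have hpath : G.pathEnd (G.varAt p) = e := pathEnd_varAt hem hap.le hpb
  obtain ⟨u, hu, hprev⟩ := exists_next_varAt hend hem hap hpb
  refine ⟨hap, hpb, onPath_of_pathEnd_eq (he.trans hpath.symm) ?_, u, hu, hprev, ?_, ?_⟩
  · rwa [← pos_le_iff (hpath.trans he.symm), pos_varAt (hpb.trans_le (pathStart_le hem))]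
  · rw [← hprev, ← hlt_iff (by omega) (by omega)]; omega
  · rw [← not_lt, ← hlt_iff hap.le hpb]; exact lt_irrefl p

theorem tag_pathEnd (hv : v < G.numVars) (h : G.tag v = 1) : G.tag (G.pathEnd v) = 1 := by
  have hend := (pathEnd_le (G := G) v).trans_lt hv
  refine (tag_eq G _).resolve_left fun h0 => ?_
  have hlevel := (onPath_pathEnd (G := G) v).level_eq
  obtain ⟨hfst, hsnd, -⟩ := rule_of_tag_one h
  have := len_pos (hfst.trans hv)
  have := len_pos (hsnd.trans hv)
  rw [level, len_of_tag_zero hend h0, Nat.log_one_right, level, eq_comm,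
    Nat.log_eq_zero_iff, len_of_tag_one h] at hlevel
  omega

end

section

/-! ## The search for a position -/

variable {G : SLP} {i v x y : ℕ}

/-- A potential for the search for a position: it pays for a step that leaves the heavy path of `v`
and for the levels which the search loses there. -/
def height (G : SLP) (v : ℕ) : ℕ := 2 * G.level v + G.room v

/-- The search for position `i` of the whole string can go on as the search for position `y` of the
string of `v`. -/
structure Reaches (G : SLP) (i v y : ℕ) : Prop where
  lt_numVars : v < G.numVars
  occ_pos : 0 < G.occ v
  lt_len : y < G.len v
  getElem?_eq : (G.str (G.numVars - 1))[i]? = (G.str v)[y]?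

theorem Reaches.follow (h : G.Reaches i v y) (hx : G.Exit v y x) :
    G.Reaches i (G.follow v y x).1 (G.follow v y x).2 ∧
      G.level v - G.level (G.follow v y x).1 + 1 + G.height (G.follow v y x).1 ≤ G.height v := by
  obtain ⟨hmem, hlt, hstr, hdrop⟩ := hx.follow_spec h.occ_pos
  have hocc := h.occ_pos.trans_le (hx.onPath.occ_le.trans (occ_le_of_mem_children hmem))
  have hlevel := level_mono_of_mem_children hmem
  rw [hx.onPath.level_eq] at hlevel
  refine ⟨⟨lt_numVars_of_mem_children hmem, hocc, hlt, h.getElem?_eq.trans hstr⟩, ?_⟩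
  unfold height
  omega

theorem Reaches.of_tag_zero (h : G.Reaches i v y) (hv : G.tag v = 0) :
    (G.str (G.numVars - 1))[i]? = some (G.fst v) := by
  have hstr := str_of_tag_zero h.lt_numVars hv
  have hlt := h.lt_len
  rw [len_of_tag_zero h.lt_numVars hv, Nat.lt_one_iff] at hlt
  rw [h.getElem?_eq, hstr, hlt, List.getElem?_cons_zero]

theorem reaches_last (hi : i < G.len (G.numVars - 1)) : G.Reaches i (G.numVars - 1) i where
  lt_numVars := Nat.sub_one_lt G.numVars_pos.ne'
  occ_pos := Nat.one_pos.trans_eq occ_last.symm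
  lt_len := hi
  getElem?_eq := rfl

theorem height_last : G.height (G.numVars - 1) = 3 * Nat.log 2 (G.len (G.numVars - 1)) := by
  rw [height, room, occ_last, Nat.div_one, level]
  ring

end

open WordRAM

section

/-! ## The table -/

variable (G : SLP)

/-- The position where the search for the multiple of the bucket width that belongs to position `p`
of the list of all heavy paths ends, for the weights on the path at this position. -/
noncomputable def searchStart (g : ℕ → ℕ) (p : ℕ) : ℕ :=
  G.pathSearch g (G.pathEnd (G.varAt p))
    ((p - G.pathStart (G.pathEnd (G.varAt p))) * G.pathWidth g (G.pathEnd (G.varAt p)))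

/-- The table that the preprocessing program computes. The rows are indexed by variables, except
for the last three columns, whose rows are the positions in the list of all heavy paths. The
lengths of variables that do not occur in the derivation tree may be too large for a word, and they
are replaced by `0`. -/
noncomputable def table : Column → ℕ → ℕ
  | .occ => G.occ
  | .len => fun k => if G.occ k = 0 then 0 else G.len k
  | .pow => fun k => if G.occ k = 0 then 0 else 2 ^ G.level k
  | .next => fun k => (G.next k).getD k
  | .pathEnd => G.pathEnd
  | .left => G.left
  | .right => G.right
  | .rank => G.rank
  | .size => G.pathSize
  | .start => G.pathStart
  | .var => G.varAt
  | .leftStart => G.searchStart G.left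
  | .rightStart => G.searchStart G.right

/-- The memory holds the number of variables in cell `2`, which the rule of the terminal symbol `X₀`
leaves unused, the rules of the program in the other cells of the input, and the table `c`. -/
structure Stores (c : Column → ℕ → ℕ) (mem : ℕ → ℕ) : Prop where
  numVars : mem 2 = G.numVars
  input : ∀ a < 3 * G.numVars, a ≠ 2 → mem a = G.inputMem a
  cell : ∀ f, ∀ k < G.numVars, cell G.numVars mem f k = c f k

/-- The memory stores the table `c`, and register `0` holds the number of variables. -/
structure View (c : Column → ℕ → ℕ) (σ : State) : Prop where
  reg_zero : σ.reg 0 = G.numVars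
  stores : G.Stores c σ.mem

/-- Words are long enough for all addresses, lengths and sums of a few of them. -/
def Roomy (w : ℕ) : Prop := 16 * G.numVars + 4 * G.len (G.numVars - 1) + 16 < 2 ^ w

variable {G} {w k i v : ℕ} {c c' : Column → ℕ → ℕ} {mem : ℕ → ℕ}
  {σ τ : State} {f : Column} {e : Expr}

theorem Roomy.sixteen_lt (hw : G.Roomy w) : 16 < 2 ^ w := by unfold Roomy at hw; omega

theorem Stores.congr (h : G.Stores c mem) (hc : ∀ f, ∀ k < G.numVars, c f k = c' f k) :
    G.Stores c' mem :=
  ⟨h.numVars, h.input, fun f k hk => (h.cell f k hk).trans (hc f k hk)⟩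

theorem Stores.update (h : G.Stores c mem) (hk : k < G.numVars) (f : Column) (v : ℕ) :
    G.Stores (Function.update c f (Function.update (c f) k v))
      (Function.update mem (cellAddr G.numVars f k) v) where
  numVars := by
    rw [Function.update_of_ne (ne_cellAddr (by omega)), h.numVars]
  input a ha ha' := by rw [Function.update_of_ne (ne_cellAddr ha), h.input a ha ha']
  cell f' k' hk' := by
    rw [cell_update, h.cell f' k' hk']
    by_cases hf : f' = f
    · subst hf; simp [Function.update_apply]
    · simp [hf]

/-- The symbol at position `i` of the code of the rule of a variable. -/
def inputExpr (i : ℕ) (e : Expr) : Expr := .load (.const 3 * e + .const i)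

abbrev tagExpr (e : Expr) : Expr := inputExpr 0 e
abbrev fstExpr (e : Expr) : Expr := inputExpr 1 e
abbrev sndExpr (e : Expr) : Expr := inputExpr 2 e

theorem View.safe_cell (h : G.View c σ) (hw : G.Roomy w) (he : e.Safe w (16 * G.numVars) σ)
    (hk : e.eval σ < G.numVars) : (cellExpr f e).Safe w (16 * G.numVars) σ :=
  safe_cellExpr (by unfold Roomy at hw; omega) h.reg_zero he hk

theorem View.safe_addr (h : G.View c σ) (hw : G.Roomy w) (he : e.Safe w (16 * G.numVars) σ)
    (hk : e.eval σ < G.numVars) : (addrExpr f e).Safe w (16 * G.numVars) σ :=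
  safe_addrExpr (by unfold Roomy at hw; omega) h.reg_zero he hk

theorem View.eval_cell (h : G.View c σ) (hk : e.eval σ < G.numVars) :
    (cellExpr f e).eval σ = c f (e.eval σ) := by
  rw [eval_cellExpr, h.reg_zero, h.stores.cell f _ hk]

theorem View.eval_addr (h : G.View c σ) :
    (addrExpr f e).eval σ = cellAddr G.numVars f (e.eval σ) := by
  rw [eval_addrExpr, h.reg_zero]

theorem View.safe_input (hw : G.Roomy w) (hi : i < 3)
    (he : e.Safe w (16 * G.numVars) σ) (hk : e.eval σ < G.numVars) :
    (inputExpr i e).Safe w (16 * G.numVars) σ := by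
  unfold Roomy at hw
  simp only [inputExpr, Expr.safe_load, Expr.safe_add, Expr.safe_mul, Expr.safe_const,
    Expr.eval_add, Expr.eval_mul, Expr.eval_const]
  refine ⟨⟨⟨by simp, he, ?_⟩, ?_, ?_⟩, ?_⟩ <;> omega

theorem View.eval_input (h : G.View c σ) (hi : i < 3) (hk : e.eval σ < G.numVars)
    (hne : e.eval σ ≠ 0 ∨ i ≠ 2) :
    (inputExpr i e).eval σ = G.inputMem (3 * e.eval σ + i) :=
  h.stores.input (3 * e.eval σ + i) (by omega) (by omega)

theorem View.eval_tag (h : G.View c σ) (hk : e.eval σ < G.numVars) :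
    (tagExpr e).eval σ = G.tag (e.eval σ) :=
  h.eval_input (by decide) hk (.inr (by decide))

theorem View.eval_fst (h : G.View c σ) (hk : e.eval σ < G.numVars) :
    (fstExpr e).eval σ = G.fst (e.eval σ) :=
  h.eval_input (by decide) hk (.inr (by decide))

theorem View.eval_snd (h : G.View c σ) (hk : G.tag (e.eval σ) = 1) :
    (sndExpr e).eval σ = G.snd (e.eval σ) :=
  h.eval_input (by decide) (lt_numVars_of_tag hk)
    (.inl (Nat.ne_of_gt ((Nat.zero_le _).trans_lt (rule_of_tag_one hk).1)))

theorem View.assign (h : G.View c σ) {r v : ℕ} (hr : r ≠ 0) :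
    G.View c ⟨Function.update σ.reg r v, σ.mem⟩ :=
  ⟨(Function.update_of_ne hr.symm _ _).trans h.reg_zero, h.stores⟩

/-! ## Filling the columns one by one -/

/-- The loop that computes a column row by row: `p` computes the entry of the row in register `1`
in register `2`. -/
def fill (f : Column) (p : Prog) : Prog :=
  forRange (block [p, .store (addrExpr f (.reg 1)) (.reg 2)])

/-- The first `n` columns and the first `k` rows of the next one are those of `table`, and the rest
is `0`. -/
noncomputable def partialTable (G : SLP) (n k : ℕ) (f : Column) (j : ℕ) : ℕ :=
  if f.index < n ∨ f.index = n ∧ j < k then G.table f j else 0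

theorem Stores.partialTable_succ {n : ℕ} (h : G.Stores (G.partialTable n G.numVars) mem) :
    G.Stores (G.partialTable (n + 1) 0) mem :=
  h.congr fun f k hk => if_congr (by omega) rfl rfl

/-- The program computes `v` in register `2` and preserves registers `0` and `1` and the memory. -/
def Computes (w s b : ℕ) (p : Prog) (σ : State) (v : ℕ) : Prop :=
  Runs w s p σ b fun τ => τ.reg 0 = σ.reg 0 ∧ τ.reg 1 = σ.reg 1 ∧ τ.mem = σ.mem ∧ τ.reg 2 = v

theorem runs_fill {b : ℕ} {p : Prog} (hw : G.Roomy w) (h : G.View (G.partialTable f.index 0) σ)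
    (hp : ∀ σ, ∀ k < G.numVars, σ.reg 1 = k → G.View (G.partialTable f.index k) σ →
      Computes w (16 * G.numVars) b p σ (G.table f k)) :
    Runs w (16 * G.numVars) (fill f p) σ (G.numVars * (b + 20) + 6)
      (G.View (G.partialTable (f.index + 1) 0)) := by
  refine (Runs.forRange (b := b + 12) hw.sixteen_lt (fun k => G.Stores (G.partialTable f.index k))
    h.reg_zero h.stores fun σ h0 k hk h1 hs => ?_).weaken le_rfl
      fun τ hτ => ⟨hτ.1, hτ.2.partialTable_succ⟩
  refine ((hp σ k hk h1 ⟨h0, hs⟩).seq fun τ ⟨hτ0, hτ1, hmem, hτ2⟩ =>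
    Runs.of_wp hw.sixteen_lt ?_).weaken le_rfl fun _ => id
  have hτ : G.View (G.partialTable f.index k) τ := ⟨hτ0.trans h0, hmem ▸ hs⟩
  have hk1 : τ.reg 1 = k := hτ1.trans h1
  simp only [wp_block_cons, wp_store, wp_block_nil, hτ.eval_addr, Expr.eval_reg, hτ2, hk1]
  refine ⟨⟨hτ.safe_addr hw trivial (by simpa [hk1]), cellAddr_lt hk, trivial⟩, hτ.reg_zero,
    trivial, (hτ.stores.update hk f _).congr fun f' j _ => ?_⟩
  rcases eq_or_ne f' f with rfl | hf
  · simp only [partialTable, Function.update_self, Function.update_apply]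
    grind
  · simp [partialTable, hf, Column.index_injective.ne hf]

end

section

/-! ## The columns of the table -/

variable {G : SLP} {k z : ℕ}

@[simp] theorem table_occ : G.table .occ = G.occ := rfl
@[simp] theorem table_pathEnd : G.table .pathEnd = G.pathEnd := rfl
@[simp] theorem table_left : G.table .left = G.left := rfl
@[simp] theorem table_right : G.table .right = G.right := rfl
@[simp] theorem table_rank : G.table .rank = G.rank := rfl
@[simp] theorem table_size : G.table .size = G.pathSize := rfl
@[simp] theorem table_start : G.table .start = G.pathStart := rfl

theorem table_len_of_occ_pos (h : 0 < G.occ k) : G.table .len k = G.len k := if_neg h.ne'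

theorem table_pow_of_occ_pos (h : 0 < G.occ k) : G.table .pow k = 2 ^ G.level k := if_neg h.ne'

theorem table_len_le (hk : k < G.numVars) : G.table .len k ≤ G.len (G.numVars - 1) := by
  rcases (G.occ k).eq_zero_or_pos with h | h
  · simp [table, h]
  · exact (table_len_of_occ_pos h).trans_le (len_le_of_occ_pos hk h)

theorem table_pow_le (hk : k < G.numVars) : G.table .pow k ≤ G.table .len k := by
  simp only [table]
  split
  · exact le_rfl
  · exact two_pow_level_le hk

theorem fst_mem_children (h : G.tag k = 1) : G.fst k ∈ G.children k :=
  mem_children.mpr ⟨h, .inl rfl⟩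

theorem snd_mem_children (h : G.tag k = 1) : G.snd k ∈ G.children k :=
  mem_children.mpr ⟨h, .inr rfl⟩

theorem occ_pos_of_mem_children (hk : 0 < G.occ k) (h : z ∈ G.children k) : 0 < G.occ z :=
  hk.trans_le (occ_le_of_mem_children h)

theorem table_len_eq (hk : k < G.numVars) : G.table .len k =
    if G.occ k = 0 then 0
    else if G.tag k = 0 then 1 else G.table .len (G.fst k) + G.table .len (G.snd k) := by
  rcases (G.occ k).eq_zero_or_pos with h | h
  · simp [table, h]
  rw [table_len_of_occ_pos h, if_neg h.ne']
  split_ifs with htag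
  · exact len_of_tag_zero hk htag
  · replace htag := (tag_eq G k).resolve_left htag
    rw [table_len_of_occ_pos (occ_pos_of_mem_children h (fst_mem_children htag)),
      table_len_of_occ_pos (occ_pos_of_mem_children h (snd_mem_children htag)), len_of_tag_one htag]

theorem two_pow_level_of_tag_one (h : G.tag k = 1) {P : ℕ}
    (hP : P = max (2 ^ G.level (G.fst k)) (2 ^ G.level (G.snd k))) :
    2 ^ G.level k = if G.len k < 2 * P then P else 2 * P := by
  have hk := lt_numVars_of_tag h
  obtain ⟨hfst, hsnd, -⟩ := rule_of_tag_one h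
  have hle_len : P ≤ G.len k := by
    rw [hP, len_of_tag_one h]
    exact max_le ((two_pow_level_le (hfst.trans hk)).trans (Nat.le_add_right _ _))
      ((two_pow_level_le (hsnd.trans hk)).trans (Nat.le_add_left _ _))
  have hlen_lt : G.len k < 4 * P := by
    have h₁ := len_lt_two_pow_level (G := G) (G.fst k)
    have h₂ := len_lt_two_pow_level (G := G) (G.snd k)
    rw [len_of_tag_one h, hP]
    grind
  obtain ⟨l, rfl⟩ : ∃ l, P = 2 ^ l := by
    rcases max_choice (2 ^ G.level (G.fst k)) (2 ^ G.level (G.snd k)) with hmax | hmax <;>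
      exact ⟨_, hP.trans hmax⟩
  rw [← pow_succ']
  split_ifs with hlt
  · rw [level, Nat.log_eq_of_pow_le_of_lt_pow hle_len hlt]
  · rw [level, Nat.log_eq_of_pow_le_of_lt_pow (not_lt.mp hlt)
      (hlen_lt.trans_eq (by rw [pow_succ, pow_succ]; ring))]

theorem table_pow_eq (hk : k < G.numVars) {P : ℕ}
    (hP : P = max (G.table .pow (G.fst k)) (G.table .pow (G.snd k))) : G.table .pow k =
    if G.occ k = 0 then 0
    else if G.tag k = 0 then 1 else if G.table .len k < 2 * P then P else 2 * P := by
  rcases (G.occ k).eq_zero_or_pos with h | h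
  · simp [table, h]
  rw [table_pow_of_occ_pos h, if_neg h.ne', table_len_of_occ_pos h]
  rcases tag_eq G k with htag | htag
  · rw [if_pos htag, level, len_of_tag_zero hk htag, Nat.log_one_right, pow_zero]
  · rw [table_pow_of_occ_pos (occ_pos_of_mem_children h (fst_mem_children htag)),
      table_pow_of_occ_pos (occ_pos_of_mem_children h (snd_mem_children htag))] at hP
    rw [if_neg (by omega), two_pow_level_of_tag_one htag hP]

theorem heavy_iff (hz : z ∈ G.children k) :
    G.Heavy k z ↔ G.table .pow z = G.table .pow k ∧ G.occ z < 2 * G.occ k := by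
  refine and_congr_left fun hocc => ?_
  have hk : 0 < G.occ k := by omega
  rw [table_pow_of_occ_pos hk, table_pow_of_occ_pos (occ_pos_of_mem_children hk hz),
    Nat.pow_right_inj one_lt_two]

theorem table_next_eq (k : ℕ) : G.table .next k =
    if G.tag k = 0 then k
    else if G.table .pow (G.fst k) = G.table .pow k ∧ G.occ (G.fst k) < 2 * G.occ k then G.fst k
    else if G.table .pow (G.snd k) = G.table .pow k ∧ G.occ (G.snd k) < 2 * G.occ k then G.snd k
    else k := by
  rcases tag_eq G k with htag | htag
  · simp [table, next, children, htag]
  · simp only [← heavy_iff (fst_mem_children htag), ← heavy_iff (snd_mem_children htag)]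
    simp only [table, next, children, htag, if_true, List.find?_cons, List.find?_nil]
    by_cases hfst : G.Heavy k (G.fst k) <;> by_cases hsnd : G.Heavy k (G.snd k) <;>
      simp [hfst, hsnd]

theorem table_next_of_none (h : G.next k = none) : G.table .next k = k := by simp [table, h]

theorem table_next_of_some {u : ℕ} (h : G.next k = some u) : G.table .next k = u := by
  simp [table, h]

theorem tag_of_table_next_ne (h : G.table .next k ≠ k) : G.tag k = 1 :=
  let ⟨_, hu⟩ := Option.ne_none_iff_exists'.mp (mt table_next_of_none h)
  tag_of_next hu

theorem table_next_le (k : ℕ) : G.table .next k ≤ k := by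
  cases h : G.next k with
  | none => exact (table_next_of_none h).le
  | some u => exact (table_next_of_some h).trans_le (lt_of_next h).le

theorem pathEnd_eq (k : ℕ) : G.pathEnd k =
    if G.table .next k = k then k else G.pathEnd (G.table .next k) := by
  cases h : G.next k with
  | none => rw [table_next_of_none h, if_pos rfl, pathEnd_of_none h]
  | some u => rw [table_next_of_some h, if_neg (lt_of_next h).ne, pathEnd_of_some h]

theorem left_eq (k : ℕ) : G.left k =
    if G.table .next k = k then 0
    else if G.table .next k = G.fst k then G.left (G.table .next k)
    else G.left (G.table .next k) + G.table .len (G.fst k) := by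
  cases h : G.next k with
  | none => rw [table_next_of_none h, if_pos rfl, left_of_none h]
  | some u =>
    rw [table_next_of_some h, if_neg (lt_of_next h).ne, left_of_some h, table_len_of_occ_pos
      (occ_pos_of_mem_children (occ_pos_of_next h) (fst_mem_children (tag_of_next h)))]
    split_ifs <;> rfl

theorem right_eq (k : ℕ) :
    G.right k = G.table .len k - G.left k - G.table .len (G.pathEnd k) := by
  cases h : G.next k with
  | none => rw [pathEnd_of_none h, right_of_none h]; omega
  | some u =>
    have hocc := occ_pos_of_next h
    rw [table_len_of_occ_pos hocc, table_len_of_occ_pos (hocc.trans_le (onPath_pathEnd k).occ_le),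
      right]

theorem rank_eq (k : ℕ) : G.rank k =
    if G.table .next k = k then 0 else G.rank (G.table .next k) + 1 := by
  cases h : G.next k with
  | none => rw [table_next_of_none h, if_pos rfl, rank_of_none h]
  | some u => rw [table_next_of_some h, if_neg (lt_of_next h).ne, rank_of_some h]

theorem pathStart_eq (k : ℕ) : G.pathStart k =
    if k = 0 then 0 else G.pathStart (k - 1) + G.pathSize (k - 1) := by
  cases k with
  | zero => rfl
  | succ k => rw [if_neg k.succ_ne_zero, Nat.add_sub_cancel, pathStart_succ]

end

section

/-! ## Programs for the columns -/

variable {G : SLP} {w k v : ℕ} {σ : State} {p : Prog}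

theorem Computes.of_wp {s : ℕ} (hw : 16 < 2 ^ w) (h : p.WP w s σ fun τ =>
      τ.reg 0 = σ.reg 0 ∧ τ.reg 1 = σ.reg 1 ∧ τ.mem = σ.mem ∧ τ.reg 2 = v) :
    Computes w s p.time p σ v :=
  Runs.of_wp hw h

theorem table_len_add_lt (hw : G.Roomy w) {j : ℕ} (hj : j < G.numVars) (hk : k < G.numVars) :
    G.table .len j + G.table .len k < 2 ^ w := by
  have := table_len_le hj
  have := table_len_le hk
  unfold Roomy at hw
  omega

theorem two_mul_table_pow_lt (hw : G.Roomy w) (hk : k < G.numVars) :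
    2 * G.table .pow k < 2 ^ w := by
  have := table_pow_le hk
  have := table_len_add_lt hw hk hk
  omega

theorem two_mul_occ_lt (hw : G.Roomy w) (hk : k < G.numVars) : 2 * G.occ k < 2 ^ w := by
  have := occ_le hk
  unfold Roomy at hw
  omega

def lenProg : Prog :=
  .ite (cellExpr .occ (.reg 1))
    (.ite (tagExpr (.reg 1))
      (.assign 2 (cellExpr .len (fstExpr (.reg 1)) + cellExpr .len (sndExpr (.reg 1))))
      (.assign 2 (.const 1)))
    (.assign 2 (.const 0))

theorem computes_len (hw : G.Roomy w) (hk : k < G.numVars) (h1 : σ.reg 1 = k)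
    (h : G.View (G.partialTable 1 k) σ) :
    Computes w (16 * G.numVars) lenProg.time lenProg σ (G.table .len k) := by
  refine .of_wp hw.sixteen_lt ?_
  rw [table_len_eq hk]
  rcases (G.occ k).eq_zero_or_pos with hocc | hocc
  · simp [lenProg, h.safe_cell hw, h.eval_cell, h1, hk, partialTable, Column.index, table, hocc]
  rcases tag_eq G k with htag | htag
  · simp [lenProg, h.safe_cell hw, h.eval_cell, h.eval_tag, View.safe_input hw, h1, hk, htag,
      partialTable, Column.index, table, hocc.ne']
  · obtain ⟨hfst, hsnd, -⟩ := rule_of_tag_one htag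
    simp [lenProg, h.safe_cell hw, h.eval_cell, h.eval_tag, h.eval_fst, h.eval_snd,
      View.safe_input hw, h1, hk, htag, hfst, hsnd, hfst.trans hk, hsnd.trans hk,
      partialTable, Column.index, hocc.ne', table_len_add_lt hw]

def powProg : Prog :=
  .ite (cellExpr .occ (.reg 1))
    (.ite (tagExpr (.reg 1))
      (block [
        .assign 3 (cellExpr .pow (fstExpr (.reg 1)) +
          (cellExpr .pow (sndExpr (.reg 1)) - cellExpr .pow (fstExpr (.reg 1)))),
        .ite (.op .lt (cellExpr .len (.reg 1)) (.const 2 * .reg 3))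
          (.assign 2 (.reg 3))
          (.assign 2 (.const 2 * .reg 3))])
      (.assign 2 (.const 1)))
    (.assign 2 (.const 0))

theorem computes_pow (hw : G.Roomy w) (hk : k < G.numVars) (h1 : σ.reg 1 = k)
    (h : G.View (G.partialTable 2 k) σ) :
    Computes w (16 * G.numVars) powProg.time powProg σ (G.table .pow k) := by
  refine .of_wp hw.sixteen_lt ?_
  obtain ⟨P, hP⟩ : ∃ P, P = G.table .pow (G.fst k) +
    (G.table .pow (G.snd k) - G.table .pow (G.fst k)) := ⟨_, rfl⟩
  rw [table_pow_eq hk (hP.trans add_tsub_eq_max)]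
  rcases (G.occ k).eq_zero_or_pos with hocc | hocc
  · simp [powProg, h.safe_cell hw, h.eval_cell, h1, hk, partialTable, Column.index, table, hocc]
  rcases tag_eq G k with htag | htag
  · simp [powProg, h.safe_cell hw, h.eval_cell, h.eval_tag, View.safe_input hw, h1, hk, htag,
      partialTable, Column.index, table, hocc.ne']
  · obtain ⟨hfst, hsnd, -⟩ := rule_of_tag_one htag
    have := two_mul_table_pow_lt hw (hfst.trans hk)
    have := two_mul_table_pow_lt hw (hsnd.trans hk)
    have hlt : P < 2 ^ w := by omega
    have hlt' : 2 * P < 2 ^ w := by omega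
    have hview := h.assign (r := 3) (v := P) three_ne_zero
    rcases lt_or_ge (G.table .len k) (2 * P) with hlen | hlen <;>
      simp [powProg, h.safe_cell hw, h.eval_cell, h.eval_tag, h.eval_fst, h.eval_snd,
        hview.safe_cell hw, hview.eval_cell, View.safe_input hw, h1, hk, htag, hfst, hsnd,
        hfst.trans hk, hsnd.trans hk, partialTable, Column.index, hocc.ne', ← hP, hlt, hlt',
        hlen, hlen.not_gt]

/-- The condition that the child `z` of the variable in register `1` is heavy. -/
def heavyExpr (z : Expr) : Expr :=
  .op .eq (cellExpr .pow z) (cellExpr .pow (.reg 1)) *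
    .op .lt (cellExpr .occ z) (.const 2 * cellExpr .occ (.reg 1))

def nextProg : Prog :=
  .ite (tagExpr (.reg 1))
    (.ite (heavyExpr (fstExpr (.reg 1)))
      (.assign 2 (fstExpr (.reg 1)))
      (.ite (heavyExpr (sndExpr (.reg 1)))
        (.assign 2 (sndExpr (.reg 1)))
        (.assign 2 (.reg 1))))
    (.assign 2 (.reg 1))

theorem safe_heavyExpr (hw : G.Roomy w) (hk : k < G.numVars) (h1 : σ.reg 1 = k)
    (h : G.View (G.partialTable 3 k) σ) {e : Expr} (he : e.Safe w (16 * G.numVars) σ)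
    (hlt : e.eval σ < k) : (heavyExpr e).Safe w (16 * G.numVars) σ := by
  have hsq : ∀ p q : Prop, ∀ [Decidable p] [Decidable q],
      (if p then 1 else 0) * (if q then 1 else 0) < 2 ^ w := fun p q _ _ => by
    have := hw.sixteen_lt
    split_ifs <;> omega
  simp [heavyExpr, h.safe_cell hw, h.eval_cell, h1, hk, hlt.trans hk, he, partialTable,
    Column.index, two_mul_occ_lt hw, hsq, -ite_mul, -mul_ite]

theorem eval_heavyExpr (hk : k < G.numVars) (h1 : σ.reg 1 = k)
    (h : G.View (G.partialTable 3 k) σ) {e : Expr} (hlt : e.eval σ < k) :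
    (heavyExpr e).eval σ = if G.table .pow (e.eval σ) = G.table .pow k ∧
      G.occ (e.eval σ) < 2 * G.occ k then 1 else 0 := by
  simp [heavyExpr, h.eval_cell, h1, hk, hlt.trans hk, partialTable, Column.index, ← ite_and,
    and_comm]

theorem computes_next (hw : G.Roomy w) (hk : k < G.numVars) (h1 : σ.reg 1 = k)
    (h : G.View (G.partialTable 3 k) σ) :
    Computes w (16 * G.numVars) nextProg.time nextProg σ (G.table .next k) := by
  refine .of_wp hw.sixteen_lt ?_
  rw [table_next_eq]
  rcases tag_eq G k with htag | htag
  · simp [nextProg, h.eval_tag, View.safe_input hw, h1, hk, htag]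
  · obtain ⟨hfst, hsnd, -⟩ := rule_of_tag_one htag
    rw [if_neg (by omega)]
    split_ifs with hfst' hsnd' <;>
      simp [nextProg, h.eval_tag, h.eval_fst, h.eval_snd, View.safe_input hw,
        safe_heavyExpr hw hk h1 h, eval_heavyExpr hk h1 h, *]

def pathEndProg : Prog :=
  .ite (.op .eq (cellExpr .next (.reg 1)) (.reg 1))
    (.assign 2 (.reg 1))
    (.assign 2 (cellExpr .pathEnd (cellExpr .next (.reg 1))))

theorem computes_pathEnd (hw : G.Roomy w) (hk : k < G.numVars) (h1 : σ.reg 1 = k)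
    (h : G.View (G.partialTable 4 k) σ) :
    Computes w (16 * G.numVars) pathEndProg.time pathEndProg σ (G.table .pathEnd k) := by
  refine .of_wp hw.sixteen_lt ?_
  rw [table_pathEnd, pathEnd_eq]
  have hle := table_next_le (G := G) k
  split_ifs with hnext
  · simp [pathEndProg, h.safe_cell hw, h.eval_cell, h1, hk, partialTable, Column.index, hnext]
  · have hlt := lt_of_le_of_ne hle hnext
    simp [pathEndProg, h.safe_cell hw, h.eval_cell, h1, hk, partialTable, Column.index, hnext, hlt,
      hlt.trans hk]

def leftProg : Prog :=
  .ite (.op .eq (cellExpr .next (.reg 1)) (.reg 1))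
    (.assign 2 (.const 0))
    (.ite (.op .eq (cellExpr .next (.reg 1)) (fstExpr (.reg 1)))
      (.assign 2 (cellExpr .left (cellExpr .next (.reg 1))))
      (.assign 2 (cellExpr .left (cellExpr .next (.reg 1)) + cellExpr .len (fstExpr (.reg 1)))))

theorem computes_left (hw : G.Roomy w) (hk : k < G.numVars) (h1 : σ.reg 1 = k)
    (h : G.View (G.partialTable 5 k) σ) :
    Computes w (16 * G.numVars) leftProg.time leftProg σ (G.table .left k) := by
  refine .of_wp hw.sixteen_lt ?_
  rw [table_left]
  have hle := table_next_le (G := G) k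
  have hlast := (pathWeight_left G).le_len_last hk
  rw [left_eq] at hlast ⊢
  split_ifs at hlast ⊢ with hnext hfst
  · simp [leftProg, h.safe_cell hw, h.eval_cell, h1, hk, partialTable, Column.index, hnext]
  all_goals
    have hlt := lt_of_le_of_ne hle hnext
    have hfst' := (rule_of_tag_one (tag_of_table_next_ne hnext)).1
    have hsum : G.left (G.table .next k) + G.table .len (G.fst k) < 2 ^ w := by
      have := table_len_le (hfst'.trans hk)
      unfold Roomy at hw
      omega
    simp [leftProg, h.safe_cell hw, h.eval_cell, h.eval_fst, View.safe_input hw, h1, hk,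
      partialTable, Column.index, hnext, hlt, hlt.trans hk, hfst, hfst', hfst'.ne,
      hfst'.trans hk, hsum]

def rightProg : Prog :=
  .assign 2 (cellExpr .len (.reg 1) - cellExpr .left (.reg 1) -
    cellExpr .len (cellExpr .pathEnd (.reg 1)))

theorem computes_right (hw : G.Roomy w) (hk : k < G.numVars) (h1 : σ.reg 1 = k)
    (h : G.View (G.partialTable 6 k) σ) :
    Computes w (16 * G.numVars) rightProg.time rightProg σ (G.table .right k) := by
  refine .of_wp hw.sixteen_lt ?_
  have hend := (pathEnd_le (G := G) k).trans_lt hk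
  rw [table_right, right_eq]
  simp [rightProg, h.safe_cell hw, h.eval_cell, h1, hk, partialTable, Column.index, hend]

def rankProg : Prog :=
  .ite (.op .eq (cellExpr .next (.reg 1)) (.reg 1))
    (.assign 2 (.const 0))
    (.assign 2 (cellExpr .rank (cellExpr .next (.reg 1)) + .const 1))

theorem computes_rank (hw : G.Roomy w) (hk : k < G.numVars) (h1 : σ.reg 1 = k)
    (h : G.View (G.partialTable 7 k) σ) :
    Computes w (16 * G.numVars) rankProg.time rankProg σ (G.table .rank k) := by
  refine .of_wp hw.sixteen_lt ?_
  rw [table_rank, rank_eq]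
  have hle := table_next_le (G := G) k
  split_ifs with hnext
  · simp [rankProg, h.safe_cell hw, h.eval_cell, h1, hk, partialTable, Column.index, hnext]
  · have hlt := lt_of_le_of_ne hle hnext
    have hsum : G.rank (G.table .next k) + 1 < 2 ^ w := by
      have : G.rank (G.table .next k) ≤ G.table .next k := Nat.count_le _
      unfold Roomy at hw
      omega
    simp [rankProg, h.safe_cell hw, h.eval_cell, h1, hk, partialTable, Column.index, hnext, hlt,
      hlt.trans hk, hsum]

def startProg : Prog :=
  .ite (.reg 1)
    (.assign 2 (cellExpr .start (.reg 1 - .const 1) + cellExpr .size (.reg 1 - .const 1)))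
    (.assign 2 (.const 0))

theorem computes_start (hw : G.Roomy w) (hk : k < G.numVars) (h1 : σ.reg 1 = k)
    (h : G.View (G.partialTable 9 k) σ) :
    Computes w (16 * G.numVars) startProg.time startProg σ (G.table .start k) := by
  refine .of_wp hw.sixteen_lt ?_
  rw [table_start, pathStart_eq]
  split_ifs with hk0
  · simp [startProg, h1, hk0]
  · have hlt : k - 1 < k := by omega
    have hsum : G.pathStart (k - 1) + G.pathSize (k - 1) < 2 ^ w := by
      rw [← pathStart_succ, Nat.sub_add_cancel (Nat.pos_of_ne_zero hk0)]
      have := pathStart_le (G := G) hk.le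
      unfold Roomy at hw
      omega
    simp [startProg, h.safe_cell hw, h.eval_cell, h1, partialTable, Column.index, hk0, hlt,
      hlt.trans hk, hsum]

end

section

/-! ## Columns that are not filled row by row -/

variable {G : SLP} {w k v : ℕ} {σ : State} {p : Prog} {f : Column}
  {e d : Expr} {Q : State → Prop}

/-- The first columns are those of `table`, the column `f` is `g`, and the rest is `0`. -/
noncomputable def columnTable (G : SLP) (f : Column) (g : ℕ → ℕ) : Column → ℕ → ℕ :=
  Function.update (G.partialTable f.index 0) f g

theorem runs_scatter (g : ℕ → ℕ → ℕ) (hw : G.Roomy w) (h : G.View (G.columnTable f (g 0)) σ)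
    (hg : ∀ j < G.numVars, g G.numVars j = G.table f j)
    (hp : ∀ σ, ∀ k < G.numVars, σ.reg 1 = k → G.View (G.columnTable f (g k)) σ →
      p.WP w (16 * G.numVars) σ fun τ =>
        τ.reg 0 = σ.reg 0 ∧ τ.reg 1 = σ.reg 1 ∧ G.Stores (G.columnTable f (g (k + 1))) τ.mem) :
    Runs w (16 * G.numVars) (forRange p) σ (G.numVars * (p.time + 8) + 6)
      (G.View (G.partialTable (f.index + 1) 0)) := by
  refine (Runs.forRange hw.sixteen_lt (fun k => G.Stores (G.columnTable f (g k)))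
    h.reg_zero h.stores fun σ h0 k hk h1 hs => ?_).weaken le_rfl
      fun τ hτ => ⟨hτ.1, hτ.2.congr fun f' j hj => ?_⟩
  · exact (Runs.of_wp hw.sixteen_lt (hp σ k hk h1 ⟨h0, hs⟩)).weaken le_rfl
      fun τ hτ => ⟨hτ.1.trans h0, hτ.2.1.trans h1, hτ.2.2⟩
  · rcases eq_or_ne f' f with rfl | hf
    · simp [columnTable, partialTable, hg j hj]
    · have := Column.index_injective.ne hf
      simp only [columnTable, partialTable, Function.update_of_ne hf]
      exact if_congr (by omega) rfl rfl

theorem View.store {g : ℕ → ℕ} (h : G.View (G.columnTable f g) σ) (hk : k < G.numVars) :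
    G.View (G.columnTable f (Function.update g k v))
      ⟨σ.reg, Function.update σ.mem (cellAddr G.numVars f k) v⟩ := by
  refine ⟨h.reg_zero, ?_⟩
  simpa [columnTable] using h.stores.update hk f v

/-- The program that adds `d` to column `f` of row `e`. -/
def addTo (f : Column) (e d : Expr) : Prog := .store (addrExpr f e) (cellExpr f e + d)

theorem View.wp_addTo {g : ℕ → ℕ} (hw : G.Roomy w) (h : G.View (G.columnTable f g) σ)
    (he : e.Safe w (16 * G.numVars) σ) (hk : e.eval σ < G.numVars)
    (hd : d.Safe w (16 * G.numVars) σ) (hlt : g (e.eval σ) + d.eval σ < 2 ^ w)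
    (hQ : ∀ τ, τ.reg = σ.reg →
      G.View (G.columnTable f (Function.update g (e.eval σ) (g (e.eval σ) + d.eval σ))) τ → Q τ) :
    (addTo f e d).WP w (16 * G.numVars) σ Q := by
  have hcell : G.columnTable f g f = g := Function.update_self ..
  simp only [addTo, wp_store, Expr.safe_add, Expr.eval_add, h.eval_cell hk, h.eval_addr, hcell]
  exact ⟨⟨h.safe_addr hw he hk, cellAddr_lt hk, h.safe_cell hw he hk, hd, hlt⟩,
    hQ _ rfl (h.store hk)⟩

/-- Distributes the occurrences of the variable in register `2` to its two children. -/
def addToChildren : Prog :=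
  block [
    addTo .occ (fstExpr (.reg 2)) (cellExpr .occ (.reg 2)),
    addTo .occ (sndExpr (.reg 2)) (cellExpr .occ (.reg 2))]

/-- Adds the number of occurrences of a variable to those of its children. Register `1` counts the
variables from the last one down, so that the number of the variable is final by then. -/
def occBody : Prog :=
  block [
    .assign 2 (.reg 0 - .const 1 - .reg 1),
    .ite (tagExpr (.reg 2)) addToChildren .skip]

/-- The start variable labels the root of the derivation tree. -/
def occInit : Prog := .store (addrExpr .occ (.reg 0 - .const 1)) (.const 1)

theorem occAfter_add_lt (hw : G.Roomy w) {i j t : ℕ} (ht : t ≤ G.numVars) (hi : i < G.numVars)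
    (hj : j < G.numVars) : G.occAfter t i + G.occAfter t j + G.occAfter t j < 2 ^ w := by
  have : G.occAfter t i ≤ _ := (occAfter_mono i ht).trans (occ_le hi)
  have : G.occAfter t j ≤ _ := (occAfter_mono j ht).trans (occ_le hj)
  unfold Roomy at hw
  omega

theorem wp_addToChildren (hw : G.Roomy w) {g : ℕ → ℕ} (htag : G.tag k = 1) (h2 : σ.reg 2 = k)
    (h : G.View (G.columnTable .occ g) σ) (hlt : ∀ j < G.numVars, g j + g k + g k < 2 ^ w)
    (hQ : ∀ τ, τ.reg = σ.reg →
      G.Stores (G.columnTable .occ fun z => g z + g k * (G.children k).count z) τ.mem → Q τ) :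
    addToChildren.WP w (16 * G.numVars) σ Q := by
  have hk := lt_numVars_of_tag htag
  obtain ⟨hfst, hsnd, -⟩ := rule_of_tag_one htag
  have hlt_fst := hlt _ (hfst.trans hk)
  have hlt_snd := hlt _ (hsnd.trans hk)
  have hcell : ∀ g, G.columnTable .occ g .occ = g := fun _ => Function.update_self ..
  have heval : (fstExpr (.reg 2)).eval σ = G.fst k ∧ (cellExpr .occ (.reg 2)).eval σ = g k := by
    simp [h.eval_fst, h.eval_cell, hcell, h2, hk]
  rw [addToChildren, wp_block_cons]
  refine h.wp_addTo hw (View.safe_input hw (by decide) trivial (by simpa [h2]))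
    (by simpa [heval] using hfst.trans hk) (h.safe_cell hw trivial (by simpa [h2]))
    (by rw [heval.1, heval.2]; omega) fun τ hτ h' => ?_
  rw [heval.1, heval.2] at h'
  rw [← hτ] at h2
  have heval' : (sndExpr (.reg 2)).eval τ = G.snd k ∧ (cellExpr .occ (.reg 2)).eval τ = g k := by
    simp [h'.eval_snd, h'.eval_cell, hcell, h2, hk, htag, hfst.ne']
  rw [wp_block_cons]
  refine h'.wp_addTo hw (View.safe_input hw (by decide) trivial (by simpa [h2]))
    (by simpa [heval'] using hsnd.trans hk) (h'.safe_cell hw trivial (by simpa [h2]))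
    ?_ fun υ hυ h'' => hQ υ (hυ.trans hτ) ?_
  · rw [heval'.1, heval'.2, Function.update_apply]
    split_ifs <;> omega
  · rw [heval'.1, heval'.2] at h''
    convert h''.stores using 2
    funext z
    simp only [children, htag, if_true, List.count_cons, List.count_nil, Function.update_apply,
      beq_iff_eq]
    grind

theorem wp_occBody (hw : G.Roomy w) {t : ℕ} (ht : t < G.numVars) (h1 : σ.reg 1 = t)
    (h : G.View (G.columnTable .occ (G.occAfter t)) σ) :
    occBody.WP w (16 * G.numVars) σ fun τ => τ.reg 0 = σ.reg 0 ∧ τ.reg 1 = σ.reg 1 ∧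
      G.Stores (G.columnTable .occ (G.occAfter (t + 1))) τ.mem := by
  obtain ⟨k, hk⟩ : ∃ k, k = G.numVars - 1 - t := ⟨_, rfl⟩
  have hkm : k < G.numVars := by omega
  have h' := h.assign (r := 2) (v := k) two_ne_zero
  have hstep : G.occAfter (t + 1) =
      fun z => G.occAfter t z + G.occAfter t k * (G.children k).count z := by
    funext z; rw [occAfter, hk]
  simp only [occBody, wp_block_cons, wp_assign, wp_ite, wp_skip, wp_block_nil, Expr.eval_sub,
    Expr.eval_reg, Expr.eval_const, h.reg_zero, h1, ← hk, hstep]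
  refine ⟨by simp, View.safe_input hw (by decide) trivial (by simpa), fun htag => ?_,
    fun htag => ?_⟩
  · replace htag : G.tag k = 1 := (tag_eq G k).resolve_left (by simpa [h'.eval_tag, hkm] using htag)
    exact wp_addToChildren hw htag (by simp) h' (fun j hj => occAfter_add_lt hw ht.le hj hkm)
      fun τ hτ hs => by simpa [hτ, h.reg_zero, h1] using hs
  · replace htag : G.tag k = 0 := by simpa [h'.eval_tag, hkm] using htag
    simpa [children, htag, h.reg_zero, h1] using h.stores

theorem wp_occInit (hw : G.Roomy w) (h : G.View (G.partialTable 0 0) σ) :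
    occInit.WP w (16 * G.numVars) σ (G.View (G.columnTable .occ (G.occAfter 0))) := by
  have hm := G.numVars_pos
  have hlast : (Expr.reg 0 - Expr.const 1).eval σ = G.numVars - 1 := by simp [h.reg_zero]
  have hlt : (Expr.reg 0 - Expr.const 1).eval σ < G.numVars := by omega
  rw [occInit, wp_store, h.eval_addr]
  refine ⟨⟨h.safe_addr hw (by simp) hlt, cellAddr_lt hlt, by simp⟩, h.reg_zero, ?_⟩
  refine (h.stores.update hlt .occ 1).congr fun f k _ => ?_
  rcases eq_or_ne f .occ with rfl | hf
  · simp [columnTable, partialTable, Column.index, Function.update_apply, h.reg_zero, occAfter]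
  · simp [columnTable, hf, Column.index]

theorem runs_occ (hw : G.Roomy w) (h : G.View (G.partialTable 0 0) σ) :
    Runs w (16 * G.numVars) (.seq occInit (forRange occBody)) σ
      (occInit.time + (G.numVars * (occBody.time + 8) + 6)) (G.View (G.partialTable 1 0)) :=
  (Runs.of_wp hw.sixteen_lt (wp_occInit hw h)).seq fun _ hτ =>
    runs_scatter G.occAfter hw hτ (fun _ _ => rfl) fun _ _ ht h1 h' => wp_occBody hw ht h1 h'

theorem View.columnTable_zero {n : ℕ} {g : ℕ → ℕ} (h : G.View (G.partialTable n 0) σ)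
    (hf : f.index = n) (hg : ∀ j < G.numVars, g j = 0) : G.View (G.columnTable f g) σ := by
  refine ⟨h.reg_zero, h.stores.congr fun f' j hj => ?_⟩
  rcases eq_or_ne f' f with rfl | hne
  · simp [columnTable, partialTable, hf, hg j hj]
  · simp [columnTable, hne, hf]

/-- Counts the variable in register `1` for the size of its heavy path. -/
def sizeBody : Prog := addTo .size (cellExpr .pathEnd (.reg 1)) (.const 1)

theorem runs_size (hw : G.Roomy w) (h : G.View (G.partialTable 8 0) σ) :
    Runs w (16 * G.numVars) (forRange sizeBody) σ (G.numVars * (sizeBody.time + 8) + 6)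
      (G.View (G.partialTable 9 0)) := by
  refine runs_scatter (f := .size) (fun t e => Nat.count (fun j => G.pathEnd j = e) t) hw
    (h.columnTable_zero rfl fun _ _ => Nat.count_zero _) (fun _ _ => rfl) fun σ k hk h1 h => ?_
  have hend := (pathEnd_le (G := G) k).trans_lt hk
  have heval : (cellExpr .pathEnd (.reg 1)).eval σ = G.pathEnd k := by
    simp [h.eval_cell, h1, hk, columnTable, partialTable, Column.index]
  have hlt : Nat.count (fun j => G.pathEnd j = G.pathEnd k) k + 1 < 2 ^ w := by
    have := Nat.count_le (fun j => G.pathEnd j = G.pathEnd k) (n := k)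
    unfold Roomy at hw
    omega
  refine h.wp_addTo hw (h.safe_cell hw trivial (by simpa [h1])) (by simpa [heval]) (by simp)
    (by simpa [heval]) fun τ hτ h' => ⟨by rw [hτ], by rw [hτ], ?_⟩
  convert h'.stores using 2
  funext e
  rw [heval, Nat.count_succ, Function.update_apply]
  rcases eq_or_ne (G.pathEnd k) e with rfl | hne
  · simp
  · simp [hne, hne.symm]

/-- Stores the variable in register `1` at its place in the list of all heavy paths. -/
def varBody : Prog :=
  .store (addrExpr .var (cellExpr .start (cellExpr .pathEnd (.reg 1)) + cellExpr .rank (.reg 1)))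
    (.reg 1)

theorem runs_var (hw : G.Roomy w) (h : G.View (G.partialTable 10 0) σ) :
    Runs w (16 * G.numVars) (forRange varBody) σ (G.numVars * (varBody.time + 8) + 6)
      (G.View (G.partialTable 11 0)) := by
  refine runs_scatter (f := .var) (fun t p => if G.varAt p < t then G.varAt p else 0) hw
    (h.columnTable_zero rfl fun _ _ => if_neg (Nat.not_lt_zero _))
    (fun p hp => if_pos (varAt_lt hp)) fun σ k hk h1 h => ?_
  have hend := (pathEnd_le (G := G) k).trans_lt hk
  have hpos : (cellExpr .start (cellExpr .pathEnd (.reg 1)) + cellExpr .rank (.reg 1)).eval σ =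
      G.pos k := by
    simp [h.eval_cell, h1, hk, hend, columnTable, partialTable, Column.index, pos]
  have hlt : G.pos k < G.numVars := pos_lt hk
  have hsum : G.pathStart (G.pathEnd k) + G.rank k < 2 ^ w := by
    have : G.pathStart (G.pathEnd k) + G.rank k < G.numVars := hlt
    unfold Roomy at hw
    omega
  rw [varBody, wp_store, h.eval_addr, hpos]
  refine ⟨⟨h.safe_addr hw ?_ (hpos ▸ hlt), cellAddr_lt hlt, trivial⟩, rfl, rfl,
    (h.stores.update hlt .var _).congr fun f p hp => ?_⟩
  · simp [h.safe_cell hw, h.eval_cell, h1, hk, hend, columnTable, partialTable, Column.index, hsum]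
  rcases eq_or_ne f .var with rfl | hf
  · simp only [columnTable, Function.update_self, Function.update_apply, Expr.eval_reg, h1]
    rcases eq_or_ne p (G.pos k) with rfl | hne
    · simp [varAt_pos hk]
    · have : G.varAt p ≠ k := fun heq => hne (by rw [← heq, pos_varAt hp])
      grind
  · simp [columnTable, hf]

end

section

/-! ## Searching a heavy path -/

variable {G : SLP} {w e p T i : ℕ} {c : Column → ℕ → ℕ} {g : ℕ → ℕ} {σ τ υ : State}
  {f fs : Column} {q : Expr}

/-- The table `c` is complete enough for a search in column `f`, which holds the weights `g`. -/
structure Searchable (G : SLP) (c : Column → ℕ → ℕ) (f : Column) (g : ℕ → ℕ) : Prop where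
  weight : G.PathWeight g
  pathEnd : ∀ k < G.numVars, c .pathEnd k = G.pathEnd k
  cell : ∀ k < G.numVars, c f k = g k
  start : ∀ k < G.numVars, c .start k = G.pathStart k
  size : ∀ k < G.numVars, c .size k = G.pathSize k
  var : ∀ p < G.numVars, c .var p = G.varAt p

/-- Registers `2` and `3` hold the limits of the path that ends in `e`, in the list of all heavy
paths, and register `4` holds the weight to search for. -/
structure SearchView (G : SLP) (c : Column → ℕ → ℕ) (e T : ℕ) (σ : State) : Prop
    extends G.View c σ where
  reg_two : σ.reg 2 = G.pathStart e
  reg_three : σ.reg 3 = G.pathStart (e + 1)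
  reg_four : σ.reg 4 = T

/-- The memory and the registers below `7` are the same in both states. A search uses the other
registers as scratch space. -/
def Agree (σ τ : State) : Prop := τ.mem = σ.mem ∧ ∀ r < 7, τ.reg r = σ.reg r

theorem Agree.assign {r x : ℕ} (hr : 7 ≤ r) : Agree σ ⟨Function.update σ.reg r x, σ.mem⟩ :=
  ⟨rfl, fun _ hi => Function.update_of_ne (by omega) _ _⟩

theorem Agree.trans (h : Agree σ τ) (h' : Agree τ υ) : Agree σ υ :=
  ⟨h'.1.trans h.1, fun r hr => (h'.2 r hr).trans (h.2 r hr)⟩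

theorem SearchView.congr (h : G.SearchView c e T σ) (hτ : Agree σ τ) : G.SearchView c e T τ where
  reg_zero := (hτ.2 0 (by decide)).trans h.reg_zero
  stores := hτ.1 ▸ h.stores
  reg_two := (hτ.2 2 (by decide)).trans h.reg_two
  reg_three := (hτ.2 3 (by decide)).trans h.reg_three
  reg_four := (hτ.2 4 (by decide)).trans h.reg_four

/-- The entry of column `f` for the variable at position `q` of the list of all heavy paths. -/
def weightExpr (f : Column) (q : Expr) : Expr := cellExpr f (cellExpr .var q)

theorem Searchable.eval_weight (hc : G.Searchable c f g) (h : G.View c σ)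
    (hq : q.eval σ < G.numVars) : (weightExpr f q).eval σ = g (G.varAt (q.eval σ)) := by
  have hvar : (cellExpr .var q).eval σ = G.varAt (q.eval σ) := by rw [h.eval_cell hq, hc.var _ hq]
  have hlt := varAt_lt hq
  rw [weightExpr, h.eval_cell (hvar ▸ hlt), hvar, hc.cell _ hlt]

theorem Searchable.safe_weight (hc : G.Searchable c f g) (h : G.View c σ) (hw : G.Roomy w)
    (hs : q.Safe w (16 * G.numVars) σ) (hq : q.eval σ < G.numVars) :
    (weightExpr f q).Safe w (16 * G.numVars) σ :=
  h.safe_cell hw (h.safe_cell hw hs hq) (by rw [h.eval_cell hq, hc.var _ hq]; exact varAt_lt hq)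

theorem lt_pathSearch_iff (hg : G.PathWeight g) (he : e < G.numVars) (hlo : G.pathStart e ≤ p)
    (hhi : p < G.pathStart (e + 1)) : p < G.pathSearch g e T ↔ g (G.varAt p) < T :=
  lt_insertionPoint_iff (hg.monotoneOn he) hlo hhi

/-- Whether position `q` of the path comes before the result of the search for the weight in
register `4`. -/
def beforeExpr (f : Column) (q : Expr) : Expr := .op .lt (weightExpr f q) (.reg 4)

theorem SearchView.eval_before_eq_zero (h : G.SearchView c e T σ) (hc : G.Searchable c f g)
    (he : e < G.numVars) (hlo : G.pathStart e ≤ q.eval σ) (hhi : q.eval σ < G.pathStart (e + 1)) :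
    (beforeExpr f q).eval σ = 0 ↔ G.pathSearch g e T ≤ q.eval σ := by
  rw [beforeExpr, Expr.eval_lt_eq_zero, hc.eval_weight h.toView (hhi.trans_le (pathStart_le he)),
    Expr.eval_reg, h.reg_four, ← not_lt, ← not_lt, lt_pathSearch_iff hc.weight he hlo hhi]

theorem SearchView.safe_before (h : G.SearchView c e T σ) (hw : G.Roomy w)
    (hc : G.Searchable c f g) (he : e < G.numVars) (hs : q.Safe w (16 * G.numVars) σ)
    (hq : q.eval σ < G.pathStart (e + 1)) : (beforeExpr f q).Safe w (16 * G.numVars) σ :=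
  ⟨hc.safe_weight h.toView hw hs (hq.trans_le (pathStart_le he)), trivial⟩

def bisectBody (f : Column) : Prog :=
  block [
    .assign 9 ((.reg 7 + .reg 8) / .const 2),
    .ite (beforeExpr f (.reg 9))
      (.assign 7 (.reg 9 + .const 1))
      (.assign 8 (.reg 9))]

/-- Bisects the interval from register `7` to register `8`, and leaves the result in both. -/
def bisect (f : Column) : Prog := .while (.op .lt (.reg 7) (.reg 8)) (bisectBody f)

/-- Registers `7` and `8` enclose the result of the search. -/
structure Enclosed (G : SLP) (g : ℕ → ℕ) (e T : ℕ) (σ : State) : Prop where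
  start_le : G.pathStart e ≤ σ.reg 7
  le_search : σ.reg 7 ≤ G.pathSearch g e T
  search_le : G.pathSearch g e T ≤ σ.reg 8
  le_end : σ.reg 8 ≤ G.pathStart (e + 1)

theorem wp_bisectBody (hw : G.Roomy w) (hc : G.Searchable c f g) (he : e < G.numVars)
    (h : G.SearchView c e T σ) (hσ : G.Enclosed g e T σ) (hlt : σ.reg 7 < σ.reg 8)
    (hi : σ.reg 8 - σ.reg 7 < 2 ^ (i + 1)) :
    (bisectBody f).WP w (16 * G.numVars) σ fun τ =>
      Agree σ τ ∧ G.Enclosed g e T τ ∧ τ.reg 8 - τ.reg 7 < 2 ^ i := by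
  obtain ⟨M, hM⟩ : ∃ M, M = (σ.reg 7 + σ.reg 8) / 2 := ⟨_, rfl⟩
  have hb := hσ.le_end.trans (pathStart_le he)
  have ⟨h1, h2, h3, h4⟩ := hσ
  have hview : G.SearchView c e T ⟨Function.update σ.reg 9 M, σ.mem⟩ :=
    h.congr (.assign (by decide))
  have hM_lo : G.pathStart e ≤ M := by omega
  have hM_hi : M < G.pathStart (e + 1) := by omega
  have hsum : σ.reg 7 + σ.reg 8 < 2 ^ w ∧ M + 1 < 2 ^ w := by unfold Roomy at hw; omega
  simp only [bisectBody, wp_block_cons, wp_assign, wp_ite, wp_block_nil, Expr.safe_div,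
    Expr.safe_add, Expr.safe_reg, Expr.safe_const, Expr.eval_div, Expr.eval_add, Expr.eval_reg,
    Expr.eval_const, ← hM, ne_eq, Function.update_self,
    hview.eval_before_eq_zero hc he (q := .reg 9) (by simpa) (by simpa)]
  refine ⟨by simpa using hsum.1, hview.safe_before hw hc he trivial (by simpa),
    fun hif => ⟨by simpa using hsum.2, .trans (.assign (by decide)) (.assign (by decide)), ?_⟩,
    fun hif => ⟨trivial, .trans (.assign (by decide)) (.assign (by decide)), ?_⟩⟩
  · rw [not_le] at hif
    refine ⟨⟨?_, ?_, ?_, ?_⟩, ?_⟩ <;> simp <;> omega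
  · refine ⟨⟨?_, ?_, ?_, ?_⟩, ?_⟩ <;> simp <;> omega

theorem runs_bisect (hw : G.Roomy w) (hc : G.Searchable c f g) (he : e < G.numVars)
    (h : G.SearchView c e T σ) (hσ : G.Enclosed g e T σ) (hi : σ.reg 8 - σ.reg 7 < 2 ^ i) :
    Runs w (16 * G.numVars) (bisect f) σ (i * ((bisectBody f).time + 4) + 4) fun τ =>
      Agree σ τ ∧ τ.reg 7 = G.pathSearch g e T := by
  let I (n : ℕ) (τ : State) : Prop := Agree σ τ ∧ G.Enclosed g e T τ ∧
    ∃ i, τ.reg 8 - τ.reg 7 < 2 ^ i ∧ n = i * ((bisectBody f).time + 4)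
  refine (Runs.while_loop hw.sixteen_lt I (fun _ _ _ => by simp) (fun n τ hI hlt => ?_) _
    ⟨⟨rfl, fun _ _ => rfl⟩, hσ, i, hi, rfl⟩).weaken le_rfl fun τ ⟨hge, _, hστ, hτ, _⟩ => ⟨hστ, ?_⟩
  · obtain ⟨hστ, hτ, i, hi, rfl⟩ := hI
    have hlt : τ.reg 7 < τ.reg 8 :=
      not_le.mp fun hge => hlt (Expr.eval_lt_eq_zero.mpr hge)
    obtain _ | i := i
    · omega
    refine ⟨_, (Runs.of_wp hw.sixteen_lt
      (wp_bisectBody hw hc he (h.congr hστ) hτ hlt hi)).weaken le_rfl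
      fun υ ⟨hτυ, hυ, hi⟩ => ⟨_, ?_, hστ.trans hτυ, hυ, i, hi, rfl⟩⟩
    change _ + _ + 4 ≤ _
    linarith
  · have hge : τ.reg 8 ≤ τ.reg 7 := Expr.eval_lt_eq_zero.mp hge
    exact hτ.le_search.antisymm (hτ.search_le.trans hge)

/-- Loads the limits of the path that ends in register `5`. -/
def loadPath : Prog :=
  block [
    .assign 2 (cellExpr .start (.reg 5)),
    .assign 3 (.reg 2 + cellExpr .size (.reg 5))]

theorem wp_loadPath (hw : G.Roomy w) (hc : G.Searchable c f g) (h : G.View c σ)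
    (he : e < G.numVars) (h5 : σ.reg 5 = e) {Q : State → Prop}
    (hQ : Q ⟨Function.update (Function.update σ.reg 2 (G.pathStart e)) 3 (G.pathStart (e + 1)),
      σ.mem⟩) : loadPath.WP w (16 * G.numVars) σ Q := by
  have hsum : G.pathStart e + G.pathSize e < 2 ^ w := by
    rw [← pathStart_succ]
    have := pathStart_le (G := G) (e := e + 1) he
    unfold Roomy at hw
    omega
  have hview := h.assign (r := 2) (v := G.pathStart e) (by decide)
  rw [pathStart_succ] at hQ
  simpa [loadPath, h.safe_cell hw, h.eval_cell, hview.safe_cell hw, hview.eval_cell, h5, he,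
    hc.start, hc.size, hsum] using hQ

/-- The width of the buckets for the weights in column `f` on the path with limits in registers `2`
and `3`. -/
def widthExpr (f : Column) : Expr :=
  weightExpr f (.reg 3 - .const 1) / (.reg 3 - .reg 2) + .const 1

end

section

variable {G : SLP} {w e k T : ℕ} {c : Column → ℕ → ℕ} {g : ℕ → ℕ} {σ τ : State}
  {f fs : Column}

theorem searchable_left (hc : ∀ f : Column, f.index < 11 → ∀ k < G.numVars, c f k = G.table f k) :
    G.Searchable c .left G.left := by
  refine ⟨pathWeight_left G, ?_, ?_, ?_, ?_, ?_⟩ <;> exact hc _ (by decide)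

theorem searchable_right (hc : ∀ f : Column, f.index < 11 → ∀ k < G.numVars, c f k = G.table f k) :
    G.Searchable c .right G.right := by
  refine ⟨pathWeight_right G, ?_, ?_, ?_, ?_, ?_⟩ <;> exact hc _ (by decide)

section

variable (hw : G.Roomy w) (hc : G.Searchable c f g) (he : e < G.numVars)
  (hlt : G.pathStart e < G.pathStart (e + 1)) (h : G.SearchView c e T σ)

include hc he hlt h

theorem SearchView.eval_lastWeight : (weightExpr f (.reg 3 - .const 1)).eval σ =
    g (G.varAt (G.pathStart (e + 1) - 1)) := by
  have hb := pathStart_le (G := G) (e := e + 1) he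
  have := h.reg_three
  rw [hc.eval_weight h.toView (by simp; omega)]
  simp [h.reg_three]

theorem SearchView.eval_width : (widthExpr f).eval σ = G.pathWidth g e := by
  simp [widthExpr, h.eval_lastWeight hc he hlt, h.reg_two, h.reg_three, pathWidth, bucketWidth]

include hw

theorem SearchView.safe_width : (widthExpr f).Safe w (16 * G.numVars) σ := by
  have hb := pathStart_le (G := G) (e := e + 1) he
  have hlast := hc.weight.le_len_last
    (varAt_lt (show G.pathStart (e + 1) - 1 < G.numVars by omega))
  have := Nat.div_le_self (g (G.varAt (G.pathStart (e + 1) - 1)))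
    (G.pathStart (e + 1) - G.pathStart e)
  have hsum : g (G.varAt (G.pathStart (e + 1) - 1)) / (G.pathStart (e + 1) - G.pathStart e) + 1
      < 2 ^ w := by unfold Roomy at hw; omega
  simp only [widthExpr, Expr.safe_add, Expr.safe_div, Expr.safe_sub, Expr.safe_reg,
    Expr.safe_const, Expr.eval_div, Expr.eval_sub, Expr.eval_reg, Expr.eval_const,
    h.eval_lastWeight hc he hlt, h.reg_two, h.reg_three]
  have := h.reg_three
  exact ⟨⟨hc.safe_weight h.toView hw (by simp) (by simp; omega), trivial, trivial⟩, by decide, hsum⟩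

end

theorem mul_pathWidth_lt {j : ℕ} (hw : G.Roomy w) (hg : G.PathWeight g) (he : e < G.numVars)
    (hlt : G.pathStart e < G.pathStart (e + 1))
    (hj : j ≤ G.pathStart (e + 1) - G.pathStart e) : j * G.pathWidth g e < 2 ^ w := by
  have hb := pathStart_le (G := G) (e := e + 1) he
  have hlast := hg.le_len_last (varAt_lt (show G.pathStart (e + 1) - 1 < G.numVars by omega))
  have hmul : j * G.pathWidth g e ≤ g (G.varAt (G.pathStart (e + 1) - 1)) +
    (G.pathStart (e + 1) - G.pathStart e) := mul_bucketWidth_le hj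
  unfold Roomy at hw
  omega

def searchStartInit (f : Column) : Prog :=
  block [
    .assign 5 (cellExpr .pathEnd (cellExpr .var (.reg 1))),
    loadPath,
    .assign 4 ((.reg 1 - .reg 2) * widthExpr f),
    .assign 7 (.reg 2),
    .assign 8 (.reg 3)]

/-- The program for a row of the column `leftStart` or `rightStart`, where `f` is `left` or
`right`, respectively. -/
def searchStartProg (f : Column) : Prog :=
  .seq (searchStartInit f) (.seq (bisect f) (.assign 2 (.reg 7)))

theorem wp_searchStartInit (hw : G.Roomy w) (hc : G.Searchable c f g) (h : G.View c σ)
    (hk : k < G.numVars) (h1 : σ.reg 1 = k) (he : G.pathEnd (G.varAt k) = e) :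
    (searchStartInit f).WP w (16 * G.numVars) σ fun τ =>
      G.SearchView c e ((k - G.pathStart e) * G.pathWidth g e) τ ∧
      τ.reg 1 = k ∧ τ.mem = σ.mem ∧ τ.reg 7 = G.pathStart e ∧ τ.reg 8 = G.pathStart (e + 1) := by
  have hvar : (cellExpr .var (.reg 1)).eval σ = G.varAt k := by
    rw [h.eval_cell (by simpa [h1]), Expr.eval_reg, h1, hc.var k hk]
  have hvark := varAt_lt hk
  have hem : e < G.numVars := he ▸ (pathEnd_le _).trans_lt hvark
  have hlo : G.pathStart e ≤ k := pos_varAt hk ▸ he ▸ pathStart_le_pos _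
  have hhi : k < G.pathStart (e + 1) := by
    simpa [pos_varAt hk, he] using pos_lt_pathStart_succ hvark
  have h5 : (cellExpr .pathEnd (cellExpr .var (.reg 1))).eval σ = e := by
    rw [h.eval_cell (hvar ▸ hvark), hvar, hc.pathEnd _ hvark, he]
  have hview := h.assign (r := 5) (v := e) (by decide)
  simp only [searchStartInit, wp_block_cons, wp_assign, h5]
  refine ⟨h.safe_cell hw (h.safe_cell hw trivial (by simpa [h1])) (hvar ▸ hvark),
    wp_loadPath hw hc hview hem (by simp) ?_⟩
  obtain ⟨τ, hτ⟩ : ∃ τ : State, τ = ⟨Function.update (Function.update (Function.update σ.reg 5 e) 2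
    (G.pathStart e)) 3 (G.pathStart (e + 1)), σ.mem⟩ := ⟨_, rfl⟩
  have hview : G.SearchView c e (τ.reg 4) τ := by
    subst hτ; exact ⟨(hview.assign (by decide)).assign (by decide), rfl, rfl, rfl⟩
  have hlt := hlo.trans_lt hhi
  have hmul := mul_pathWidth_lt (j := k - G.pathStart e) hw hc.weight hem hlt (by omega)
  have h1 : τ.reg 1 = k := by simp [hτ, h1]
  have hmem : τ.mem = σ.mem := by simp [hτ]
  rw [← hτ]
  have hpost (T : ℕ) : G.SearchView c e T ⟨Function.update (Function.update (Function.update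
      τ.reg 4 T) 7 (G.pathStart e)) 8 (G.pathStart (e + 1)), τ.mem⟩ :=
    ⟨⟨hview.reg_zero, hview.stores⟩, hview.reg_two, hview.reg_three, rfl⟩
  simpa [hview.eval_width hc hem hlt, hview.safe_width hw hc hem hlt, h1, hview.reg_two, hmul,
    hview.reg_three, hpost] using hmem

theorem computes_searchStart (hw : G.Roomy w) (hc : G.Searchable c f g) (h : G.View c σ)
    (hk : k < G.numVars) (h1 : σ.reg 1 = k) :
    Computes w (16 * G.numVars) ((searchStartInit f).time +
      ((Nat.log 2 G.numVars + 1) * ((bisectBody f).time + 4) + 4 + 2)) (searchStartProg f) σ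
      (G.searchStart g k) := by
  obtain ⟨e, he⟩ : ∃ e, G.pathEnd (G.varAt k) = e := ⟨_, rfl⟩
  have hem : e < G.numVars := he ▸ (pathEnd_le _).trans_lt (varAt_lt hk)
  refine (Runs.of_wp hw.sixteen_lt (wp_searchStartInit hw hc h hk h1 he)).seq
    fun τ ⟨hview, hτ1, hmem, h7, h8⟩ => (runs_bisect hw hc hem hview ?_ ?_).seq
      fun υ ⟨⟨hυmem, hυ⟩, hυ7⟩ => (Runs.of_wp hw.sixteen_lt ?_).weaken le_rfl fun _ => id
  · have hle := G.pathStart_mono e.le_succ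
    exact ⟨h7.ge, h7.trans_le (le_insertionPoint _ _ _ _), h8 ▸ insertionPoint_le hle, h8.le⟩
  · have hb := pathStart_le (G := G) (e := e + 1) hem
    have := Nat.lt_pow_succ_log_self one_lt_two G.numVars
    omega
  · simp [hυ, hυ7, hυmem, hmem, hview.reg_zero, h.reg_zero, hτ1, h1, searchStart, he]

end

section

variable {G : SLP} {w e j p n v T : ℕ} {c : Column → ℕ → ℕ} {g : ℕ → ℕ} {σ τ : State}
  {f fs : Column}

theorem searchStart_eq (he : e < G.numVars) (hlo : G.pathStart e ≤ p)
    (hhi : p < G.pathStart (e + 1)) :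
    G.searchStart g p = G.pathSearch g e ((p - G.pathStart e) * G.pathWidth g e) := by
  rw [searchStart, pathEnd_varAt he hlo hhi]

/-- In the interior of a bucket, a large gap between two weights bounds the number of variables on
the path. -/
theorem PathWeight.sub_pathStart_lt (hg : G.PathWeight g) (hv : v < G.numVars)
    (he : G.pathEnd v = e) (hlo : G.pathSearch g e (j * G.pathWidth g e) < p)
    (hhi : p < G.pathSearch g e ((j + 1) * G.pathWidth g e))
    (hgap : g (G.varAt (p - 1)) < g (G.varAt p)) :
    G.pathStart (e + 1) - G.pathStart e <
      2 ^ (G.level v - Nat.log 2 (g (G.varAt p) - g (G.varAt (p - 1))) + 1) := by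
  have hem : e < G.numVars := he ▸ (pathEnd_le v).trans_lt hv
  have hlt : G.pathStart e < G.pathStart (e + 1) :=
    he ▸ (pathStart_le_pos v).trans_lt (pos_lt_pathStart_succ hv)
  have hlog := log_sub_add_log_gap_le hlt (hg.monotoneOn hem) hlo hhi hgap
  have hpath : G.pathEnd (G.varAt (G.pathStart (e + 1) - 1)) = e :=
    pathEnd_varAt hem (by omega) (by omega)
  have hlast := hg.log_le_level (onPath_pathEnd (G.varAt (G.pathStart (e + 1) - 1)))
  rw [hpath, ← he, (onPath_pathEnd v).level_eq, he] at hlast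
  have hlog : _ + Nat.log 2 (g (G.varAt p) - g (G.varAt (p - 1))) ≤ _ := hlog.trans hlast
  exact (Nat.lt_pow_succ_log_self one_lt_two _).trans_le
    (Nat.pow_le_pow_right two_pos (Nat.succ_le_succ (Nat.le_sub_of_add_le hlog)))

theorem pathSearch_sub_mul_pathWidth (hg : G.PathWeight g) (he : e < G.numVars)
    (hlt : G.pathStart e < G.pathStart (e + 1)) :
    G.pathSearch g e ((G.pathStart (e + 1) - G.pathStart e) * G.pathWidth g e) =
      G.pathStart (e + 1) :=
  insertionPoint_mul_bucketWidth hlt (hg.monotoneOn he)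

/-- Loads the first position of the bucket for position `q` on the path, or the end of the path if
`q` is not less than that. -/
def loadLimit (fs : Column) (r : ℕ) (q : Expr) : Prog :=
  .ite (.op .lt q (.reg 3)) (.assign r (cellExpr fs q)) (.assign r (.reg 3))

theorem wp_loadLimit {r : ℕ} {q : Expr} {Q : State → Prop} (hw : G.Roomy w) (hg : G.PathWeight g)
    (hfs : ∀ p < G.numVars, c fs p = G.searchStart g p) (he : e < G.numVars)
    (h : G.SearchView c e T σ) (hlt : G.pathStart e < G.pathStart (e + 1))
    (hq : q.Safe w (16 * G.numVars) σ) (heval : q.eval σ = G.pathStart e + j)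
    (hj : j ≤ G.pathStart (e + 1) - G.pathStart e)
    (hQ : Q ⟨Function.update σ.reg r (G.pathSearch g e (j * G.pathWidth g e)), σ.mem⟩) :
    (loadLimit fs r q).WP w (16 * G.numVars) σ Q := by
  have hb := pathStart_le (G := G) (e := e + 1) he
  rcases hj.lt_or_eq with hj | rfl
  · have hrow : c fs (G.pathStart e + j) = G.pathSearch g e (j * G.pathWidth g e) := by
      rw [hfs _ (by omega), searchStart_eq he (by omega) (by omega), Nat.add_sub_cancel_left]
    have hmem : G.pathStart e + j < G.pathStart (e + 1) := by omega
    simpa [loadLimit, hq, h.reg_three, heval, hmem, hmem.trans_le hb, h.safe_cell hw, h.eval_cell,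
      hrow] using hQ
  · rw [pathSearch_sub_mul_pathWidth hg he hlt] at hQ
    simpa [loadLimit, hq, h.reg_three, heval, hlt.le] using hQ

/-- Encloses the result of the search for the weight in register `4` by the limits of its bucket. -/
def loadBucket (f fs : Column) : Prog :=
  block [
    .assign 9 (.reg 2 + .reg 4 / widthExpr f),
    loadLimit fs 7 (.reg 9),
    loadLimit fs 8 (.reg 9 + .const 1)]

theorem wp_loadBucket (hw : G.Roomy w) (hc : G.Searchable c f g)
    (hfs : ∀ p < G.numVars, c fs p = G.searchStart g p) (he : e < G.numVars)
    (h : G.SearchView c e T σ) (hlt : G.pathStart e < G.pathStart (e + 1))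
    (hT : T ≤ g (G.varAt (G.pathStart (e + 1) - 1))) (hj : T / G.pathWidth g e = j) :
    (loadBucket f fs).WP w (16 * G.numVars) σ fun τ => Agree σ τ ∧
      τ.reg 7 = G.pathSearch g e (j * G.pathWidth g e) ∧
      τ.reg 8 = G.pathSearch g e ((j + 1) * G.pathWidth g e) := by
  have hjlt : j < G.pathStart (e + 1) - G.pathStart e := hj ▸ div_bucketWidth_lt hlt hT
  have hb := pathStart_le (G := G) (e := e + 1) he
  have hsum : G.pathStart e + j < 2 ^ w ∧ G.pathStart e + j + 1 < 2 ^ w := by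
    unfold Roomy at hw; omega
  simp only [loadBucket, wp_block_cons, wp_block_nil, wp_assign, Expr.eval_add, Expr.eval_div,
    Expr.eval_reg, h.eval_width hc he hlt, h.reg_two, h.reg_four, hj]
  have hview : G.SearchView c e T ⟨Function.update σ.reg 9 (G.pathStart e + j), σ.mem⟩ :=
    h.congr (.assign (by decide))
  refine ⟨?_, wp_loadLimit hw hc.weight hfs he hview hlt trivial (by simp) hjlt.le
    (wp_loadLimit hw hc.weight hfs he (hview.congr (.assign (by decide))) hlt ?_
      (by simp [add_assoc]) hjlt ⟨⟨rfl, fun r hr => ?_⟩, ?_⟩)⟩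
  · simp [h.safe_width hw hc he hlt, h.eval_width hc he hlt, h.reg_two, h.reg_four, hj, hsum]
  · simp [hsum]
  · simp [Function.update_of_ne, show r ≠ 8 ∧ r ≠ 7 ∧ r ≠ 9 by omega]
  · simp

/-- Collapses the limits in registers `7` and `8` if one of them is the result of the search. -/
def narrow (f : Column) : Prog :=
  block [
    .ite (beforeExpr f (.reg 7)) .skip (.assign 8 (.reg 7)),
    .ite (beforeExpr f (.reg 8 - .const 1)) (.assign 7 (.reg 8)) .skip]

theorem wp_narrow (hw : G.Roomy w) (hc : G.Searchable c f g) (he : e < G.numVars)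
    (h : G.SearchView c e T σ) (hσ : G.Enclosed g e T σ) (hp : G.pathSearch g e T = p)
    (hlo : G.pathStart e < p) (hhi : p < G.pathStart (e + 1)) :
    (narrow f).WP w (16 * G.numVars) σ fun τ => Agree σ τ ∧ G.Enclosed g e T τ ∧
      (τ.reg 8 = τ.reg 7 ∨ σ.reg 7 < p ∧ p < σ.reg 8) := by
  subst hp
  have ⟨h1, h2, h3, h4⟩ := hσ
  have hview : G.SearchView c e T ⟨Function.update σ.reg 8 (σ.reg 7), σ.mem⟩ :=
    h.congr (.assign (by decide))
  simp only [narrow, wp_block_cons, wp_block_nil, wp_assign, wp_ite, wp_skip, ne_eq,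
    h.eval_before_eq_zero hc he (q := .reg 7) h1 (h2.trans_lt hhi),
    h.eval_before_eq_zero hc he (q := .reg 8 - .const 1) (by simp; omega) (by simp; omega)]
  refine ⟨h.safe_before hw hc he trivial (h2.trans_lt hhi), fun hlt =>
    ⟨h.safe_before hw hc he (by simp) (by simp; omega), fun hle => ?_, fun hgt => ?_⟩,
      fun heq => ?_⟩
  · simp only [Expr.eval_sub, Expr.eval_reg, Expr.eval_const] at hle
    refine ⟨trivial, .assign (by decide), ⟨?_, ?_, ?_, ?_⟩, .inl ?_⟩ <;> simp <;> omega
  · simp only [Expr.eval_sub, Expr.eval_reg, Expr.eval_const] at hlt hgt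
    exact ⟨⟨rfl, fun _ _ => rfl⟩, hσ, .inr (by omega)⟩
  · have heq : G.pathSearch g e T = σ.reg 7 := heq.antisymm h2
    have hpos : ¬ G.pathSearch g e T ≤ σ.reg 7 - 1 := by omega
    have hzero := hview.eval_before_eq_zero hc he (q := .reg 8 - .const 1) (by simp; omega)
      (by simp; omega)
    refine ⟨trivial, hview.safe_before hw hc he (by simp) (by simp; omega), fun _ =>
      ⟨trivial, .trans (.assign (by decide)) (.assign (by decide)), ⟨?_, ?_, ?_, ?_⟩, .inl ?_⟩,
      fun hle => (hpos (by simpa using hzero.mp hle)).elim⟩ <;> simp <;> omega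

/-- The search along a heavy path for a weight: `f` is the column of the weights, and `fs` that of
the bucket starts. -/
def searchPath (f fs : Column) : Prog := .seq (loadBucket f fs) (.seq (narrow f) (bisect f))

/-- A bound for the time of a search of `n + 1` bisection steps. -/
def searchTime (f fs : Column) (n : ℕ) : ℕ :=
  (loadBucket f fs).time + ((narrow f).time + ((n + 1) * ((bisectBody f).time + 4) + 4))

theorem runs_searchPath (hw : G.Roomy w) (hc : G.Searchable c f g)
    (hfs : ∀ p < G.numVars, c fs p = G.searchStart g p) (hv : v < G.numVars)
    (he : G.pathEnd v = e) (h : G.SearchView c e T σ) (hT : 0 < T) (hTv : T ≤ g v)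
    (hp : G.pathSearch g e T = p)
    (hn : G.level v - Nat.log 2 (g (G.varAt p) - g (G.varAt (p - 1))) = n) :
    Runs w (16 * G.numVars) (searchPath f fs) σ (searchTime f fs n) fun τ =>
      Agree σ τ ∧ τ.reg 7 = p := by
  have hem : e < G.numVars := he ▸ (pathEnd_le v).trans_lt hv
  obtain ⟨hlo, hhi, -, u, -, hu, hgap, hTp⟩ := hc.weight.exists_next hv he hT hTv hp
  have hlt := hlo.trans hhi
  have hTlast : T ≤ g (G.varAt (G.pathStart (e + 1) - 1)) :=
    hTp.trans (hc.weight.monotoneOn hem ⟨hlo.le, hhi⟩ ⟨by omega, by omega⟩ (by omega))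
  refine (Runs.of_wp hw.sixteen_lt (wp_loadBucket hw hc hfs hem h hlt hTlast rfl)).seq
    fun τ ⟨hστ, h7, h8⟩ => ?_
  have hτ := h.congr hστ
  have hbucket : G.Enclosed g e T τ := by
    refine ⟨h7 ▸ le_insertionPoint _ _ _ _, h7 ▸ insertionPoint_mono ?_,
      h8 ▸ insertionPoint_mono ?_, h8 ▸ insertionPoint_le hlt.le⟩
    · exact Nat.div_mul_le_self _ _
    · exact Nat.mul_comm _ _ ▸ (Nat.lt_mul_div_succ T (Nat.succ_pos _)).le
  refine (Runs.of_wp hw.sixteen_lt (wp_narrow hw hc hem hτ hbucket hp hlo hhi)).seq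
    fun υ ⟨hτυ, hυ, hwidth⟩ => (runs_bisect hw hc hem (hτ.congr hτυ) hυ ?_).weaken le_rfl
      fun _ hρ => ⟨(hστ.trans hτυ).trans hρ.1, hρ.2.trans hp⟩
  rcases hwidth with heq | hin
  · rw [heq, Nat.sub_self]; exact Nat.two_pow_pos _
  · have hshort := hc.weight.sub_pathStart_lt hv he (h7 ▸ hin.1) (h8 ▸ hin.2)
      (hu ▸ hgap.trans_le hTp)
    rw [hn] at hshort
    have := hυ.start_le
    have := hυ.le_end
    omega

end

section

/-! ## The query program -/

variable {G : SLP} {w p n v x y T : ℕ} {g : ℕ → ℕ} {σ τ : State}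
  {f fs : Column} {q : Expr}

/-- The query has reached position `y` of the string of the variable `v`. -/
structure QueryView (G : SLP) (v y : ℕ) (σ : State) : Prop extends G.View G.table σ where
  reg_one : σ.reg 1 = y
  reg_six : σ.reg 6 = v

theorem QueryView.congr (h : G.QueryView v y σ) (hmem : τ.mem = σ.mem) (h0 : τ.reg 0 = σ.reg 0)
    (h1 : τ.reg 1 = σ.reg 1) (h6 : τ.reg 6 = σ.reg 6) : G.QueryView v y τ :=
  ⟨⟨h0.trans h.reg_zero, hmem ▸ h.stores⟩, h1.trans h.reg_one, h6.trans h.reg_six⟩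

/-- The limits of the heavy path through `v` are in registers `2` and `3`, and its end is in
register `5`. -/
structure PathView (G : SLP) (v y : ℕ) (σ : State) : Prop extends G.QueryView v y σ where
  reg_two : σ.reg 2 = G.pathStart (G.pathEnd v)
  reg_three : σ.reg 3 = G.pathStart (G.pathEnd v + 1)
  reg_five : σ.reg 5 = G.pathEnd v

/-- Loads the end of the heavy path of the variable in register `6`, and the limits of the path. -/
def loadHeavyPath : Prog := .seq (.assign 5 (cellExpr .pathEnd (.reg 6))) loadPath

theorem wp_loadHeavyPath (hw : G.Roomy w) (hv : v < G.numVars) (h : G.QueryView v y σ) :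
    loadHeavyPath.WP w (16 * G.numVars) σ (G.PathView v y) := by
  have hc := searchable_left (G := G) fun _ _ _ _ => rfl
  have h6 : (Expr.reg 6).eval σ < G.numVars := h.reg_six.trans_lt hv
  have hend : (cellExpr .pathEnd (.reg 6)).eval σ = G.pathEnd v := by
    rw [h.eval_cell h6, Expr.eval_reg, h.reg_six, table_pathEnd]
  refine ⟨h.safe_cell hw trivial h6, wp_loadPath hw hc (h.toView.assign (by decide))
    ((pathEnd_le v).trans_lt hv) (by simpa) ⟨h.congr rfl rfl rfl rfl, rfl, rfl, ?_⟩⟩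
  simpa

/-- Searches the path with limits in registers `2` and `3` for the variable at which the weight in
column `f` passes the value of `q`. -/
def searchVar (f fs : Column) (q : Expr) : Prog :=
  .seq (.assign 4 q) (.seq (searchPath f fs) (.assign 5 (cellExpr .var (.reg 7))))

def searchVarTime (f fs : Column) (q : Expr) (n : ℕ) : ℕ :=
  q.cost + 1 + (searchTime f fs n + (Prog.assign 5 (cellExpr .var (.reg 7))).time)

theorem runs_searchVar (hw : G.Roomy w) (hc : G.Searchable G.table f g)
    (hfs : G.table fs = G.searchStart g) (hv : v < G.numVars) (h : G.PathView v y σ)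
    (hq : q.Safe w (16 * G.numVars) σ) (hqT : q.eval σ = T) (hT : 0 < T) (hTv : T ≤ g v)
    (hp : G.pathSearch g (G.pathEnd v) T = p)
    (hn : G.level v - Nat.log 2 (g (G.varAt p) - g (G.varAt (p - 1))) = n) :
    Runs w (16 * G.numVars) (searchVar f fs q) σ (searchVarTime f fs q n) fun τ =>
      G.QueryView v y τ ∧ τ.reg 5 = G.varAt p := by
  have hp_lt : p < G.numVars := (hc.weight.exists_next hv rfl hT hTv hp).2.1.trans_le
    (pathStart_le ((pathEnd_le v).trans_lt hv))
  have hview : G.SearchView G.table (G.pathEnd v) T ⟨Function.update σ.reg 4 T, σ.mem⟩ :=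
    ⟨h.toView.assign (by decide), h.reg_two, h.reg_three, rfl⟩
  have hset : (Prog.assign 4 q).WP w (16 * G.numVars) σ
      (· = ⟨Function.update σ.reg 4 T, σ.mem⟩) := ⟨hq, by rw [hqT]⟩
  refine (Runs.of_wp hw.sixteen_lt hset).seq fun τ hτ => ?_
  subst hτ
  refine (runs_searchPath hw hc (fun _ _ => by rw [hfs]) hv rfl hview hT hTv hp hn).seq
    fun υ ⟨hυ, h7⟩ => Runs.of_wp hw.sixteen_lt ?_
  have hview := (hview.congr hυ).toView
  refine wp_assign.mpr ⟨hview.safe_cell hw trivial (by simpa [h7]), h.congr hυ.1 ?_ ?_ ?_, ?_⟩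
  · simpa using hυ.2 0 (by decide)
  · simpa using hυ.2 1 (by decide)
  · simpa using hυ.2 6 (by decide)
  · simp [hview.eval_cell, h7, hp_lt, hc.var]

/-- How far the position sought is before the string of the end of the path. -/
def leftTarget : Expr := cellExpr .left (.reg 6) - .reg 1

/-- How far the position sought is after the string of the end of the path. -/
def rightTarget : Expr := .reg 1 + .const 1 - cellExpr .left (.reg 6) - cellExpr .len (.reg 5)

theorem QueryView.eval_left (h : G.QueryView v y σ) (hv : v < G.numVars) :
    (cellExpr .left (.reg 6)).eval σ = G.left v := by
  rw [h.eval_cell (by simpa [h.reg_six]), Expr.eval_reg, h.reg_six, table_left]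

theorem QueryView.safe_left (h : G.QueryView v y σ) (hw : G.Roomy w) (hv : v < G.numVars) :
    (cellExpr .left (.reg 6)).Safe w (16 * G.numVars) σ :=
  h.safe_cell hw trivial (by simpa [h.reg_six])

theorem PathView.eval_len (h : G.PathView v y σ) (hv : v < G.numVars) (hocc : 0 < G.occ v) :
    (cellExpr .len (.reg 5)).eval σ = G.len (G.pathEnd v) := by
  have hend := (pathEnd_le (G := G) v).trans_lt hv
  rw [h.eval_cell (by simpa [h.reg_five]), Expr.eval_reg, h.reg_five,
    table_len_of_occ_pos (hocc.trans_le (onPath_pathEnd v).occ_le)]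

theorem PathView.safe_len (h : G.PathView v y σ) (hw : G.Roomy w) (hv : v < G.numVars) :
    (cellExpr .len (.reg 5)).Safe w (16 * G.numVars) σ :=
  h.safe_cell hw trivial (by simpa [h.reg_five] using (pathEnd_le v).trans_lt hv)

theorem runs_searchLeft (hw : G.Roomy w) (hv : v < G.numVars) (hy : y < G.left v) :
    ∃ x, G.Exit v y x ∧ ∀ σ, G.PathView v y σ →
      Runs w (16 * G.numVars) (searchVar .left .leftStart leftTarget) σ
        (searchVarTime .left .leftStart leftTarget (G.level v - G.level (G.follow v y x).1))
        fun τ => G.QueryView v y τ ∧ τ.reg 5 = x := by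
  have hc := searchable_left (G := G) fun _ _ _ _ => rfl
  have hT : 0 < G.left v - y := Nat.sub_pos_of_lt hy
  obtain ⟨-, -, hpath, u, hu, hprev, hlt, hle⟩ :=
    hc.weight.exists_next hv rfl hT (Nat.sub_le _ _) rfl
  obtain ⟨hexit, hlen⟩ := exit_left hpath hu hy hlt hle
  refine ⟨_, hexit, fun σ h => runs_searchVar hw hc rfl hv h ?_ ?_ hT (Nat.sub_le _ _) rfl ?_⟩
  · simp [leftTarget, h.safe_left hw hv]
  · simp [leftTarget, h.eval_left hv, h.reg_one]
  · rw [hprev, ← hlen]; rfl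

theorem runs_searchRight (hw : G.Roomy w) (hv : v < G.numVars) (hocc : 0 < G.occ v)
    (hy : y < G.len v) (hge : G.left v + G.len (G.pathEnd v) ≤ y) :
    ∃ x, G.Exit v y x ∧ ∀ σ, G.PathView v y σ →
      Runs w (16 * G.numVars) (searchVar .right .rightStart rightTarget) σ
        (searchVarTime .right .rightStart rightTarget (G.level v - G.level (G.follow v y x).1))
        fun τ => G.QueryView v y τ ∧ τ.reg 5 = x := by
  have hc := searchable_right (G := G) fun _ _ _ _ => rfl
  have hsum : y + 1 < 2 ^ w := by
    have := len_le_of_occ_pos hv hocc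
    unfold Roomy at hw
    omega
  have hsplit := left_add_len_pathEnd_add_right G v
  have hT : 0 < y + 1 - G.left v - G.len (G.pathEnd v) := by omega
  have hTv : y + 1 - G.left v - G.len (G.pathEnd v) ≤ G.right v := by omega
  obtain ⟨-, -, hpath, u, hu, hprev, hlt, hle⟩ := hc.weight.exists_next hv rfl hT hTv rfl
  obtain ⟨hexit, hlen⟩ := exit_right hpath hu hlt hle
  refine ⟨_, hexit, fun σ h => runs_searchVar hw hc rfl hv h ?_ ?_ hT hTv rfl ?_⟩
  · simp [rightTarget, h.safe_left hw hv, h.safe_len hw hv, h.reg_one, hsum]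
  · simp [rightTarget, h.eval_left hv, h.eval_len hv hocc, h.reg_one]
  · rw [hprev, ← hlen]; rfl

/-- Whether the position sought is before the string of the end of the path. -/
def beforeEnd : Expr := .op .lt (.reg 1) (cellExpr .left (.reg 6))

/-- Whether the position sought is not after the string of the end of the path. -/
def notAfterEnd : Expr := .op .lt (.reg 1) (cellExpr .left (.reg 6) + cellExpr .len (.reg 5))

theorem PathView.eval_beforeEnd_eq_zero (h : G.PathView v y σ) (hv : v < G.numVars) :
    beforeEnd.eval σ = 0 ↔ G.left v ≤ y := by
  rw [beforeEnd, Expr.eval_lt_eq_zero, h.eval_left hv, Expr.eval_reg, h.reg_one]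

theorem PathView.safe_beforeEnd (h : G.PathView v y σ) (hw : G.Roomy w) (hv : v < G.numVars) :
    beforeEnd.Safe w (16 * G.numVars) σ :=
  ⟨trivial, h.safe_left hw hv⟩

theorem PathView.eval_notAfterEnd_eq_zero (h : G.PathView v y σ) (hv : v < G.numVars)
    (hocc : 0 < G.occ v) :
    notAfterEnd.eval σ = 0 ↔ G.left v + G.len (G.pathEnd v) ≤ y := by
  rw [notAfterEnd, Expr.eval_lt_eq_zero, Expr.eval_add, h.eval_left hv, h.eval_len hv hocc,
    Expr.eval_reg, h.reg_one]

theorem PathView.safe_notAfterEnd (h : G.PathView v y σ) (hw : G.Roomy w) (hv : v < G.numVars)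
    (hocc : 0 < G.occ v) : notAfterEnd.Safe w (16 * G.numVars) σ := by
  have hsum : G.left v + G.len (G.pathEnd v) < 2 ^ w := by
    have := len_le_of_occ_pos hv hocc
    have := left_add_len_pathEnd_add_right G v
    unfold Roomy at hw
    omega
  simp [notAfterEnd, h.safe_left hw hv, h.safe_len hw hv, h.eval_left hv, h.eval_len hv hocc, hsum]

/-- Computes in register `5` where the heavy path of the variable in register `6` is left. The
limits of the path are in registers `2` and `3`, and its end is in register `5`. -/
def searchExit : Prog :=
  .ite beforeEnd (searchVar .left .leftStart leftTarget)
    (.ite notAfterEnd .skip (searchVar .right .rightStart rightTarget))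

def searchExitTime (n : ℕ) : ℕ :=
  beforeEnd.cost + 1 +
    (notAfterEnd.cost + 1 + searchVarTime .right .rightStart rightTarget n)

theorem searchVarTime_le (n : ℕ) : searchVarTime .left .leftStart leftTarget n ≤
    searchVarTime .right .rightStart rightTarget n :=
  Nat.add_le_add_right (by decide) _

theorem runs_searchExit (hw : G.Roomy w) (ht : G.tag v = 1) (hocc : 0 < G.occ v)
    (hy : y < G.len v) :
    ∃ x, G.Exit v y x ∧ ∀ σ, G.PathView v y σ → Runs w (16 * G.numVars) searchExit σ
      (searchExitTime (G.level v - G.level (G.follow v y x).1))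
      fun τ => G.QueryView v y τ ∧ τ.reg 5 = x := by
  have hv := lt_numVars_of_tag ht
  rcases lt_or_ge y (G.left v) with hleft | hleft
  · obtain ⟨x, hx, hrun⟩ := runs_searchLeft hw hv hleft
    exact ⟨x, hx, fun σ h => .ite hw.sixteen_lt (h.safe_beforeEnd hw hv)
      (fun _ => (hrun σ h).weaken ((searchVarTime_le _).trans (Nat.le_add_left _ _)) fun _ => id)
      fun hge => (((h.eval_beforeEnd_eq_zero hv).mp hge).not_gt hleft).elim⟩
  suffices hsuff : ∃ x, G.Exit v y x ∧ ∀ σ, G.PathView v y σ →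
      Runs w (16 * G.numVars) (.ite notAfterEnd .skip (searchVar .right .rightStart rightTarget)) σ
        (notAfterEnd.cost + 1 + searchVarTime .right .rightStart rightTarget
          (G.level v - G.level (G.follow v y x).1)) fun τ => G.QueryView v y τ ∧ τ.reg 5 = x by
    obtain ⟨x, hx, hrun⟩ := hsuff
    exact ⟨x, hx, fun σ h => .ite hw.sixteen_lt (h.safe_beforeEnd hw hv)
      (fun hne => (hne ((h.eval_beforeEnd_eq_zero hv).mpr hleft)).elim) fun _ => hrun σ h⟩
  rcases lt_or_ge y (G.left v + G.len (G.pathEnd v)) with hend | hend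
  · refine ⟨_, exit_pathEnd (tag_pathEnd hv ht) hleft hend, fun σ h => .ite hw.sixteen_lt
      (h.safe_notAfterEnd hw hv hocc) (fun _ => ?_)
      fun hge => (((h.eval_notAfterEnd_eq_zero hv hocc).mp hge).not_gt hend).elim⟩
    refine (Runs.of_wp (p := .skip) hw.sixteen_lt ?_).weaken ?_ fun _ => id
    · exact ⟨h.toQueryView, h.reg_five⟩
    · exact Nat.le_add_right_of_le (Nat.le_add_left 1 _)
  · obtain ⟨x, hx, hrun⟩ := runs_searchRight hw hv hocc hy hend
    exact ⟨x, hx, fun σ h => .ite hw.sixteen_lt (h.safe_notAfterEnd hw hv hocc)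
      (fun hne => (hne ((h.eval_notAfterEnd_eq_zero hv hocc).mpr hend)).elim) fun _ => hrun σ h⟩

end

section

variable {G : SLP} {i w v x y : ℕ} {σ : State}

/-- Goes on to the child of the variable in register `5` in whose string the position in register
`1` lies. -/
def descendProg : Prog :=
  .ite (.op .lt (.reg 1) (cellExpr .len (fstExpr (.reg 5))))
    (.assign 6 (fstExpr (.reg 5)))
    (block [
      .assign 1 (.reg 1 - cellExpr .len (fstExpr (.reg 5))),
      .assign 6 (sndExpr (.reg 5))])

theorem wp_descendProg (hw : G.Roomy w) (h : G.View G.table σ) (h1 : σ.reg 1 = y)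
    (h5 : σ.reg 5 = x) (hx : G.tag x = 1) (hocc : 0 < G.occ x) :
    descendProg.WP w (16 * G.numVars) σ
      (G.QueryView (G.descend x y).1 (G.descend x y).2) := by
  have hxm := lt_numVars_of_tag hx
  have hfst_eval : (fstExpr (.reg 5)).eval σ = G.fst x := by simp [h.eval_fst, h5, hxm]
  have hfst : (fstExpr (.reg 5)).eval σ < G.numVars :=
    hfst_eval.trans_lt ((rule_of_tag_one hx).1.trans hxm)
  have hfst_safe : (fstExpr (.reg 5)).Safe w (16 * G.numVars) σ :=
    View.safe_input hw (by decide) trivial (by simpa [h5])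
  have hlen_eval : (cellExpr .len (fstExpr (.reg 5))).eval σ = G.len (G.fst x) := by
    rw [h.eval_cell hfst, hfst_eval,
      table_len_of_occ_pos (occ_pos_of_mem_children hocc (fst_mem_children hx))]
  have hlen_safe := h.safe_cell hw hfst_safe hfst (f := .len)
  simp only [descendProg, wp_block_cons, wp_block_nil, wp_assign, wp_ite, ne_eq,
    Expr.eval_lt_eq_zero, Expr.eval_sub, Expr.eval_reg, h1, hlen_eval, hfst_eval, not_le]
  refine ⟨⟨trivial, hlen_safe⟩, fun hlt => ⟨hfst_safe, ?_⟩,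
    fun hge => ⟨⟨trivial, hlen_safe⟩, ?_, ?_⟩⟩
  · rw [descend_of_lt hlt]
    exact ⟨h.assign (by decide), by simp [h1], by simp⟩
  · exact View.safe_input hw (by decide) trivial (by simpa [h5])
  · have hview : G.View G.table ⟨Function.update σ.reg 1 (y - G.len (G.fst x)), σ.mem⟩ :=
      h.assign (by decide)
    rw [descend_of_ge hge, hview.eval_snd (by simpa [h5])]
    exact ⟨hview.assign (by decide), by simp, by simp [h5]⟩

/-- Computes in register `1` the position sought in the string of the variable in register `5`. -/
def shiftProg : Prog :=
  .assign 1 (.reg 1 + cellExpr .left (.reg 5) - cellExpr .left (.reg 6))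

/-- One step of the search: along a heavy path and then to a child off the path. -/
def stepProg : Prog :=
  .seq loadHeavyPath (.seq searchExit (.seq shiftProg descendProg))

def stepTime (n : ℕ) : ℕ :=
  loadHeavyPath.time + (searchExitTime n + (shiftProg.time + descendProg.time))

theorem stepTime_le (n : ℕ) : stepTime n ≤ (n + 1) * stepTime 0 := by
  have hslope : stepTime n = stepTime 0 + n * ((bisectBody .right).time + 4) := by
    simp only [stepTime, searchExitTime, searchVarTime, searchTime]
    ring
  have hle : (bisectBody .right).time + 4 ≤ stepTime 0 := by
    simp only [stepTime, searchExitTime, searchVarTime, searchTime]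
    omega
  calc stepTime n ≤ stepTime 0 + n * stepTime 0 := by rw [hslope]; gcongr
    _ = (n + 1) * stepTime 0 := by ring

theorem wp_shiftProg (hw : G.Roomy w) (hv : v < G.numVars) (hocc : 0 < G.occ v) (hy : y < G.len v)
    (hx : x < G.numVars) (h : G.QueryView v y σ) (h5 : σ.reg 5 = x) :
    shiftProg.WP w (16 * G.numVars) σ fun τ => G.View G.table τ ∧
      τ.reg 1 = y + G.left x - G.left v ∧ τ.reg 5 = x := by
  have hsum : y + G.left x < 2 ^ w := by
    have := len_le_of_occ_pos hv hocc
    have := (pathWeight_left G).le_len_last hx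
    unfold Roomy at hw
    omega
  refine wp_assign.mpr ⟨?_, h.assign (by decide), ?_, by simpa⟩
  · simp [h.safe_cell hw, h.safe_left hw hv, h.eval_cell, h5, h.reg_one, hx, hsum]
  · simp [h.eval_left hv, h.eval_cell, h5, h.reg_one, hx]

theorem runs_stepProg (hw : G.Roomy w) (hr : G.Reaches i v y) (ht : G.tag v = 1)
    (h : G.QueryView v y σ) :
    ∃ z y', G.Reaches i z y' ∧ G.level v - G.level z + 1 + G.height z ≤ G.height v ∧
      Runs w (16 * G.numVars) stepProg σ (stepTime (G.level v - G.level z))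
        (G.QueryView z y') := by
  obtain ⟨x, hx, hrun⟩ := runs_searchExit hw ht hr.occ_pos hr.lt_len
  obtain ⟨hr', hheight⟩ := hr.follow hx
  refine ⟨_, _, hr', hheight, (Runs.of_wp hw.sixteen_lt (wp_loadHeavyPath hw hr.lt_numVars h)).seq
    fun τ hτ => (hrun τ hτ).seq fun υ ⟨hυ, h5⟩ => (Runs.of_wp hw.sixteen_lt (wp_shiftProg hw
      hr.lt_numVars hr.occ_pos hr.lt_len (lt_numVars_of_tag hx.tag_eq) hυ h5)).seq
      fun ρ ⟨hρ, h1, h5⟩ => Runs.of_wp hw.sixteen_lt (wp_descendProg hw hρ h1 h5 hx.tag_eq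
        (hr.occ_pos.trans_le hx.onPath.occ_le))⟩

/-- Repeats the step of the search until the variable in register `6` derives a single symbol. -/
def searchLoop : Prog := .while (tagExpr (.reg 6)) stepProg

def searchLoopTime (n : ℕ) : ℕ :=
  n * (stepTime 0 + ((tagExpr (.reg 6)).cost + 1)) + ((tagExpr (.reg 6)).cost + 1)

theorem runs_searchLoop (hw : G.Roomy w) (hr : G.Reaches i v y) (h : G.QueryView v y σ) :
    Runs w (16 * G.numVars) searchLoop σ (searchLoopTime (G.height v)) fun τ =>
      ∃ z y', G.Reaches i z y' ∧ G.tag z = 0 ∧ G.QueryView z y' τ := by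
  let I (n : ℕ) (τ : State) : Prop := ∃ z y', G.Reaches i z y' ∧ G.QueryView z y' τ ∧
    n = G.height z * (stepTime 0 + ((tagExpr (.reg 6)).cost + 1))
  have htag {τ : State} {z y' : ℕ} (hr : G.Reaches i z y') (h : G.QueryView z y' τ) :
      (tagExpr (.reg 6)).eval τ = G.tag z := by
    rw [h.eval_tag (e := .reg 6) (h.reg_six.trans_lt hr.lt_numVars), Expr.eval_reg, h.reg_six]
  refine (Runs.while_loop hw.sixteen_lt I ?_ ?_ _ ⟨v, y, hr, h, rfl⟩).weaken le_rfl
    fun τ ⟨h0, _, z, y', hr, hτ, _⟩ => ⟨z, y', hr, (htag hr hτ).symm.trans h0, hτ⟩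
  · rintro _ τ ⟨z, y', hr, hτ, -⟩
    exact View.safe_input hw (by decide) trivial (hτ.reg_six.trans_lt hr.lt_numVars)
  · rintro _ τ ⟨z, y', hr, hτ, rfl⟩ hne
    rw [htag hr hτ] at hne
    obtain ⟨u, x, hr', hheight, hrun⟩ :=
      runs_stepProg hw hr ((tag_eq G z).resolve_left hne) hτ
    refine ⟨_, (hrun.weaken (stepTime_le _) fun υ hυ => ⟨_, ?_, u, x, hr', hυ, rfl⟩)⟩
    have hmul := Nat.mul_le_mul_right (stepTime 0 + ((tagExpr (.reg 6)).cost + 1)) hheight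
    generalize G.level z - G.level u = d at hmul ⊢
    refine le_trans ?_ hmul
    ring_nf
    omega

/-- Starts the search at the last variable, with the position counted from `0`. -/
def queryInit : Prog :=
  block [
    .assign 1 (.reg 0 - .const 1),
    .assign 0 (.load (.const 2)),
    .assign 6 (.reg 0 - .const 1)]

/-- Outputs the symbol derived from the variable in register `6`. -/
def queryOutput : Prog := .assign 0 (fstExpr (.reg 6))

/-- The query program; its argument is a position that is counted from `1`. -/
def query : Prog := .seq queryInit (.seq searchLoop queryOutput)

def queryTime (n : ℕ) : ℕ := queryInit.time + (searchLoopTime n + queryOutput.time)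

theorem wp_queryInit {mem : ℕ → ℕ} (h : G.Stores G.table mem) (i : ℕ) :
    queryInit.WP w (16 * G.numVars) (start (i + 1) mem) (G.QueryView (G.numVars - 1) i) := by
  have := G.numVars_pos
  simp only [queryInit, wp_block_cons, wp_block_nil, wp_assign]
  have h2 : (start (i + 1) mem).mem 2 = G.numVars := h.numVars
  exact ⟨by simp, by simp; omega, by simp, ⟨by simp [h2], h⟩, by simp [start], by simp [h2]⟩

theorem runs_query (hw : G.Roomy w) {mem : ℕ → ℕ} (h : G.Stores G.table mem)
    (hi : i < G.word.length) :
    Runs w (16 * G.numVars) query (start (i + 1) mem) (queryTime (3 * Nat.log 2 G.word.length))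
      fun τ => G.word[i]? = some (τ.reg 0) := by
  rw [← len_last] at hi ⊢
  rw [← str_last, ← height_last]
  refine (Runs.of_wp hw.sixteen_lt (wp_queryInit h i)).seq fun τ hτ =>
    (runs_searchLoop hw (reaches_last hi) hτ).seq fun υ ⟨z, y, hr, hz, hυ⟩ =>
      Runs.of_wp hw.sixteen_lt (wp_assign.mpr ⟨?_, ?_⟩)
  · exact View.safe_input hw (by decide) trivial (hυ.reg_six.trans_lt hr.lt_numVars)
  · have hfst := hυ.eval_fst (e := .reg 6) (hυ.reg_six.trans_lt hr.lt_numVars)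
    simp [hr.of_tag_zero hz, hfst, hυ.reg_six]

theorem query_readOnly : query.readOnly := rfl

end

section

/-! ## The preprocessing program -/

variable {G : SLP} {w : ℕ} {σ : State} {f : Column}

/-- The program that computes a column from the earlier ones. -/
def columnProg : Column → Prog
  | .occ => .seq occInit (forRange occBody)
  | .len => fill .len lenProg
  | .pow => fill .pow powProg
  | .next => fill .next nextProg
  | .pathEnd => fill .pathEnd pathEndProg
  | .left => fill .left leftProg
  | .right => fill .right rightProg
  | .rank => fill .rank rankProg
  | .size => forRange sizeBody
  | .start => fill .start startProg
  | .var => forRange varBody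
  | .leftStart => fill .leftStart (searchStartProg .left)
  | .rightStart => fill .rightStart (searchStartProg .right)

/-- The preprocessing time up to a constant factor: `m log m` for `m` variables, with a `+ 1` that
keeps it positive for `m = 1`. -/
def workload (G : SLP) : ℕ := G.numVars * (Nat.log 2 G.numVars + 1)

theorem numVars_le_workload (G : SLP) : G.numVars ≤ G.workload :=
  Nat.le_mul_of_pos_right _ (Nat.succ_pos _)

theorem workload_pos (G : SLP) : 0 < G.workload := G.numVars_pos.trans_le G.numVars_le_workload

theorem mul_add_le_workload (b d : ℕ) : G.numVars * b + d ≤ (b + d) * G.workload := by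
  rw [add_mul, mul_comm b]
  gcongr
  exacts [G.numVars_le_workload, Nat.le_mul_of_pos_right _ G.workload_pos]

/-- The program for a column takes the table from the columns before it to the next one, within
`K` units of the workload. -/
def ColumnRuns (f : Column) (p : Prog) (K : ℕ) : Prop :=
  ∀ ⦃G : SLP⦄ ⦃w : ℕ⦄ ⦃σ : State⦄, G.Roomy w → G.View (G.partialTable f.index 0) σ →
    Runs w (16 * G.numVars) p σ (K * G.workload) (G.View (G.partialTable (f.index + 1) 0))

theorem columnRuns_fill {p : Prog} {b : ℕ}
    (hp : ∀ ⦃G : SLP⦄ ⦃w : ℕ⦄ ⦃σ : State⦄ ⦃k : ℕ⦄, G.Roomy w → k < G.numVars → σ.reg 1 = k →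
      G.View (G.partialTable f.index k) σ →
      Computes w (16 * G.numVars) b p σ (G.table f k)) :
    ColumnRuns f (fill f p) (b + 20 + 6) := fun _ _ _ hw h =>
  (runs_fill hw h fun _ _ hk h1 h => hp hw hk h1 h).weaken (mul_add_le_workload _ _) fun _ => id

theorem columnRuns_searchStart {g : SLP → ℕ → ℕ} {fs : Column}
    (hfs : ∀ G : SLP, G.table fs = G.searchStart (g G))
    (hc : ∀ (G : SLP) (k : ℕ), G.Searchable (G.partialTable fs.index k) f (g G)) :
    ColumnRuns fs (fill fs (searchStartProg f))
      ((bisectBody f).time + 4 + ((searchStartInit f).time + 26 + 6)) := by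
  intro G w σ hw h
  refine (runs_fill hw h fun σ k hk h1 h => hfs G ▸ computes_searchStart hw (hc G k) h hk h1).weaken
    ?_ fun _ => id
  have := mul_add_le_workload (G := G) ((searchStartInit f).time + 26) 6
  rw [workload] at *
  linarith

theorem exists_columnRuns (f : Column) : ∃ K, ColumnRuns f (columnProg f) K := by
  cases f with
  | occ =>
    exact ⟨_, fun _ _ _ hw h => (runs_occ hw h).weaken ((Nat.add_left_comm _ _ _).trans_le
      (mul_add_le_workload _ _)) fun _ => id⟩
  | len => exact ⟨_, columnRuns_fill fun _ _ _ _ => computes_len⟩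
  | pow => exact ⟨_, columnRuns_fill fun _ _ _ _ => computes_pow⟩
  | next => exact ⟨_, columnRuns_fill fun _ _ _ _ => computes_next⟩
  | pathEnd => exact ⟨_, columnRuns_fill fun _ _ _ _ => computes_pathEnd⟩
  | left => exact ⟨_, columnRuns_fill fun _ _ _ _ => computes_left⟩
  | right => exact ⟨_, columnRuns_fill fun _ _ _ _ => computes_right⟩
  | rank => exact ⟨_, columnRuns_fill fun _ _ _ _ => computes_rank⟩
  | size =>
    exact ⟨_, fun _ _ _ hw h => (runs_size hw h).weaken (mul_add_le_workload _ _) fun _ => id⟩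
  | start => exact ⟨_, columnRuns_fill fun _ _ _ _ => computes_start⟩
  | var =>
    exact ⟨_, fun _ _ _ hw h => (runs_var hw h).weaken (mul_add_le_workload _ _) fun _ => id⟩
  | leftStart =>
    exact ⟨_, columnRuns_searchStart (g := left) (fun _ => rfl) fun G k =>
      searchable_left fun f hf _ _ => if_pos (.inl hf)⟩
  | rightStart =>
    exact ⟨_, columnRuns_searchStart (g := right) (fun _ => rfl) fun G k =>
      searchable_right fun f hf _ _ => if_pos (.inl (hf.trans (by decide)))⟩

/-- The columns in the order in which they are computed. -/
def columns : List Column :=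
  [.occ, .len, .pow, .next, .pathEnd, .left, .right, .rank, .size, .start, .var, .leftStart,
    .rightStart]

theorem exists_runs_columns : ∀ (l : List Column) (n : ℕ),
    l.map Column.index = List.range' n l.length →
    ∃ K, ∀ ⦃G : SLP⦄ ⦃w : ℕ⦄ ⦃σ : State⦄, G.Roomy w → G.View (G.partialTable n 0) σ →
      Runs w (16 * G.numVars) (block (l.map columnProg)) σ (K * G.workload)
        (G.View (G.partialTable (n + l.length) 0))
  | [], n, _ => ⟨1, fun G w σ hw h => (Runs.of_wp (p := .skip) hw.sixteen_lt h).weaken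
      (Nat.mul_pos one_pos G.workload_pos) fun _ => id⟩
  | f :: l, n, hl => by
    simp only [List.map_cons, List.length_cons, List.range'_succ, List.cons.injEq] at hl
    obtain ⟨rfl, hl⟩ := hl
    obtain ⟨K, hK⟩ := exists_columnRuns f
    obtain ⟨L, hL⟩ := exists_runs_columns l _ hl
    refine ⟨K + L, fun G w σ hw h => ?_⟩
    rw [add_mul, List.length_cons, ← Nat.add_assoc, Nat.add_right_comm]
    exact (hK hw h).seq fun τ hτ => hL hw hτ

/-- The preprocessing program; its argument is the number of variables. -/
def preprocess : Prog :=
  .seq (.store (.const 2) (.reg 0)) (block (columns.map columnProg))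

theorem wp_storeNumVars :
    (Prog.store (.const 2) (.reg 0)).WP w (16 * G.numVars) (start G.numVars G.inputMem)
      (G.View (G.partialTable 0 0)) := by
  have := G.numVars_pos
  refine wp_store.mpr ⟨⟨by simp, by simp; omega, trivial⟩, by simp [start], by simp [start], ?_, ?_⟩
  · exact fun a _ ha => Function.update_of_ne ha _ _
  · intro f k _
    have hlt : ¬cellAddr G.numVars f k / 3 < G.numVars := by unfold cellAddr; omega
    simp [cell, start, (ne_cellAddr (by omega : 2 < 3 * G.numVars)).symm, inputMem, hlt,
      partialTable]

theorem exists_runs_preprocess : ∃ K, ∀ ⦃G : SLP⦄ ⦃w : ℕ⦄, G.Roomy w →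
    Runs w (16 * G.numVars) preprocess (start G.numVars G.inputMem) (K * G.workload)
      fun τ => G.Stores G.table τ.mem := by
  obtain ⟨K, hK⟩ := exists_runs_columns columns 0 rfl
  refine ⟨(Prog.store (.const 2) (.reg 0)).time + K, fun G w hw => ?_⟩
  refine ((Runs.of_wp hw.sixteen_lt wp_storeNumVars).seq fun τ hτ => hK hw hτ).weaken ?_
    fun τ hτ => hτ.stores.congr fun f k _ => if_pos (.inl f.index_lt)
  rw [add_mul]
  gcongr
  exact Nat.le_mul_of_pos_right _ G.workload_pos

end

section

/-! ## Bounds in terms of the size of the grammar and the length of the string -/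

variable {G : SLP} {w L t : ℕ}

theorem roomy_of_pow_le (h : (G.size + G.word.length) ^ 4 ≤ 2 ^ w) : G.Roomy w := by
  refine lt_of_lt_of_le ?_ h
  have hsize := G.two_mul_numVars_le_size
  have hvars := G.numVars_pos
  have hlen : 0 < G.word.length := G.len_last ▸ len_pos (Nat.sub_one_lt hvars.ne')
  rw [len_last]
  calc 16 * G.numVars + 4 * G.word.length + 16 < 3 ^ 3 * (G.size + G.word.length) := by omega
    _ ≤ (G.size + G.word.length) ^ 3 * (G.size + G.word.length) := by gcongr; omega
    _ = (G.size + G.word.length) ^ 4 := (pow_succ _ 3).symm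

theorem inputMem_lt (hw : G.Roomy w)
    (hterm : ∀ (k : Fin G.numVars) (a : ℕ), G.rule k = .terminal a → a < 2 ^ w) (j : ℕ) :
    G.inputMem j < 2 ^ w := by
  unfold Roomy at hw
  unfold inputMem
  split
  · next h =>
    cases hrule : G.rule ⟨j / 3, h⟩ with
    | terminal a =>
      have := hterm _ a hrule
      generalize (⟨j % 3, _⟩ : Fin 3) = i
      fin_cases i <;> simp [ruleCode, this]
    | pair l r =>
      have : l.val < j / 3 := l.isLt
      have : r.val < j / 3 := r.isLt
      generalize (⟨j % 3, _⟩ : Fin 3) = i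
      fin_cases i
      exacts [show 1 < 2 ^ w by omega, show l.val < 2 ^ w by omega, show r.val < 2 ^ w by omega]
  · omega

theorem words_start {x : ℕ} {mem : ℕ → ℕ} (hx : x < 2 ^ w) (hmem : ∀ j, mem j < 2 ^ w) :
    (start x mem).Words w :=
  State.Words.update_reg (σ := ⟨0, mem⟩) ⟨fun _ => Nat.two_pow_pos w, hmem⟩ 0 hx

theorem natLog_le_two_mul_log (n : ℕ) : (Nat.log 2 n : ℝ) ≤ 2 * Real.log n := by
  have hlog := Real.natLog_le_logb n 2
  rw [Nat.cast_ofNat, Real.logb, le_div_iff₀ (Real.log_pos one_lt_two)] at hlog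
  nlinarith [Real.log_two_gt_d9, (Nat.log 2 n).cast_nonneg (α := ℝ)]

theorem workload_le (G : SLP) : (G.workload : ℝ) ≤ 2 * (G.size * Real.log G.size) := by
  have hsize : (2 * G.numVars : ℝ) ≤ G.size := by exact_mod_cast G.two_mul_numVars_le_size
  have hvars : (1 : ℝ) ≤ G.numVars := by exact_mod_cast G.numVars_pos
  have hlog := natLog_le_two_mul_log G.numVars
  have hmono : Real.log G.numVars ≤ Real.log G.size := Real.log_le_log (by linarith) (by linarith)
  have htwo : Real.log 2 ≤ Real.log G.size := Real.log_le_log two_pos (by linarith)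
  have hgt := Real.log_two_gt_d9
  calc (G.workload : ℝ) = G.numVars * (Nat.log 2 G.numVars + 1) := by simp [workload]
    _ ≤ (G.size / 2) * (4 * Real.log G.size) := by gcongr <;> linarith
    _ = 2 * (G.size * Real.log G.size) := by ring

theorem cast_le_of_le_mul_workload (h : t ≤ L * G.workload) :
    (t : ℝ) ≤ 2 * L * (G.size * Real.log G.size) :=
  calc (t : ℝ) ≤ L * G.workload := by exact_mod_cast h
    _ ≤ L * (2 * (G.size * Real.log G.size)) := by gcongr; exact G.workload_le
    _ = 2 * L * (G.size * Real.log G.size) := by ring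

theorem cast_queryTime_le (n : ℕ) (h : queryTime 3 ≤ L) :
    (queryTime (3 * Nat.log 2 n) : ℝ) ≤ 2 * L * (1 + Real.log n) := by
  have hle : queryTime (3 * Nat.log 2 n) ≤ queryTime 3 * (1 + Nat.log 2 n) := by
    simp only [queryTime, searchLoopTime]
    ring_nf
    omega
  calc (queryTime (3 * Nat.log 2 n) : ℝ) ≤ queryTime 3 * (1 + Nat.log 2 n) := by exact_mod_cast hle
    _ ≤ L * (2 * (1 + Real.log n)) := by
      gcongr
      linarith [natLog_le_two_mul_log n]
    _ = 2 * L * (1 + Real.log n) := by ring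

end

end SLP

theorem mainTheorem4 :
    ∃ (pre query : WordRAM.Prog) (C : ℝ) (c : ℕ),
      ∀ (G : SLP) (w : ℕ),
        -- words have at least `c * log₂ (n + N)` bits, and every terminal symbol fits in a word
        (G.size + G.word.length) ^ c ≤ 2 ^ w →
        (∀ (k : Fin G.numVars) (a : ℕ), G.rule k = SLPRule.terminal a → a < 2 ^ w) →
        ∃ (s t : ℕ) (σ : WordRAM.State),
          3 * G.numVars ≤ s ∧
          (s : ℝ) ≤ C * (G.size * Real.log G.size) ∧
          (t : ℝ) ≤ C * (G.size * Real.log G.size) ∧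
          WordRAM.Exec w s pre (WordRAM.start G.numVars G.inputMem) t σ ∧
          ∀ i : Fin G.word.length,
            ∃ (u : ℕ) (τ : WordRAM.State),
              (u : ℝ) ≤ C * (1 + Real.log G.word.length) ∧
              WordRAM.Exec w s query (WordRAM.start (i.val + 1) σ.mem) u τ ∧
              τ.reg 0 = G.word.get i ∧
              τ.mem = σ.mem := by
  obtain ⟨K, hK⟩ := SLP.exists_runs_preprocess
  let L := 16 + K + SLP.queryTime 3
  refine ⟨SLP.preprocess, SLP.query, 2 * L, 4, fun G w hpow hterm => ?_⟩
  have hw := SLP.roomy_of_pow_le hpow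
  have hlt : G.numVars + G.word.length < 2 ^ w := by rw [SLP.Roomy, G.len_last] at hw; omega
  obtain ⟨t, σ, hpre, ht, hσ, hstores⟩ :=
    hK hw (SLP.words_start (by omega) (SLP.inputMem_lt hw hterm))
  refine ⟨16 * G.numVars, t, σ, by omega, ?_, ?_, hpre, fun i => ?_⟩
  · exact SLP.cast_le_of_le_mul_workload (Nat.mul_le_mul (by omega) G.numVars_le_workload)
  · exact SLP.cast_le_of_le_mul_workload (ht.trans (Nat.mul_le_mul_right _ (by omega)))
  · obtain ⟨u, τ, hquery, hu, -, hout⟩ :=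
      SLP.runs_query hw hstores i.isLt (SLP.words_start (by omega) hσ.2)
    refine ⟨u, τ, (Nat.cast_le.mpr hu).trans (SLP.cast_queryTime_le _ (by omega)), hquery, ?_,
      hquery.mem_eq SLP.query_readOnly⟩
    rw [List.getElem?_eq_getElem i.isLt, Option.some_inj] at hout
    exact hout.symm
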